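/- **Notation.** $\zeta$ is the Riemann zeta function and, for an integer $n\ge 1$, $\zeta(s,n)$ is the Hurwitz zeta function (the meromorphic continuation of $\sum_{k\ge 0}(k+n)^{-s}$). All powers of positive reals are the usual ones, $x^{w}=e^{w\log x}$. $\psi=\Gamma'/\Gamma$ is the digamma function, $\gamma$ is Euler's constant, $1_{\mathbb Z}$ is the indicator function of $\mathbb Z$ in $\mathbb R$, $(\alpha)_m=\alpha(\alpha+1)\cdots(\alpha+m-1)$, and $${}_1F_2(\alpha;\beta,\gamma';z)=\sum_{m\ge0}\frac{(\alpha)_m}{(\beta)_m(\gamma')_m}\frac{z^m}{m!}.$$ ${}_2F_1(a,b;c;\cdot)$ is the principal branch on $\mathbb C\setminus[1,\infty)$, i.e. the analytic continuation of the Gauss series from the unit disc. For $x>1$ and $\sigma\in\{1,-1\}$ put ${}_2F_1^{\sigma}(a,b;c;x)=\lim_{w\to x,\ \sigma\operatorname{Im}w>0}{}_2F_1(a,b;c;w)$, and put ${}_2F_1^{\sigma}={}_2F_1$ off $[1,\infty)$. For $a,d>0$ and $s\in\mathbb C$ let $$R_{a,0,d}(s)=s\left(\int_1^{1/a}-\int_1^{d}\right)\lfloor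 ax\rfloor\, x^{-s-1}\,dx .$$ **(1)** Let $\rho\in\mathbb C$, $\rho\ne 1$, and let $a,d>0$. The series on the right-hand side below converges absolutely, and $\zeta(\rho)=0$ if and only if $$\frac12\left(\Big(d\,\frac{a\rho}{1-\rho}+\frac12\Big)d^{-\rho}+R_{a,0,d}(\rho)\right)=\sum_{k=1}^\infty\left(-\frac{a d^{1-\rho}\rho}{1-\rho}\,{}_1F_2\Big(\tfrac{1-\rho}2;\tfrac32,1+\tfrac{1-\rho}2;-\pi^2a^2d^2k^2\Big)+a^{\rho}\,\frac{\Gamma(1-\rho)\sin(\frac{\pi}{2}\rho)}{(2\pi)^{1-\rho}k^{1-\rho}}\right).$$ Here, for $\rho\in\{2,3,4,\dots\}$, each summand (whose singularity at $\rho$ is removable) is given its limiting value. **(2)** Let $\rho\in\mathbb C\setminus\mathbb Z$, $a\in\mathbb R\setminus\{0\}$, $d>0$, let $n$ be the smallest integer with $n>|a|d$, and let $\sigma\in\{1,-1\}$. In the sum over $k\in\mathbb Z$ below, the terms with indices $k$ and $-k$ are added first, and the resulting series over $k\ge 1$ converges absolutely; so does the series on the right-hand side. Moreover $\zeta(\rho)=0$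 if and only if $$\begin{aligned}&\frac{\log 2}{d^\rho}+\big(1-1_{\mathbb Z}(ad)\big)\frac{\log\big(\sin(\pi ad)^2\big)}{2d^\rho}+\frac1{\rho d^\rho}\\&+\frac{1_{\mathbb Z}(ad)}{d^\rho}\left(\frac1\rho-\big(\psi(1+\rho)+\gamma\big)-\pi\cot(\pi\rho)+\sigma\pi i+\frac12\log\big((\pi ad)^2\big)\right)\\&+\frac1{d^\rho}\sum_{\substack{k\in\mathbb Z\\k\notin\{0,ad\}}}\frac{ad}{k}\,\frac{{}_2F_1^{\sigma}\big(1,1-\rho;2-\rho;\frac{ad}k\big)}{1-\rho}+\sigma\, i\pi|a|^\rho\,\zeta(\rho,n)\\&=-\sum_{k=1}^\infty\left(\frac1{d^\rho k}\,{}_1F_2\Big(-\tfrac\rho2;\tfrac12,1-\tfrac\rho2;-\pi^2a^2d^2k^2\Big)-|a|^\rho\,\frac{\Gamma(1-\rho)\cos(\frac\pi2\rho)}{(2\pi)^{-\rho}k^{1-\rho}}\right).\end{aligned}$$ -/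

import Mathlib

open scoped Topology

noncomputable section

namespace ZetaZeros

/-- The generalized hypergeometric series
`₁F₂(α; β, γ; z) = ∑ (α)ₙ / ((β)ₙ (γ)ₙ) * zⁿ / n!`. -/
def oneFTwo (α β γ z : ℂ) : ℂ :=
  ∑' n : ℕ, (ascPochhammer ℂ n).eval α /
    ((ascPochhammer ℂ n).eval β * (ascPochhammer ℂ n).eval γ) * (z ^ n / (n.factorial : ℂ))

/-- `F` is the analytic continuation of the Gauss series `₂F₁(a, b; c; ·)` from the open unit disc
to the cut plane `ℂ ∖ [1, ∞)`, which is the set of `z` with `1 - z ∈ Complex.slitPlane`. -/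
def IsGaussContinuation (a b c : ℂ) (F : ℂ → ℂ) : Prop :=
  AnalyticOnNhd ℂ F {z : ℂ | 1 - z ∈ Complex.slitPlane} ∧
    ∀ z : ℂ, ‖z‖ < 1 → F z = ordinaryHypergeometric a b c z

/-- The principal branch of `₂F₁(a, b; c; ·)` on `ℂ ∖ [1, ∞)`. Its values on `[1, ∞)` carry no
meaning; boundary values there are given by `gaussSide`. -/
def gaussPrincipal (a b c : ℂ) : ℂ → ℂ :=
  Classical.epsilon (IsGaussContinuation a b c)

open Classical in
/-- `₂F₁(a, b; c; z)`: the principal branch off the cut `[1, ∞)`, and on the cut the boundary value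
from the side `σ * Im z > 0`. So `σ = 1` is the limit from the upper half-plane and `σ = -1` the
limit from the lower half-plane. -/
def gaussSide (σ : ℝ) (a b c z : ℂ) : ℂ :=
  if 1 - z ∈ Complex.slitPlane then gaussPrincipal a b c z
  else Filter.limUnder (𝓝[{w : ℂ | 0 < σ * w.im}] z) (gaussPrincipal a b c)

/-- The Hurwitz zeta function `s ↦ ζ(s, n)` at a positive integer `n`: the continuation of
`∑_{k ≥ 0} (k + n)^(-s)`. See `hasSum_hurwitzNat` and `differentiableAt_hurwitzNat`. -/
def hurwitzNat (s : ℂ) (n : ℕ) : ℂ :=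
  riemannZeta s - ∑ k ∈ Finset.range (n - 1), 1 / ((k : ℂ) + 1) ^ s

theorem hasSum_hurwitzNat {s : ℂ} (hs : 1 < s.re) {n : ℕ} (hn : 1 ≤ n) :
    HasSum (fun k : ℕ => 1 / ((k : ℂ) + n) ^ s) (hurwitzNat s n) := by
  have h1 : HasSum (fun k : ℕ => 1 / ((k : ℂ) + 1) ^ s) (riemannZeta s) := by
    rw [zeta_eq_tsum_one_div_nat_add_one_cpow hs]
    have h0 := (summable_nat_add_iff 1).mpr (Complex.summable_one_div_nat_cpow.mpr hs)
    refine Summable.hasSum (h0.congr fun k => ?_)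
    push_cast
    rfl
  have h2 := (hasSum_nat_add_iff' (n - 1)).mpr h1
  have e : (fun k : ℕ => 1 / ((k : ℂ) + n) ^ s) =
      fun k : ℕ => 1 / (((k + (n - 1) : ℕ) : ℂ) + 1) ^ s := by
    funext k
    rw [Nat.cast_add, add_assoc, ← Nat.cast_add_one, Nat.sub_add_cancel hn]
  rw [e]
  exact h2

theorem differentiableAt_hurwitzNat {s : ℂ} (hs : s ≠ 1) (n : ℕ) :
    DifferentiableAt ℂ (fun w => hurwitzNat w n) s := by
  unfold hurwitzNat
  refine (differentiableAt_riemannZeta hs).sub (DifferentiableAt.fun_sum fun k _ => ?_)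
  have hk : ((k : ℂ) + 1) ≠ 0 := Nat.cast_add_one_ne_zero k
  refine (differentiableAt_const _).div (differentiableAt_id.const_cpow (Or.inl hk)) ?_
  simp [Complex.cpow_eq_zero_iff, hk]

/-- `R_{a,b,d}(s) = s (∫_1^{(1-{b})/a} - ∫_1^d) ⌊a x + {b}⌋ x^(-s-1) dx`. -/
def remainder (a b d : ℝ) (s : ℂ) : ℂ :=
  s * ((∫ x in (1 : ℝ)..((1 - Int.fract b) / a),
          ((⌊a * x + Int.fract b⌋ : ℤ) : ℂ) * (x : ℂ) ^ (-s - 1)) -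
        ∫ x in (1 : ℝ)..d, ((⌊a * x + Int.fract b⌋ : ℤ) : ℂ) * (x : ℂ) ^ (-s - 1))

/-- The `k`-th term (`k ≥ 1`) of the first `₁F₂`/Gamma series, as a formula. -/
def sineFormula (a d : ℝ) (k : ℕ) (s : ℂ) : ℂ :=
  -((a : ℂ) * (d : ℂ) ^ (1 - s) * s / (1 - s) *
      oneFTwo ((1 - s) / 2) (3 / 2) (1 + (1 - s) / 2)
        (-((Real.pi : ℂ) ^ 2 * (a : ℂ) ^ 2 * (d : ℂ) ^ 2 * (k : ℂ) ^ 2))) +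
    (a : ℂ) ^ s * (Complex.Gamma (1 - s) * Complex.sin (Real.pi / 2 * s)) /
      ((2 * (Real.pi : ℂ)) ^ (1 - s) * (k : ℂ) ^ (1 - s))

open Classical in
/-- The `k`-th term of the first `₁F₂`/Gamma series. At the integers `2, 3, 4, …` a factor of
`sineFormula` has a pole, the singularity of the whole term is removable, and the term is given its
limit. -/
def sineTerm (a d : ℝ) (k : ℕ) (s : ℂ) : ℂ :=
  if ∃ m : ℕ, 2 ≤ m ∧ s = m then Filter.limUnder (𝓝[≠] s) (sineFormula a d k) else sineFormula a d k s

/-- The `k`-th term (`k ≥ 1`) of the second `₁F₂`/Gamma series. -/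
def cosineTerm (a d : ℝ) (k : ℕ) (s : ℂ) : ℂ :=
  1 / ((d : ℂ) ^ s * k) *
      oneFTwo (-s / 2) (1 / 2) (1 - s / 2)
        (-((Real.pi : ℂ) ^ 2 * (a : ℂ) ^ 2 * (d : ℂ) ^ 2 * (k : ℂ) ^ 2)) -
    ((|a| : ℝ) : ℂ) ^ s * (Complex.Gamma (1 - s) * Complex.cos (Real.pi / 2 * s)) /
      ((2 * (Real.pi : ℂ)) ^ (-s) * (k : ℂ) ^ (1 - s))

open Classical in
/-- The term of index `k ≠ 0` of the `₂F₁` sum; the index `k = a d` is left out of the sum. -/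
def gaussTerm (σ a d : ℝ) (s : ℂ) (k : ℤ) : ℂ :=
  if (k : ℝ) = a * d then 0
  else ((a * d / k : ℝ) : ℂ) * (gaussSide σ 1 (1 - s) (2 - s) ((a * d / k : ℝ) : ℂ) / (1 - s))

/-- The indicator function of `ℤ` in `ℝ`. -/
def intIndicator (x : ℝ) : ℂ := (Set.range ((↑) : ℤ → ℝ)).indicator (fun _ => 1) x

end ZetaZeros

end

/-! ### Exponential tail integrals along vertical rays. -/

namespace ZetaZeros
open Complex Filter MeasureTheory Set

/-! Let τ = ±i and let w lie in the open quadrant Re w > 0, Re(τw) < 0, so that q = e^{2πτw} has |q|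
< 1. Two functions of w are compared. The tail sum ∑ m⁻¹ ∫_w^{w+τ∞} e^{2πmτx} x^{-s-1} dx has
derivative log(1 - q) w^{-s-1}. The function G(z) = z ₂F₁(1, 1-s; 2-s; z)/(1-s) = ∑ z^m/(m-s)
satisfies zG' = sG + z/(1-z), so by the cotangent expansion w^{-s} ∑ (G(w/k) + G(-w/k)) has
derivative w^{-s}(1/w - π cot πw). Since log(1 - q) has derivative π cot πw + πτ, a suitable
combination, `balance`, is constant in w (`hasDerivAt_balance`).

For Re s < -1 the constant is found by letting w → 0: the tails become rotated Gamma integrals and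
add up to a multiple of ζ(1-s), and everything else vanishes. Continuation in s to ℂ∖ℤ and the
functional equation give the value -πζ(s)(cot(πs/2) - σi) for τ = σi (`balance_eq_zeta`).

Letting w tend vertically to a real D > 0 gives one identity for each sign (`boundary_identity`).
Across the cut G jumps by 2πi z^s, because its only branching at 1 is a logarithm
(`exists_gaussLift_regular`). When D is an integer, the singularity of one G-term cancels that of
log(1 - q) and leaves a digamma value. The lower incomplete Gamma series, split by parity, writes
each tail through the two ₁F₂ (`expTail_eq_oneFTwo`): the difference of the two signs gives the sine
terms, the sum gives the cosine terms.

With D = ad, the difference of the identities expresses ζ(s), and it extends by continuity to every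
s ≠ 1. After Abel summation of the remainder, the two sides in (1) differ by a^ρ ζ(ρ)/2. With D =
|a|d, the mean, combined with the jumps of G and the Hurwitz term, shows that the two sides in (2)
differ by -π|a|^ρ ζ(ρ)(cot(πρ/2) - σi). The last factor equals (σi)^{-ρ}/sin(πρ/2) and never
vanishes. -/

theorem norm_cpow_le_factorial_mul_exp {z p : ℂ} (hz : z ≠ 0) {N : ℕ} (hN : |p.re| ≤ N) :
    ‖z ^ p‖ ≤ N.factorial * Real.exp (‖z‖ + ‖z‖⁻¹ + Real.pi * |p.im|) := by
  have hx : 0 < ‖z‖ := norm_pos_iff.mpr hz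
  set x := ‖z‖
  have hxi : 0 < x⁻¹ := inv_pos.mpr hx
  obtain ⟨h1, h2⟩ := abs_le.mp hN
  -- Whichever of x and x⁻¹ is at least 1 dominates. Trading the N-th power for N! e^{x + x⁻¹}
  -- leaves a majorant in which p enters only through N and |Im p|.
  have hpow : x ^ p.re ≤ (x + x⁻¹) ^ N := by
    rcases le_total 1 x with h | h
    · calc x ^ p.re ≤ x ^ (N : ℝ) := Real.rpow_le_rpow_of_exponent_le h h2
        _ = x ^ N := Real.rpow_natCast x N
        _ ≤ _ := by gcongr; linarith
    · calc x ^ p.re = x⁻¹ ^ (-p.re) := by rw [Real.inv_rpow hx.le, Real.rpow_neg hx.le, inv_inv]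
        _ ≤ x⁻¹ ^ (N : ℝ) :=
          Real.rpow_le_rpow_of_exponent_le ((one_le_inv₀ hx).mpr h) (by linarith)
        _ = x⁻¹ ^ N := Real.rpow_natCast _ N
        _ ≤ _ := by gcongr; linarith
  have hfac : (x + x⁻¹) ^ N ≤ N.factorial * Real.exp (x + x⁻¹) := by
    have := Real.pow_div_factorial_le_exp (x + x⁻¹) (by positivity) N
    rwa [div_le_iff₀' (by positivity)] at this
  have harg : -(arg z * p.im) ≤ Real.pi * |p.im| := by
    calc -(arg z * p.im) ≤ |arg z * p.im| := neg_le_abs _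
      _ = |arg z| * |p.im| := abs_mul _ _
      _ ≤ _ := by gcongr; exact abs_arg_le_pi z
  rw [norm_cpow_of_ne_zero hz, div_eq_mul_inv, ← Real.exp_neg, Real.exp_add, ← mul_assoc]
  gcongr
  exact hpow.trans hfac

theorem norm_log_le {z : ℂ} (hz : z ≠ 0) : ‖log z‖ ≤ ‖z‖ + ‖z‖⁻¹ + Real.pi := by
  have hx : 0 < ‖z‖ := norm_pos_iff.mpr hz
  have h1 : |Real.log ‖z‖| ≤ ‖z‖ + ‖z‖⁻¹ := by
    have ha := Real.log_le_sub_one_of_pos hx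
    have hb := Real.log_le_sub_one_of_pos (inv_pos.mpr hx)
    rw [Real.log_inv] at hb
    have hxi : 0 < ‖z‖⁻¹ := inv_pos.mpr hx
    rw [abs_le]
    constructor <;> linarith
  calc ‖log z‖ ≤ |(log z).re| + |(log z).im| := norm_le_abs_re_add_abs_im _
    _ ≤ _ := by
      rw [log_re, log_im]
      exact add_le_add h1 (abs_arg_le_pi z)

/-- The integral `∫_0^∞ e^{-cu} (w + τ u)^p du`. -/
noncomputable def tailIntegral (c : ℝ) (τ p w : ℂ) : ℂ :=
  ∫ u in Ioi (0 : ℝ), cexp (-(c * u)) * (w + τ * u) ^ p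

variable {τ : ℂ}

theorem mul_self_eq_neg_one (hτ : τ = I ∨ τ = -I) : τ * τ = -1 := by
  rcases hτ with rfl | rfl <;> simp

theorem norm_direction (hτ : τ = I ∨ τ = -I) : ‖τ‖ = 1 := by
  rcases hτ with rfl | rfl <;> simp

theorem re_add_direction_mul (hτ : τ = I ∨ τ = -I) (w : ℂ) (u : ℝ) : (w + τ * u).re = w.re := by
  rcases hτ with rfl | rfl <;> simp

theorem direction_ne_zero (hτ : τ = I ∨ τ = -I) : τ ≠ 0 := by
  rcases hτ with rfl | rfl <;> simp

theorem ray_mem_slitPlane (hτ : τ = I ∨ τ = -I) {w : ℂ} (hw : 0 < w.re) (u : ℝ) :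
    w + τ * u ∈ slitPlane :=
  Or.inl (by rwa [re_add_direction_mul hτ])

theorem norm_ray_le (hτ : τ = I ∨ τ = -I) (w : ℂ) {u : ℝ} (hu : 0 ≤ u) :
    ‖w + τ * u‖ ≤ ‖w‖ + u := by
  refine (norm_add_le _ _).trans ?_
  rw [norm_mul, norm_direction hτ, one_mul, norm_real, Real.norm_of_nonneg hu]

theorem norm_ray_inv_le (hτ : τ = I ∨ τ = -I) {w : ℂ} {δ : ℝ} (hδ : 0 < δ) (hw : δ ≤ w.re)
    (u : ℝ) : ‖w + τ * u‖⁻¹ ≤ δ⁻¹ := by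
  gcongr
  calc δ ≤ (w + τ * u).re := by rwa [re_add_direction_mul hτ]
    _ ≤ _ := re_le_norm _

theorem continuous_tail_integrand (hτ : τ = I ∨ τ = -I) {w : ℂ} (hw : 0 < w.re) (c : ℝ) (p : ℂ) :
    Continuous fun u : ℝ => cexp (-(c * u)) * (w + τ * u) ^ p := by
  refine (by fun_prop : Continuous fun u : ℝ => cexp (-(c * u))).mul ?_
  exact (by fun_prop : Continuous fun u : ℝ => w + τ * u).cpow continuous_const
    fun u => ray_mem_slitPlane hτ hw u

/-- A constant that dominates the integrand of `tailIntegral` locally uniformly. -/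
noncomputable def tailConst (N : ℕ) (δ R B : ℝ) : ℝ :=
  N.factorial * Real.exp (R + δ⁻¹ + Real.pi * B)

/-- Along the ray the norm grows at most like ‖w‖ + u and its inverse stays below δ⁻¹, so the power
costs a single factor e^u whatever the exponent. Every rate c > 1 is therefore admissible, and
integration leaves the decay 1/(c - 1). -/
theorem norm_ray_cpow_le (hτ : τ = I ∨ τ = -I) {w p : ℂ} {δ R B : ℝ} {N : ℕ} (hδ : 0 < δ)
    (hw : δ ≤ w.re) (hR : ‖w‖ ≤ R) (hN : |p.re| ≤ N) (hB : |p.im| ≤ B) {u : ℝ} (hu : 0 ≤ u) :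
    ‖(w + τ * u) ^ p‖ ≤ tailConst N δ R B * Real.exp u := by
  refine (norm_cpow_le_factorial_mul_exp
    (slitPlane_ne_zero (ray_mem_slitPlane hτ (hδ.trans_le hw) u)) hN).trans ?_
  rw [tailConst, mul_assoc, ← Real.exp_add]
  have h1 := norm_ray_le hτ w hu
  have h2 := norm_ray_inv_le hτ hδ hw u
  have h3 : Real.pi * |p.im| ≤ Real.pi * B := by gcongr
  refine mul_le_mul_of_nonneg_left (Real.exp_le_exp.mpr ?_) (Nat.cast_nonneg _)
  linarith

theorem norm_exp_neg_mul (c u : ℝ) : ‖cexp (-(c * u))‖ = Real.exp (-(c * u)) := by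
  rw [← ofReal_mul, ← ofReal_neg, norm_exp_ofReal]

theorem norm_tail_integrand_le (hτ : τ = I ∨ τ = -I) {w p : ℂ} {δ R B : ℝ} {N : ℕ} (c : ℝ)
    (hδ : 0 < δ)
    (hw : δ ≤ w.re) (hR : ‖w‖ ≤ R) (hN : |p.re| ≤ N) (hB : |p.im| ≤ B) {u : ℝ} (hu : 0 ≤ u) :
    ‖cexp (-(c * u)) * (w + τ * u) ^ p‖ ≤ tailConst N δ R B * Real.exp (-(c - 1) * u) := by
  rw [norm_mul, norm_exp_neg_mul]
  calc _ ≤ Real.exp (-(c * u)) * (tailConst N δ R B * Real.exp u) := by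
        gcongr; exact norm_ray_cpow_le hτ hδ hw hR hN hB hu
    _ = _ := by
        rw [mul_left_comm, ← Real.exp_add]; ring_nf

theorem integrableOn_tail_integrand (hτ : τ = I ∨ τ = -I) {w : ℂ} (p : ℂ) (hw : 0 < w.re) {c : ℝ}
    (hc : 1 < c) : IntegrableOn (fun u : ℝ => cexp (-(c * u)) * (w + τ * u) ^ p) (Ioi 0) := by
  refine Integrable.mono' ((integrableOn_exp_mul_Ioi (a := -(c - 1)) (by linarith) 0).const_mul
    (tailConst ⌈|p.re|⌉₊ w.re ‖w‖ |p.im|))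
    (continuous_tail_integrand hτ hw c p).aestronglyMeasurable ?_
  refine (ae_restrict_mem measurableSet_Ioi).mono fun u hu => ?_
  exact norm_tail_integrand_le hτ c hw le_rfl le_rfl (Nat.le_ceil _) le_rfl (le_of_lt hu)

theorem norm_tailIntegral_le (hτ : τ = I ∨ τ = -I) {w p : ℂ} {δ R B : ℝ} {N : ℕ} {c : ℝ}
    (hc : 1 < c) (hδ : 0 < δ)
    (hw : δ ≤ w.re) (hR : ‖w‖ ≤ R) (hN : |p.re| ≤ N) (hB : |p.im| ≤ B) :
    ‖tailIntegral c τ p w‖ ≤ tailConst N δ R B / (c - 1) := by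
  have hi := (integrableOn_exp_mul_Ioi (a := -(c - 1)) (by linarith) 0).const_mul
    (tailConst N δ R B)
  refine (norm_integral_le_of_norm_le hi ?_).trans_eq ?_
  · refine (ae_restrict_mem measurableSet_Ioi).mono fun u hu => ?_
    exact norm_tail_integrand_le hτ c hδ hw hR hN hB (le_of_lt hu)
  · rw [integral_const_mul, integral_exp_mul_Ioi (by linarith)]
    simp [div_eq_mul_inv, neg_sub, ← inv_neg]

theorem hasDerivAt_tailIntegral (hτ : τ = I ∨ τ = -I) {w : ℂ} (p : ℂ) {c : ℝ}
    (hc : 1 < c) (hw : 0 < w.re) :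
    HasDerivAt (tailIntegral c τ p) (p * tailIntegral c τ (p - 1) w) w := by
  have hopen : {v : ℂ | w.re / 2 < v.re ∧ ‖v‖ < ‖w‖ + 1} ∈ 𝓝 w :=
    ((isOpen_lt continuous_const continuous_re).inter
      (isOpen_lt continuous_norm continuous_const)).mem_nhds ⟨by simp; linarith, by simp⟩
  have key := (hasDerivAt_integral_of_dominated_loc_of_deriv_le
    (μ := volume.restrict (Ioi (0 : ℝ))) (x₀ := w)
    (F := fun v u => cexp (-(c * u)) * (v + τ * u) ^ p)
    (F' := fun v u => p * (cexp (-(c * u)) * (v + τ * u) ^ (p - 1)))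
    (bound := fun u => ‖p‖ * (tailConst ⌈|(p - 1).re|⌉₊ (w.re / 2) (‖w‖ + 1) |(p - 1).im| *
      Real.exp (-(c - 1) * u)))
    hopen ?_ (integrableOn_tail_integrand hτ p hw hc) ?_ ?_ ?_ ?_).2
  · rw [integral_const_mul] at key
    exact key
  · filter_upwards [hopen] with v hv
    exact (continuous_tail_integrand hτ (by linarith [hv.1]) c p).aestronglyMeasurable
  · exact ((continuous_tail_integrand hτ hw c (p - 1)).const_mul p).aestronglyMeasurable
  · refine (ae_restrict_mem measurableSet_Ioi).mono fun u hu v hv => ?_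
    rw [norm_mul]
    gcongr
    exact norm_tail_integrand_le hτ c (by linarith) hv.1.le hv.2.le (Nat.le_ceil _) le_rfl
      (le_of_lt hu)
  · exact ((integrableOn_exp_mul_Ioi (by linarith) 0).const_mul _).const_mul _
  · refine (ae_restrict_mem measurableSet_Ioi).mono fun u hu v hv => ?_
    have hv0 : 0 < v.re := by linarith [hv.1]
    have h := ((hasDerivAt_id' v).add_const (τ * u)).cpow_const (c := p)
      (ray_mem_slitPlane hτ hv0 u)
    exact (h.const_mul (cexp (-(c * u)))).congr_deriv (by ring)

theorem differentiable_tailIntegral_exponent (hτ : τ = I ∨ τ = -I) {w : ℂ} {c : ℝ}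
    (hc : 2 < c) (hw : 0 < w.re) : Differentiable ℂ fun p => tailIntegral c τ p w := by
  intro p
  have hopen : Metric.ball p 1 ∈ 𝓝 p := Metric.ball_mem_nhds _ one_pos
  refine (hasDerivAt_integral_of_dominated_loc_of_deriv_le
    (μ := volume.restrict (Ioi (0 : ℝ))) (x₀ := p)
    (F := fun q u => cexp (-(c * u)) * (w + τ * u) ^ q)
    (F' := fun q u => cexp (-(c * u)) * (w + τ * u) ^ q * log (w + τ * u))
    (bound := fun u => tailConst ⌈|p.re| + 1⌉₊ w.re ‖w‖ (|p.im| + 1) *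
      Real.exp (‖w‖ + w.re⁻¹ + Real.pi) * Real.exp (-(c - 2) * u))
    hopen ?_ (integrableOn_tail_integrand hτ p hw (by linarith)) ?_ ?_ ?_ ?_).2.differentiableAt
  · exact Eventually.of_forall fun q =>
      (continuous_tail_integrand hτ hw c q).aestronglyMeasurable
  · exact ((continuous_tail_integrand hτ hw c p).mul
      ((by fun_prop : Continuous fun u : ℝ => w + τ * u).clog
        fun u => ray_mem_slitPlane hτ hw u)).aestronglyMeasurable
  · refine (ae_restrict_mem measurableSet_Ioi).mono fun u hu q hq => ?_
    have hu0 : (0 : ℝ) ≤ u := le_of_lt hu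
    have hd : ‖q - p‖ < 1 := by rwa [← dist_eq_norm]
    have h1 : |q.re| ≤ |p.re| + 1 := by
      have := (abs_re_le_norm (q - p)).trans hd.le
      have h2 := abs_sub_abs_le_abs_sub q.re p.re
      rw [sub_re] at this
      linarith
    have h2 : |q.im| ≤ |p.im| + 1 := by
      have := (abs_im_le_norm (q - p)).trans hd.le
      have h2 := abs_sub_abs_le_abs_sub q.im p.im
      rw [sub_im] at this
      linarith
    -- Differentiation in the exponent brings down a logarithm, which costs a second factor e^u;
    -- this is why c > 2 is required.
    have hlog : ‖log (w + τ * u)‖ ≤ Real.exp (‖w‖ + w.re⁻¹ + Real.pi) * Real.exp u := by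
      rw [← Real.exp_add]
      refine (norm_log_le (slitPlane_ne_zero (ray_mem_slitPlane hτ hw u))).trans ?_
      refine le_trans ?_ (Real.add_one_le_exp _)
      have := norm_ray_le hτ w hu0
      have := norm_ray_inv_le hτ hw le_rfl u
      linarith
    rw [norm_mul]
    calc _ ≤ (tailConst ⌈|p.re| + 1⌉₊ w.re ‖w‖ (|p.im| + 1) * Real.exp (-(c - 1) * u)) *
          (Real.exp (‖w‖ + w.re⁻¹ + Real.pi) * Real.exp u) := by
            refine mul_le_mul (norm_tail_integrand_le hτ c hw le_rfl le_rfl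
              (h1.trans (Nat.le_ceil _)) h2 hu0) hlog (norm_nonneg _) ?_
            unfold tailConst; positivity
      _ = _ := by
          rw [show -(c - 2) * u = -(c - 1) * u + u by ring, Real.exp_add (-(c - 1) * u)]; ring
  · exact (integrableOn_exp_mul_Ioi (by linarith) 0).const_mul _
  · refine (ae_restrict_mem measurableSet_Ioi).mono fun u hu q hq => ?_
    have h := (hasDerivAt_id' q).const_cpow (c := w + τ * u)
      (Or.inl (slitPlane_ne_zero (ray_mem_slitPlane hτ hw u)))
    exact (h.const_mul (cexp (-(c * u)))).congr_deriv (by ring)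

/-- Integration by parts: e^{-cu}(w + τu)^p equals w^p at u = 0 and vanishes at infinity. -/
theorem tailIntegral_recurrence (hτ : τ = I ∨ τ = -I) {w : ℂ} (p : ℂ) {c : ℝ}
    (hc : 1 < c) (hw : 0 < w.re) :
    τ * p * tailIntegral c τ (p - 1) w = c * tailIntegral c τ p w - w ^ p := by
  have hint := ((integrableOn_tail_integrand hτ p hw hc).const_mul (-(c : ℂ))).add
    ((integrableOn_tail_integrand hτ (p - 1) hw hc).const_mul (τ * p))
  have hd : ∀ u ∈ Ici (0 : ℝ), HasDerivAt (fun u : ℝ => cexp (-(c * u)) * (w + τ * u) ^ p)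
      (-(c : ℂ) * (cexp (-(c * u)) * (w + τ * u) ^ p) +
        τ * p * (cexp (-(c * u)) * (w + τ * u) ^ (p - 1))) u := by
    intro u _
    have h1 : HasDerivAt (fun v : ℂ => w + τ * v) τ (u : ℂ) := by
      simpa using ((hasDerivAt_id (u : ℂ)).const_mul τ).const_add w
    have h2 := h1.cpow_const (c := p) (ray_mem_slitPlane hτ hw u)
    have h3 : HasDerivAt (fun v : ℂ => cexp (-(c * v))) (cexp (-(c * u)) * (-c)) (u : ℂ) := by
      simpa using ((hasDerivAt_id (u : ℂ)).const_mul (c : ℂ)).neg.cexp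
    exact (h3.fun_mul h2).comp_ofReal.congr_deriv (by ring)
  have hlim : Tendsto (fun u : ℝ => cexp (-(c * u)) * (w + τ * u) ^ p) atTop (𝓝 0) := by
    have hb : Tendsto (fun u : ℝ => tailConst ⌈|p.re|⌉₊ w.re ‖w‖ |p.im| *
        Real.exp (-(c - 1) * u)) atTop (𝓝 0) := by
      have : Tendsto (fun u : ℝ => -(c - 1) * u) atTop atBot :=
        tendsto_id.const_mul_atTop_of_neg (by linarith)
      simpa using (Real.tendsto_exp_atBot.comp this).const_mul
        (tailConst ⌈|p.re|⌉₊ w.re ‖w‖ |p.im|)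
    refine squeeze_zero_norm' ?_ hb
    filter_upwards [eventually_ge_atTop 0] with u hu
    exact norm_tail_integrand_le hτ c hw le_rfl le_rfl (Nat.le_ceil _) le_rfl hu
  have key := integral_Ioi_of_hasDerivAt_of_tendsto' hd hint hlim
  change ∫ u in Ioi (0 : ℝ), (_ + _) = _ at key
  rw [integral_add ((integrableOn_tail_integrand hτ p hw hc).const_mul _)
    ((integrableOn_tail_integrand hτ (p - 1) hw hc).const_mul _), integral_const_mul,
    integral_const_mul] at key
  simp only [ofReal_zero, mul_zero, neg_zero, Complex.exp_zero, one_mul, add_zero] at key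
  rw [tailIntegral, tailIntegral]
  linear_combination key

/-- The tail `∫_w^{w + τ∞} e^{τ c x} x^p dx`. -/
noncomputable def expTail (c : ℝ) (τ p w : ℂ) : ℂ :=
  τ * cexp (c * τ * w) * tailIntegral c τ p w

/-- Only the lower endpoint of the tail moves. In the product rule the integral with exponent p - 1
is removed by `tailIntegral_recurrence`, and τ² = -1 cancels what is left of the integral with
exponent p. -/
theorem hasDerivAt_expTail (hτ : τ = I ∨ τ = -I) {w : ℂ} (p : ℂ) {c : ℝ}
    (hc : 1 < c) (hw : 0 < w.re) :
    HasDerivAt (expTail c τ p) (-(cexp (c * τ * w) * w ^ p)) w := by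
  have h1 : HasDerivAt (fun v => τ * cexp (c * τ * v)) (τ * (cexp (c * τ * w) * (c * τ))) w := by
    simpa using (((hasDerivAt_id w).const_mul (c * τ)).cexp).const_mul τ
  refine (h1.fun_mul (hasDerivAt_tailIntegral hτ p hc hw)).congr_deriv ?_
  have h3 := tailIntegral_recurrence hτ p hc hw
  have h4 := mul_self_eq_neg_one hτ
  linear_combination cexp (c * τ * w) * h3 + cexp (c * τ * w) * c * tailIntegral c τ p w * h4

theorem norm_exp_direction_le {w : ℂ} {c : ℝ} (hc : 0 ≤ c)
    (hw : (τ * w).re ≤ 0) : ‖cexp (c * τ * w)‖ ≤ 1 := by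
  rw [norm_exp, Real.exp_le_one_iff, mul_assoc, re_ofReal_mul]
  exact mul_nonpos_of_nonneg_of_nonpos hc hw

theorem norm_expTail_le (hτ : τ = I ∨ τ = -I) {w p : ℂ} {δ R B : ℝ} {N : ℕ} {c : ℝ}
    (hc : 1 < c) (hδ : 0 < δ) (hτw : (τ * w).re ≤ 0)
    (hw : δ ≤ w.re) (hR : ‖w‖ ≤ R) (hN : |p.re| ≤ N) (hB : |p.im| ≤ B) :
    ‖expTail c τ p w‖ ≤ tailConst N δ R B / (c - 1) := by
  rw [expTail, norm_mul, norm_mul, norm_direction hτ, one_mul]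
  calc _ ≤ 1 * (tailConst N δ R B / (c - 1)) :=
        mul_le_mul (norm_exp_direction_le (by linarith) hτw)
          (norm_tailIntegral_le hτ hc hδ hw hR hN hB) (norm_nonneg _) zero_le_one
    _ = _ := one_mul _

end ZetaZeros
-- The sum of the tails: holomorphy, derivative and limits.
namespace ZetaZeros
open Complex Filter MeasureTheory Set

theorem ofReal_mul_cpow {r : ℝ} (hr : 0 < r) {z : ℂ} (hz : z ≠ 0) (p : ℂ) :
    ((r : ℂ) * z) ^ p = (r : ℂ) ^ p * z ^ p := by
  have hr' : (r : ℂ) ≠ 0 := ofReal_ne_zero.mpr hr.ne'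
  rw [cpow_def_of_ne_zero (mul_ne_zero hr' hz), cpow_def_of_ne_zero hr', cpow_def_of_ne_zero hz,
    log_ofReal_mul hr hz, ofReal_log hr.le, ← Complex.exp_add, add_mul]

variable {τ : ℂ}

/-- The frequency `2π(k+1)`. -/
noncomputable def freq (k : ℕ) : ℝ := 2 * Real.pi * (k + 1)

theorem succ_le_freq_sub_one (k : ℕ) : (k : ℝ) + 1 ≤ freq k - 1 := by
  unfold freq
  nlinarith [Real.pi_gt_three, Nat.cast_nonneg (α := ℝ) k]

theorem freq_pos (k : ℕ) : 0 < freq k := by unfold freq; positivity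

theorem two_lt_freq (k : ℕ) : 2 < freq k := by
  unfold freq
  nlinarith [Real.pi_gt_three, Nat.cast_nonneg (α := ℝ) k]

theorem tailConst_nonneg (N : ℕ) (δ R B : ℝ) : 0 ≤ tailConst N δ R B := by
  unfold tailConst; positivity

theorem summable_one_div_succ_sq : Summable fun k : ℕ => 1 / ((k : ℝ) + 1) ^ 2 := by
  have := (summable_nat_add_iff 1).mpr (Real.summable_one_div_nat_pow.mpr one_lt_two)
  simpa using this

/-- The `k`-th tail `(k+1)⁻¹ ∫_w^{w + τ∞} e^{2π(k+1)τ x} x^{-s-1} dx`. -/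
noncomputable def tailTerm (τ s w : ℂ) (k : ℕ) : ℂ := expTail (freq k) τ (-s - 1) w / (k + 1)

/-- The sum over `k` of the tails. -/
noncomputable def tailSum (τ s w : ℂ) : ℂ := ∑' k, tailTerm τ s w k

/-- As `freq k - 1` is at least k + 1, the decay 1/(c - 1) of a tail and the weight 1/(k + 1)
together give a convergent majorant. No smallness of |q| is needed, so the real axis is included. -/
theorem div_succ_sq_bound {A : ℂ} {C : ℝ} (hC : 0 ≤ C) (k : ℕ) (h : ‖A‖ ≤ C / (freq k - 1)) :
    ‖A / (k + 1)‖ ≤ C * (1 / ((k : ℝ) + 1) ^ 2) := by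
  have h0 : (0 : ℝ) < k + 1 := by positivity
  have h1 := succ_le_freq_sub_one k
  have h2 : ‖((k : ℂ) + 1)‖ = k + 1 := by
    rw [← Nat.cast_add_one, norm_natCast, Nat.cast_add_one]
  rw [norm_div, h2, div_le_iff₀ h0]
  refine h.trans ?_
  calc C / (freq k - 1) ≤ C / (k + 1) := by gcongr
    _ = _ := by field_simp

theorem norm_tailTerm_le (hτ : τ = I ∨ τ = -I) {w s : ℂ} {δ R B : ℝ} {N : ℕ}
    (hδ : 0 < δ) (hτw : (τ * w).re ≤ 0)
    (hw : δ ≤ w.re) (hR : ‖w‖ ≤ R) (hN : |s.re| + 1 ≤ N) (hB : |s.im| ≤ B) (k : ℕ) :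
    ‖tailTerm τ s w k‖ ≤ tailConst N δ R B * (1 / ((k : ℝ) + 1) ^ 2) := by
  refine div_succ_sq_bound (tailConst_nonneg _ _ _ _) k ?_
  refine norm_expTail_le hτ (by linarith [two_lt_freq k]) hδ hτw hw hR (le_trans ?_ hN) ?_
  · simp only [sub_re, neg_re, one_re]
    have := abs_sub (-s.re) 1
    simpa using this
  · simpa using hB

theorem summable_tailTerm (hτ : τ = I ∨ τ = -I) {w : ℂ} (s : ℂ) (hw : 0 < w.re)
    (hτw : (τ * w).re ≤ 0) : Summable (tailTerm τ s w) :=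
  .of_norm_bounded (summable_one_div_succ_sq.mul_left _)
    (norm_tailTerm_le hτ hw hτw le_rfl le_rfl (Nat.le_ceil _) le_rfl)

theorem differentiable_expTail_exponent (hτ : τ = I ∨ τ = -I) {w : ℂ} {c : ℝ} (hc : 2 < c)
    (hw : 0 < w.re) : Differentiable ℂ fun s => expTail c τ (-s - 1) w := by
  unfold expTail
  exact ((differentiable_tailIntegral_exponent hτ hc hw).comp (by fun_prop)).const_mul _

theorem differentiable_tailSum (hτ : τ = I ∨ τ = -I) {w : ℂ} (hw : 0 < w.re)
    (hτw : (τ * w).re ≤ 0) : Differentiable ℂ fun s => tailSum τ s w := by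
  intro s
  refine (differentiableOn_tsum_of_summable_norm (U := Metric.ball s 1)
    (summable_one_div_succ_sq.mul_left
      (tailConst ⌈|s.re| + 2⌉₊ w.re ‖w‖ (|s.im| + 1)))
    (fun k => ?_) Metric.isOpen_ball (fun k t ht => ?_)).differentiableAt
    (Metric.ball_mem_nhds _ one_pos)
  · exact ((differentiable_expTail_exponent hτ (two_lt_freq k) hw).div_const _).differentiableOn
  · have hd : ‖t - s‖ < 1 := by rwa [← dist_eq_norm]
    refine norm_tailTerm_le hτ hw hτw le_rfl le_rfl (le_trans ?_ (Nat.le_ceil _)) ?_ k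
    · have := (abs_re_le_norm (t - s)).trans hd.le
      have h2 := abs_sub_abs_le_abs_sub t.re s.re
      rw [sub_re] at this
      linarith
    · have := (abs_im_le_norm (t - s)).trans hd.le
      have h2 := abs_sub_abs_le_abs_sub t.im s.im
      rw [sub_im] at this
      linarith

theorem norm_nome_lt_one {w : ℂ} (hτw : (τ * w).re < 0) : ‖cexp (2 * Real.pi * τ * w)‖ < 1 := by
  rw [norm_exp, Real.exp_lt_one_iff, mul_assoc, ← ofReal_ofNat, ← ofReal_mul, re_ofReal_mul]
  exact mul_neg_of_pos_of_neg Real.two_pi_pos hτw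

/-- By Weierstrass' theorem the locally uniformly convergent series may be differentiated term by
term, and the derivatives add up by the Taylor series of log(1 - q). -/
theorem hasDerivAt_tailSum (hτ : τ = I ∨ τ = -I) {w : ℂ} (s : ℂ) (hw : 0 < w.re)
    (hτw : (τ * w).re < 0) :
    HasDerivAt (tailSum τ s) (log (1 - cexp (2 * Real.pi * τ * w)) * w ^ (-s - 1)) w := by
  set U : Set ℂ := {v | w.re / 2 < v.re ∧ ‖v‖ < ‖w‖ + 1 ∧ (τ * v).re < 0}
  have hU : IsOpen U := (isOpen_lt continuous_const continuous_re).inter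
    ((isOpen_lt continuous_norm continuous_const).inter
      (isOpen_lt (continuous_re.comp (continuous_const_mul τ)) continuous_const))
  have hwU : w ∈ U := ⟨by linarith, by linarith, hτw⟩
  have hd : ∀ k, ∀ v ∈ U, HasDerivAt (fun v => tailTerm τ s v k)
      (-(cexp (freq k * τ * v) * v ^ (-s - 1)) / (k + 1)) v := fun k v hv =>
    (hasDerivAt_expTail hτ (-s - 1) (by linarith [two_lt_freq k]) (by linarith [hv.1])).div_const _
  have hu := summable_one_div_succ_sq.mul_left
    (tailConst ⌈|s.re| + 1⌉₊ (w.re / 2) (‖w‖ + 1) |s.im|)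
  have hdo : ∀ k : ℕ, DifferentiableOn ℂ (fun v => tailTerm τ s v k) U :=
    fun k v hv => (hd k v hv).differentiableAt.differentiableWithinAt
  have hle : ∀ (k : ℕ), ∀ v ∈ U, ‖tailTerm τ s v k‖ ≤
      tailConst ⌈|s.re| + 1⌉₊ (w.re / 2) (‖w‖ + 1) |s.im| * (1 / ((k : ℝ) + 1) ^ 2) :=
    fun k v hv => norm_tailTerm_le hτ (by linarith) hv.2.2.le hv.1.le hv.2.1.le
      (Nat.le_ceil _) le_rfl k
  have h1 := (differentiableOn_tsum_of_summable_norm hu hdo hU hle).differentiableAt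
    (hU.mem_nhds hwU)
  have h2 := hasSum_deriv_of_summable_norm hu hdo hU hle hwU
  have h3 : HasSum (fun k : ℕ => -(cexp (freq k * τ * w) * w ^ (-s - 1)) / (k + 1))
      (log (1 - cexp (2 * Real.pi * τ * w)) * w ^ (-s - 1)) := by
    have h4 := (hasSum_nat_add_iff' 1).mpr (hasSum_taylorSeries_neg_log (norm_nome_lt_one hτw))
    have h5 := h4.mul_right (-w ^ (-s - 1))
    convert! h5 using 1
    · funext k
      rw [← Complex.exp_nat_mul, freq]
      push_cast
      rw [show (2 * (Real.pi : ℂ) * (k + 1)) * τ * w = (k + 1) * (2 * Real.pi * τ * w) by ring]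
      ring
    · simp
  refine h1.hasDerivAt.congr_deriv (h2.unique ?_)
  convert! h3 using 1
  funext k
  exact (hd k w hwU).deriv

/-- The majorant is independent of ε, so dominated convergence reaches the real point D, although
|q| = 1 there and the derivative formula is no longer available. -/
theorem tendsto_tailSum_boundary (hτ : τ = I ∨ τ = -I) {D : ℝ} (s : ℂ) (hD : 0 < D) :
    Tendsto (fun ε : ℝ => tailSum τ s (D + τ * ε)) (𝓝[>] 0) (𝓝 (tailSum τ s D)) := by
  refine tendsto_tsum_of_dominated_convergence (summable_one_div_succ_sq.mul_left
    (tailConst ⌈|s.re| + 1⌉₊ D (D + 1) |s.im|)) (fun k => ?_) ?_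
  · have h := (hasDerivAt_expTail hτ (-s - 1) (w := D) (c := freq k)
      (by linarith [two_lt_freq k]) (by simpa using hD)).continuousAt
    refine (Tendsto.comp (f := fun ε : ℝ => (D : ℂ) + τ * ε) h ?_).div_const _
    have : Tendsto (fun ε : ℝ => (D : ℂ) + τ * ε) (𝓝 0) (𝓝 (D + τ * (0 : ℝ))) :=
      Continuous.tendsto (by fun_prop) 0
    simpa using this.mono_left nhdsWithin_le_nhds
  · filter_upwards [Ioo_mem_nhdsGT one_pos] with ε hε k
    refine norm_tailTerm_le hτ hD ?_ ?_ ?_ (Nat.le_ceil _) le_rfl k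
    · rw [mul_add, ← mul_assoc, mul_self_eq_neg_one hτ]
      rcases hτ with rfl | rfl <;> simp [hε.1.le]
    · rw [re_add_direction_mul hτ]; simp
    · refine (norm_ray_le hτ _ hε.1.le).trans ?_
      rw [norm_real, Real.norm_of_nonneg hD.le]
      linarith [hε.2]

theorem norm_cpow_le_of_re_nonneg {z p : ℂ} (hz : z ≠ 0) {N : ℕ} (hp : 0 ≤ p.re) (hN : p.re ≤ N)
    {x : ℝ} (hx : 1 ≤ x) (hzx : ‖z‖ ≤ x) :
    ‖z ^ p‖ ≤ N.factorial * Real.exp (Real.pi * |p.im|) * Real.exp x := by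
  have hpow : ‖z‖ ^ p.re ≤ x ^ N :=
    calc ‖z‖ ^ p.re ≤ x ^ p.re := Real.rpow_le_rpow (norm_nonneg _) hzx hp
      _ ≤ x ^ (N : ℝ) := Real.rpow_le_rpow_of_exponent_le hx hN
      _ = x ^ N := Real.rpow_natCast x N
  have hfac : x ^ N ≤ N.factorial * Real.exp x := by
    have := Real.pow_div_factorial_le_exp x (by linarith) N
    rwa [div_le_iff₀' (by positivity)] at this
  have harg : -(arg z * p.im) ≤ Real.pi * |p.im| := by
    calc -(arg z * p.im) ≤ |arg z * p.im| := neg_le_abs _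
      _ = |arg z| * |p.im| := abs_mul _ _
      _ ≤ _ := by gcongr; exact abs_arg_le_pi z
  rw [norm_cpow_of_ne_zero hz, div_eq_mul_inv, ← Real.exp_neg, mul_right_comm]
  gcongr
  exact hpow.trans hfac

/-- For Re p ≥ 0 the power is bounded without any use of ‖z‖⁻¹, so the majorant survives the
approach to the origin. The factor e² comes from the bound 2 + u for the norm. -/
theorem norm_tail_integrand_corner_le (hτ : τ = I ∨ τ = -I) {p : ℂ} (hp : 0 ≤ p.re) (c : ℝ)
    {ε : ℝ} (hε : ε ∈ Ioo (0 : ℝ) 1) {u : ℝ} (hu : 0 ≤ u) :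
    ‖cexp (-(c * u)) * ((1 + τ) * ε + τ * u) ^ p‖ ≤
      ⌈p.re⌉₊.factorial * Real.exp (Real.pi * |p.im|) * Real.exp 2 * Real.exp (-(c - 1) * u) := by
  have hre : 0 < ((1 + τ) * ε : ℂ).re := by rcases hτ with rfl | rfl <;> simp [hε.1]
  have hn : ‖((1 + τ) * ε : ℂ) + τ * u‖ ≤ 2 + u := by
    refine (norm_ray_le hτ _ hu).trans ?_
    rw [norm_mul, norm_real, Real.norm_of_nonneg hε.1.le]
    have : ‖(1 : ℂ) + τ‖ ≤ 2 := (norm_add_le _ _).trans (by rw [norm_direction hτ]; norm_num)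
    nlinarith [hε.1, hε.2, norm_nonneg ((1 : ℂ) + τ)]
  have h := norm_cpow_le_of_re_nonneg (slitPlane_ne_zero (ray_mem_slitPlane hτ hre u)) hp
    (Nat.le_ceil _) (by linarith) hn
  rw [norm_mul, norm_exp_neg_mul]
  calc _ ≤ Real.exp (-(c * u)) * (⌈p.re⌉₊.factorial * Real.exp (Real.pi * |p.im|) *
          Real.exp (2 + u)) := by gcongr
    _ = _ := by
      rw [show -(c - 1) * u = -(c * u) + u by ring, Real.exp_add, Real.exp_add]; ring

/-- The diagonal (1 + τ)ε is the path on which constants are later evaluated at the vertex 0 of the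
quadrant. -/
theorem corner_mem (hτ : τ = I ∨ τ = -I) {ε : ℝ} (hε : 0 < ε) :
    0 < ((1 + τ) * ε : ℂ).re ∧ (τ * ((1 + τ) * ε)).re < 0 := by
  rcases hτ with rfl | rfl <;> simp [hε]

theorem tendsto_corner : Tendsto (fun ε : ℝ => (1 + τ) * (ε : ℂ)) (𝓝[>] 0) (𝓝 0) := by
  have : Tendsto (fun ε : ℝ => (1 + τ) * (ε : ℂ)) (𝓝 0) (𝓝 ((1 + τ) * (0 : ℝ))) :=
    Continuous.tendsto (by fun_prop) 0
  simpa using this.mono_left nhdsWithin_le_nhds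

/-- At w = 0 the tail is the Gamma integral rotated onto the ray in direction τ. The power τ^{-s-1}
splits off from (τu)^{-s-1} because u > 0, and the outer factor τ raises it to τ^{-s}. -/
theorem tendsto_expTail_corner (hτ : τ = I ∨ τ = -I) {s : ℂ} (hs : s.re < -1) {c : ℝ}
    (hc : 1 < c) :
    Tendsto (fun ε : ℝ => expTail c τ (-s - 1) ((1 + τ) * ε)) (𝓝[>] 0)
      (𝓝 (τ ^ (-s) * (c : ℂ) ^ s * Gamma (-s))) := by
  have hp : 0 ≤ (-s - 1).re := by simp; linarith
  have hc0 : (c : ℂ) ≠ 0 := ofReal_ne_zero.mpr (by linarith)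
  have hτ0 := direction_ne_zero hτ
  have hint : Tendsto (fun ε : ℝ => tailIntegral c τ (-s - 1) ((1 + τ) * ε)) (𝓝[>] 0)
      (𝓝 (∫ u in Ioi (0 : ℝ), cexp (-(c * u)) * (τ * u) ^ (-s - 1))) := by
    refine tendsto_integral_filter_of_dominated_convergence (fun u => ⌈(-s - 1).re⌉₊.factorial *
      Real.exp (Real.pi * |(-s - 1).im|) * Real.exp 2 * Real.exp (-(c - 1) * u)) ?_ ?_
      ((integrableOn_exp_mul_Ioi (by linarith) 0).const_mul _) ?_
    · filter_upwards [self_mem_nhdsWithin] with ε hε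
      exact (continuous_tail_integrand hτ (corner_mem hτ hε).1 c _).aestronglyMeasurable
    · filter_upwards [Ioo_mem_nhdsGT one_pos] with ε hε
      refine (ae_restrict_mem measurableSet_Ioi).mono fun u hu => ?_
      exact norm_tail_integrand_corner_le hτ hp c hε (le_of_lt hu)
    · refine (ae_restrict_mem measurableSet_Ioi).mono fun u hu => ?_
      have hu0 : u ≠ 0 := ne_of_gt hu
      have hsl : τ * u ∈ slitPlane := by
        rcases hτ with rfl | rfl <;> simp [mem_slitPlane_iff, hu0]
      have h1 : Tendsto (fun ε : ℝ => (1 + τ) * (ε : ℂ) + τ * u) (𝓝[>] 0) (𝓝 (τ * u)) := by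
        simpa using tendsto_corner.add_const (τ * (u : ℂ))
      exact (h1.cpow tendsto_const_nhds hsl).const_mul _
  have hval : ∫ u in Ioi (0 : ℝ), cexp (-(c * u)) * (τ * u) ^ (-s - 1) =
      τ ^ (-s - 1) * ((c : ℂ) ^ s * Gamma (-s)) := by
    have h := integral_cpow_mul_exp_neg_mul_Ioi (a := -s) (r := c) (by rw [neg_re]; linarith)
      (by linarith)
    rw [one_div, inv_cpow _ _ (by
      rw [arg_ofReal_of_nonneg (by linarith)]; exact Real.pi_pos.ne), cpow_neg, inv_inv] at h
    rw [← h, ← integral_const_mul]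
    refine setIntegral_congr_fun measurableSet_Ioi fun u hu => ?_
    rw [mul_comm τ, ofReal_mul_cpow hu hτ0]
    ring
  have hexp : Tendsto (fun ε : ℝ => τ * cexp (c * τ * ((1 + τ) * ε))) (𝓝[>] 0) (𝓝 τ) := by
    have : Tendsto (fun ε : ℝ => τ * cexp (c * τ * ((1 + τ) * ε))) (𝓝 0)
        (𝓝 (τ * cexp (c * τ * ((1 + τ) * (0 : ℝ))))) := Continuous.tendsto (by fun_prop) 0
    simpa using this.mono_left nhdsWithin_le_nhds
  have key := hexp.mul hint
  rw [hval] at key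
  have hpow : τ * (τ ^ (-s - 1) * ((c : ℂ) ^ s * Gamma (-s))) =
      τ ^ (-s) * (c : ℂ) ^ s * Gamma (-s) := by
    rw [cpow_sub _ _ hτ0, cpow_one]
    field_simp
  rwa [hpow] at key

/-- The individual limits carry (2π(k+1))^s/(k+1), which is (2π)^s times a term of the Dirichlet
series of ζ(1 - s). -/
theorem tendsto_tailSum_corner (hτ : τ = I ∨ τ = -I) {s : ℂ} (hs : s.re < -1) :
    Tendsto (fun ε : ℝ => tailSum τ s ((1 + τ) * ε)) (𝓝[>] 0)
      (𝓝 (τ ^ (-s) * (2 * Real.pi : ℂ) ^ s * Gamma (-s) * riemannZeta (1 - s))) := by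
  have hp : 0 ≤ (-s - 1).re := by simp; linarith
  set C : ℝ := ⌈(-s - 1).re⌉₊.factorial * Real.exp (Real.pi * |(-s - 1).im|) * Real.exp 2
  have hC : 0 ≤ C := by positivity
  have key : Tendsto (fun ε : ℝ => tailSum τ s ((1 + τ) * ε)) (𝓝[>] 0)
      (𝓝 (∑' k : ℕ, τ ^ (-s) * (freq k : ℂ) ^ s * Gamma (-s) / (k + 1))) := by
    refine tendsto_tsum_of_dominated_convergence (summable_one_div_succ_sq.mul_left C)
      (fun k => (tendsto_expTail_corner hτ hs (by linarith [two_lt_freq k])).div_const _) ?_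
    filter_upwards [Ioo_mem_nhdsGT one_pos] with ε hε k
    have hc := two_lt_freq k
    refine div_succ_sq_bound hC k ?_
    rw [expTail, norm_mul, norm_mul, norm_direction hτ, one_mul]
    have hb : ‖tailIntegral (freq k) τ (-s - 1) ((1 + τ) * ε)‖ ≤ C / (freq k - 1) := by
      have hi := (integrableOn_exp_mul_Ioi (a := -(freq k - 1)) (by linarith) 0).const_mul C
      refine (norm_integral_le_of_norm_le hi ?_).trans_eq ?_
      · refine (ae_restrict_mem measurableSet_Ioi).mono fun u hu => ?_
        exact norm_tail_integrand_corner_le hτ hp _ hε (le_of_lt hu)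
      · rw [integral_const_mul, integral_exp_mul_Ioi (by linarith)]
        simp [div_eq_mul_inv, neg_sub, ← inv_neg]
    calc _ ≤ 1 * (C / (freq k - 1)) := mul_le_mul
          (norm_exp_direction_le (freq_pos k).le (corner_mem hτ hε.1).2.le) hb
          (norm_nonneg _) zero_le_one
      _ = _ := one_mul _
  convert! key using 2
  rw [zeta_eq_tsum_one_div_nat_add_one_cpow (by simp; linarith), ← tsum_mul_left]
  refine tsum_congr fun k => ?_
  have hk : ((k : ℂ) + 1) ≠ 0 := Nat.cast_add_one_ne_zero k
  have h1 : (freq k : ℂ) ^ s = (2 * Real.pi : ℂ) ^ s * ((k : ℂ) + 1) ^ s := by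
    have := ofReal_mul_cpow Real.two_pi_pos hk s
    rw [freq]; push_cast at this ⊢; exact this
  rw [h1, cpow_sub _ _ hk, cpow_one]
  have := cpow_ne_zero_iff_of_exponent_ne_zero (y := s) (x := (k : ℂ) + 1)
    (by rintro rfl; norm_num at hs)
  have h2 := this.mpr hk
  field_simp

end ZetaZeros
-- The lower incomplete Gamma series complementing a tail.
namespace ZetaZeros
open Complex Filter MeasureTheory Set

theorem isClosed_range_natCast : IsClosed (range ((↑) : ℕ → ℂ)) := by
  have h := (isometry_ofReal.isClosedEmbedding.comp Nat.isClosedEmbedding_coe_real).isClosed_range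
  convert! h using 1

theorem isPreconnected_compl_range_natCast : IsPreconnected (range ((↑) : ℕ → ℂ))ᶜ :=
  ((countable_range _).isPathConnected_compl_of_one_lt_rank
    (by rw [rank_real_complex]; norm_num)).isConnected.isPreconnected

/-- Away from `ℕ` the distances to the natural numbers have a locally uniform lower bound. -/
theorem exists_eventually_le_norm_natCast_sub {s : ℂ} (hs : ∀ m : ℕ, s ≠ m) :
    ∃ δ > 0, ∀ᶠ t in 𝓝 s, ∀ m : ℕ, δ ≤ ‖(m : ℂ) - t‖ := by
  have hmem : (range ((↑) : ℕ → ℂ))ᶜ ∈ 𝓝 s :=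
    isClosed_range_natCast.isOpen_compl.mem_nhds (by rintro ⟨m, hm⟩; exact hs m hm.symm)
  obtain ⟨r, hr, hsub⟩ := Metric.mem_nhds_iff.mp hmem
  refine ⟨r / 2, by positivity, ?_⟩
  filter_upwards [Metric.ball_mem_nhds s (half_pos hr)] with t ht m
  by_contra! h
  refine hsub (?_ : (m : ℂ) ∈ Metric.ball s r) ⟨m, rfl⟩
  rw [Metric.mem_ball] at ht ⊢
  calc dist (m : ℂ) s ≤ dist (m : ℂ) t + dist t s := dist_triangle _ _ _
    _ < r / 2 + r / 2 := by rw [dist_eq_norm (m : ℂ)]; exact add_lt_add h ht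
    _ = r := by ring

theorem exists_le_norm_natCast_sub {s : ℂ} (hs : ∀ m : ℕ, s ≠ m) :
    ∃ δ > 0, ∀ m : ℕ, δ ≤ ‖(m : ℂ) - s‖ := by
  obtain ⟨δ, hδ, h⟩ := exists_eventually_le_norm_natCast_sub hs
  exact ⟨δ, hδ, h.self_of_nhds⟩

/-- The series `∑ x^m / (m! (m - s))`. -/
noncomputable def lowerSeries (s x : ℂ) : ℂ := ∑' m : ℕ, x ^ m / (m.factorial * (m - s))

theorem norm_lowerSeries_term_le {s x : ℂ} {δ R : ℝ} (hδ : 0 < δ) {m : ℕ}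
    (h : δ ≤ ‖(m : ℂ) - s‖) (hx : ‖x‖ ≤ R) :
    ‖x ^ m / (m.factorial * (m - s))‖ ≤ δ⁻¹ * (R ^ m / m.factorial) := by
  have hR : 0 ≤ R := (norm_nonneg x).trans hx
  rw [norm_div, norm_mul, norm_pow, norm_natCast]
  calc ‖x‖ ^ m / (m.factorial * ‖(m : ℂ) - s‖) ≤ R ^ m / (m.factorial * δ) := by gcongr
    _ = _ := by field_simp

theorem summable_lowerSeries {s : ℂ} (hs : ∀ m : ℕ, s ≠ m) (x : ℂ) :
    Summable fun m : ℕ => x ^ m / (m.factorial * (m - s)) := by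
  obtain ⟨δ, hδ, h⟩ := exists_le_norm_natCast_sub hs
  exact .of_norm_bounded ((Real.summable_pow_div_factorial ‖x‖).mul_left _)
    fun m => norm_lowerSeries_term_le hδ (h m) le_rfl

/-- Termwise, m/(m - s) = 1 + s/(m - s). The equation is kept multiplied by x so that x = 0 needs no
exception. -/
theorem hasDerivAt_lowerSeries {s : ℂ} (hs : ∀ m : ℕ, s ≠ m) (x : ℂ) :
    ∃ L', HasDerivAt (lowerSeries s) L' x ∧ x * L' = s * lowerSeries s x + cexp x := by
  obtain ⟨δ, hδ, h⟩ := exists_le_norm_natCast_sub hs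
  have hu := (Real.summable_pow_div_factorial (‖x‖ + 1)).mul_left δ⁻¹
  set U := Metric.ball (0 : ℂ) (‖x‖ + 1)
  have hxU : x ∈ U := by simp [U]
  have hd : ∀ (m : ℕ) (y : ℂ), HasDerivAt (fun y => y ^ m / (m.factorial * (m - s)))
      (m * y ^ (m - 1) / (m.factorial * (m - s))) y := fun m y => (hasDerivAt_pow m y).div_const _
  have hdo : ∀ m : ℕ, DifferentiableOn ℂ (fun y => y ^ m / (m.factorial * (m - s))) U :=
    fun m y _ => (hd m y).differentiableAt.differentiableWithinAt
  have hle : ∀ (m : ℕ) (y : ℂ), y ∈ U → ‖y ^ m / (m.factorial * (m - s))‖ ≤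
      δ⁻¹ * ((‖x‖ + 1) ^ m / m.factorial) := fun m y hy =>
    norm_lowerSeries_term_le hδ (h m) (mem_ball_zero_iff.mp hy).le
  have h1 := (differentiableOn_tsum_of_summable_norm hu hdo Metric.isOpen_ball hle).differentiableAt
    (Metric.isOpen_ball.mem_nhds hxU)
  have h2 := hasSum_deriv_of_summable_norm hu hdo Metric.isOpen_ball hle hxU
  refine ⟨_, h1.hasDerivAt, (h2.mul_left x).unique ?_⟩
  have h3 := ((summable_lowerSeries hs x).hasSum.mul_left s).add (NormedSpace.expSeries_div_hasSum_exp x)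
  rw [← exp_eq_exp_ℂ] at h3
  convert! h3 using 1
  funext m
  have hm : (m : ℂ) - s ≠ 0 := sub_ne_zero.mpr (hs m).symm
  have hf : (m.factorial : ℂ) ≠ 0 := Nat.cast_ne_zero.mpr m.factorial_ne_zero
  rw [(hd m x).deriv]
  have hpow : x * (m * x ^ (m - 1)) = m * x ^ m := by
    rcases m with - | m
    · simp
    · rw [Nat.add_sub_cancel, pow_succ]; ring
  rw [mul_div_assoc', hpow]
  field_simp
  ring

theorem differentiableOn_lowerSeries_parameter (x : ℂ) :
    DifferentiableOn ℂ (fun s => lowerSeries s x) (range ((↑) : ℕ → ℂ))ᶜ := by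
  intro s hs
  have hs' : ∀ m : ℕ, s ≠ m := fun m hm => hs ⟨m, hm.symm⟩
  obtain ⟨δ, hδ, h⟩ := exists_eventually_le_norm_natCast_sub hs'
  obtain ⟨U, hU, hUo, hsU⟩ := eventually_nhds_iff.mp h
  refine (((differentiableOn_tsum_of_summable_norm
    ((Real.summable_pow_div_factorial ‖x‖).mul_left δ⁻¹) (fun m t ht => ?_) hUo
    fun m t ht => norm_lowerSeries_term_le hδ (hU t ht m) le_rfl).differentiableAt
      (hUo.mem_nhds hsU))).differentiableWithinAt
  have hm : (m : ℂ) - t ≠ 0 := norm_pos_iff.mp (hδ.trans_le (hU t ht m))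
  have hf : (m.factorial : ℂ) ≠ 0 := Nat.cast_ne_zero.mpr m.factorial_ne_zero
  exact (DifferentiableAt.fun_div (differentiableAt_const _)
    (by fun_prop : DifferentiableAt ℂ (fun t => (m.factorial : ℂ) * (m - t)) t)
    (mul_ne_zero hf hm)).differentiableWithinAt

variable {τ : ℂ}

/-- The differential equation of the series gives w^{-s} L(cτw) the derivative w^{-s-1} e^{cτw}, the
opposite of that of the tail. The sum is thus constant on the half-plane. At the corner w^{-s} kills
the first summand and the tail becomes a Gamma value. -/
theorem cpow_mul_lowerSeries_add_expTail_of_re_lt (hτ : τ = I ∨ τ = -I) {s : ℂ} (hs : s.re < -1)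
    {c : ℝ} (hc : 2 < c) {w : ℂ} (hw : 0 < w.re) :
    w ^ (-s) * lowerSeries s (c * τ * w) + expTail c τ (-s - 1) w =
      τ ^ (-s) * (c : ℂ) ^ s * Gamma (-s) := by
  have hs' : ∀ m : ℕ, s ≠ m := by
    rintro m rfl
    rw [natCast_re] at hs
    linarith [Nat.cast_nonneg (α := ℝ) m]
  set U : Set ℂ := {v | 0 < v.re}
  have hU : IsOpen U := isOpen_lt continuous_const continuous_re
  have hUc : IsPreconnected U := (convex_halfSpace_re_gt 0).isPreconnected
  have hd : ∀ v ∈ U, HasDerivAt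
      (fun v => v ^ (-s) * lowerSeries s (c * τ * v) + expTail c τ (-s - 1) v) 0 v := by
    intro v hv
    have hv0 : v ≠ 0 := slitPlane_ne_zero (Or.inl hv)
    obtain ⟨L', hL', hL⟩ := hasDerivAt_lowerSeries hs' (c * τ * v)
    have h1 : HasDerivAt (fun v => lowerSeries s (c * τ * v)) (L' * (c * τ)) v := by
      exact (hL'.comp v ((hasDerivAt_id' v).const_mul (c * τ))).congr_deriv (by ring)
    have h2 := (hasDerivAt_id' v).cpow_const (c := -s) (Or.inl hv)
    refine ((h2.fun_mul h1).fun_add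
      (hasDerivAt_expTail hτ (-s - 1) (by linarith) hv)).congr_deriv ?_
    have h3 : v ^ (-s) = v ^ (-s - 1) * v := by rw [cpow_sub _ _ hv0, cpow_one]; field_simp
    rw [h3]
    linear_combination v ^ (-s - 1) * hL
  have hconst : ∀ v ∈ U, _ = _ := fun v hv => hU.is_const_of_deriv_eq_zero hUc
    (fun v hv => (hd v hv).differentiableAt.differentiableWithinAt)
    (fun v hv => (hd v hv).deriv) hw hv
  have hlim : Tendsto (fun ε : ℝ => ((1 + τ) * (ε : ℂ)) ^ (-s) *
      lowerSeries s (c * τ * ((1 + τ) * ε)) + expTail c τ (-s - 1) ((1 + τ) * ε)) (𝓝[>] 0)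
      (𝓝 (0 * lowerSeries s (c * τ * 0) + τ ^ (-s) * (c : ℂ) ^ s * Gamma (-s))) := by
    refine (Tendsto.mul ?_ ?_).add (tendsto_expTail_corner hτ hs (by linarith))
    · have h1 : Tendsto (fun z : ℂ => z ^ (-s)) (𝓝 0) (𝓝 (0 ^ (-s))) :=
        (continuousAt_cpow_zero_of_re_pos (z := -s) (by rw [neg_re]; linarith)).tendsto.comp
          (tendsto_id.prodMk_nhds tendsto_const_nhds)
      rw [zero_cpow (by rw [Ne, neg_eq_zero]; exact_mod_cast hs' 0)] at h1
      exact h1.comp tendsto_corner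
    · obtain ⟨L', hL', -⟩ := hasDerivAt_lowerSeries hs' (c * τ * 0)
      exact hL'.continuousAt.tendsto.comp (tendsto_corner.const_mul _)
  rw [zero_mul, zero_add] at hlim
  refine tendsto_nhds_unique (tendsto_const_nhds.congr' ?_) hlim
  filter_upwards [self_mem_nhdsWithin] with ε hε
  exact hconst _ (corner_mem hτ hε).1

/-- The decomposition of `∫_0^∞ e^{cτx} x^{-s-1} dx` at `x = D`, continued in `s`. -/
theorem cpow_mul_lowerSeries_add_expTail (hτ : τ = I ∨ τ = -I) {s : ℂ} (hs : ∀ m : ℕ, s ≠ m)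
    {c : ℝ} (hc : 2 < c) {D : ℝ} (hD : 0 < D) :
    (D : ℂ) ^ (-s) * lowerSeries s (c * τ * D) + expTail c τ (-s - 1) D =
      τ ^ (-s) * (c : ℂ) ^ s * Gamma (-s) := by
  have hD0 : (D : ℂ) ≠ 0 := ofReal_ne_zero.mpr hD.ne'
  have hc0 : (c : ℂ) ≠ 0 := ofReal_ne_zero.mpr (by linarith)
  have hU : IsOpen (range ((↑) : ℕ → ℂ))ᶜ := isClosed_range_natCast.isOpen_compl
  have hDre : 0 < (D : ℂ).re := by simpa using hD
  have hf : DifferentiableOn ℂ (fun s : ℂ => (D : ℂ) ^ (-s) * lowerSeries s (c * τ * D) +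
      expTail c τ (-s - 1) D) (range ((↑) : ℕ → ℂ))ᶜ :=
    (DifferentiableOn.mul (fun t _ => (differentiableAt_id.neg.const_cpow
      (Or.inl hD0)).differentiableWithinAt) (differentiableOn_lowerSeries_parameter _)).add
      (differentiable_expTail_exponent hτ hc hDre).differentiableOn
  have hg : DifferentiableOn ℂ (fun s : ℂ => τ ^ (-s) * (c : ℂ) ^ s * Gamma (-s))
      (range ((↑) : ℕ → ℂ))ᶜ := by
    intro t ht
    refine DifferentiableAt.differentiableWithinAt (((differentiableAt_id.neg.const_cpow
      (Or.inl (direction_ne_zero hτ))).mul (differentiableAt_id.const_cpow (Or.inl hc0))).mul ?_)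
    refine (differentiableAt_Gamma (-t) fun m hm => ht ⟨m, ?_⟩).comp t differentiableAt_id.neg
    exact (neg_injective hm).symm
  have hmem : (-2 : ℂ) ∈ (range ((↑) : ℕ → ℂ))ᶜ := by
    rintro ⟨m, hm⟩
    have := congrArg re hm
    simp only [natCast_re, neg_re, re_ofNat] at this
    linarith [Nat.cast_nonneg (α := ℝ) m]
  refine (hf.analyticOnNhd hU).eqOn_of_preconnected_of_eventuallyEq (hg.analyticOnNhd hU)
    isPreconnected_compl_range_natCast hmem ?_ (fun ⟨m, hm⟩ => hs m hm.symm)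
  -- Both sides are holomorphic off ℕ, whose complement is connected, so agreement near -2 suffices.
  have : {t : ℂ | t.re < -1} ∈ 𝓝 (-2 : ℂ) :=
    (isOpen_lt continuous_re continuous_const).mem_nhds (by norm_num)
  filter_upwards [this] with t ht
  exact cpow_mul_lowerSeries_add_expTail_of_re_lt hτ ht hc hDre

end ZetaZeros
-- The Gauss function on the cut plane, its differential equation and its branching at 1.
namespace ZetaZeros
open Complex Filter MeasureTheory Set

/-- The plane cut along `[1, ∞)`. -/
def cutPlane : Set ℂ := {z : ℂ | 1 - z ∈ slitPlane}

theorem isOpen_cutPlane : IsOpen cutPlane := isOpen_slitPlane.preimage (by fun_prop)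

theorem starConvex_cutPlane {x : ℝ} (hx : x < 1) : StarConvex ℝ (x : ℂ) cutPlane := by
  intro z hz a b ha hb hab
  have h := starConvex_ofReal_slitPlane (sub_pos.mpr hx) hz ha hb hab
  have e : 1 - (a • (x : ℂ) + b • z) = a • ((1 - x : ℝ) : ℂ) + b • (1 - z) := by
    simp only [real_smul]
    push_cast
    have : (a : ℂ) + b = 1 := by exact_mod_cast hab
    linear_combination -this
  change 1 - (a • (x : ℂ) + b • z) ∈ slitPlane
  rwa [e]

theorem isPreconnected_cutPlane : IsPreconnected cutPlane := by
  have h := starConvex_cutPlane zero_lt_one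
  exact (h.isPathConnected (by simp [cutPlane])).isConnected.isPreconnected

theorem mem_cutPlane_of_norm_lt_one {z : ℂ} (hz : ‖z‖ < 1) : z ∈ cutPlane := by
  have h : ‖-z‖ < 1 := by rwa [norm_neg]
  have := mem_slitPlane_of_norm_lt_one h
  rwa [← sub_eq_add_neg] at this

theorem mem_cutPlane_of_im_ne_zero {z : ℂ} (hz : z.im ≠ 0) : z ∈ cutPlane := by
  right; simpa using hz

theorem ofReal_mem_cutPlane {x : ℝ} : (x : ℂ) ∈ cutPlane ↔ x < 1 := by
  simp [cutPlane, mem_slitPlane_iff]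

theorem ne_one_of_mem_cutPlane {z : ℂ} (hz : z ∈ cutPlane) : 1 - z ≠ 0 := slitPlane_ne_zero hz

theorem one_sub_mul_mem_slitPlane {z : ℂ} (hz : z ∈ cutPlane) {y : ℝ} (hy : y ∈ Icc (0 : ℝ) 1) :
    1 - z * y ∈ slitPlane := by
  have h := starConvex_cutPlane zero_lt_one hz (sub_nonneg.mpr hy.2) hy.1 (by ring)
  have e : (1 - y) • ((0 : ℝ) : ℂ) + y • z = z * y := by simp [real_smul, mul_comm]
  rw [e] at h
  exact h

theorem integrable_cpow_unit {q : ℂ} (hq : -1 < q.re) :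
    Integrable (fun y : ℝ => (y : ℂ) ^ q) (volume.restrict (Ioc 0 1)) := by
  have h := intervalIntegral.intervalIntegrable_cpow' (a := 0) (b := 1) hq
  rwa [intervalIntegrable_iff, uIoc_of_le zero_le_one] at h

/-- Euler's integral `∫_0^1 y^q / (1 - z y) dy`. -/
noncomputable def eulerIntegral (q z : ℂ) : ℂ :=
  ∫ y in Ioc (0 : ℝ) 1, (y : ℂ) ^ q * (1 - z * y)⁻¹

theorem aestronglyMeasurable_euler {q : ℂ} (hq : -1 < q.re) {z : ℂ} (hz : z ∈ cutPlane) (n : ℕ) :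
    AEStronglyMeasurable (fun y : ℝ => (y : ℂ) ^ q * ((1 - z * y)⁻¹) ^ n)
      (volume.restrict (Ioc 0 1)) := by
  refine (integrable_cpow_unit hq).aestronglyMeasurable.mul ?_
  refine ContinuousOn.aestronglyMeasurable (fun y hy => ContinuousAt.continuousWithinAt ?_)
    measurableSet_Ioc
  have h0 := slitPlane_ne_zero (one_sub_mul_mem_slitPlane hz ⟨hy.1.le, hy.2⟩)
  exact (ContinuousAt.inv₀ (f := fun y : ℝ => 1 - z * (y : ℂ)) (by fun_prop) h0).pow n

theorem differentiableOn_eulerIntegral {q : ℂ} (hq : -1 < q.re) :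
    DifferentiableOn ℂ (eulerIntegral q) cutPlane := by
  intro z hz
  obtain ⟨r, hr, hsub⟩ := Metric.nhds_basis_closedBall.mem_iff.mp (isOpen_cutPlane.mem_nhds hz)
  obtain ⟨C, hC⟩ : ∃ C : ℝ, ∀ x ∈ Metric.closedBall z r ×ˢ Icc (0 : ℝ) 1,
      ‖(1 - x.1 * (x.2 : ℂ))⁻¹‖ ≤ C := by
    refine ((isCompact_closedBall z r).prod isCompact_Icc).exists_bound_of_continuousOn ?_
    refine ContinuousOn.inv₀ (by fun_prop) fun x hx => ?_
    exact slitPlane_ne_zero (one_sub_mul_mem_slitPlane (hsub hx.1) hx.2)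
  have hC0 : 0 ≤ C := (norm_nonneg _).trans
    (hC (z, 0) ⟨Metric.mem_closedBall_self hr.le, by simp⟩)
  have hmem : Metric.closedBall z r ∈ 𝓝 z := Metric.closedBall_mem_nhds z hr
  refine (hasDerivAt_integral_of_dominated_loc_of_deriv_le
    (μ := volume.restrict (Ioc (0 : ℝ) 1)) (x₀ := z)
    (F := fun (v : ℂ) (y : ℝ) => (y : ℂ) ^ q * (1 - v * y)⁻¹)
    (F' := fun (v : ℂ) (y : ℝ) => (y : ℂ) ^ q * ((1 - v * y)⁻¹) ^ 2 * y)
    (bound := fun y => ‖(y : ℂ) ^ q‖ * C ^ 2)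
    hmem ?_ ?_ ?_ ?_ ?_ ?_).2.differentiableAt.differentiableWithinAt
  · filter_upwards [hmem] with v hv
    simpa using aestronglyMeasurable_euler hq (hsub hv) 1
  · refine ((integrable_cpow_unit hq).norm.mul_const C).mono' (by
      simpa using aestronglyMeasurable_euler hq hz 1) ?_
    refine (ae_restrict_mem measurableSet_Ioc).mono fun y hy => ?_
    rw [norm_mul]
    gcongr
    exact hC (z, y) ⟨Metric.mem_closedBall_self hr.le, hy.1.le, hy.2⟩
  · exact (aestronglyMeasurable_euler hq hz 2).mul
      (by fun_prop : Continuous fun y : ℝ => (y : ℂ)).aestronglyMeasurable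
  · refine (ae_restrict_mem measurableSet_Ioc).mono fun y hy v hv => ?_
    have h1 := hC (v, y) ⟨hv, hy.1.le, hy.2⟩
    have h2 : ‖(y : ℂ)‖ ≤ 1 := by
      rw [norm_real, Real.norm_of_nonneg hy.1.le]; exact hy.2
    rw [norm_mul, norm_mul, norm_pow]
    calc _ ≤ ‖(y : ℂ) ^ q‖ * C ^ 2 * 1 := by gcongr
      _ = _ := mul_one _
  · exact (integrable_cpow_unit hq).norm.mul_const _
  · refine (ae_restrict_mem measurableSet_Ioc).mono fun y hy v hv => ?_
    have h0 := slitPlane_ne_zero (one_sub_mul_mem_slitPlane (hsub hv) ⟨hy.1.le, hy.2⟩)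
    have h1 : HasDerivAt (fun v : ℂ => 1 - v * y) (-y) v := by
      simpa using ((hasDerivAt_id' v).mul_const (y : ℂ)).const_sub 1
    refine ((h1.fun_inv h0).const_mul ((y : ℂ) ^ q)).congr_deriv ?_
    field_simp

theorem hasSum_eulerIntegral {q : ℂ} (hq : -1 < q.re) {z : ℂ} (hz : ‖z‖ < 1) :
    HasSum (fun j : ℕ => z ^ j / (q + j + 1)) (eulerIntegral q z) := by
  have h := hasSum_integral_of_dominated_convergence (μ := volume.restrict (Ioc (0 : ℝ) 1))
    (F := fun (j : ℕ) y => (y : ℂ) ^ q * (z * y) ^ j)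
    (f := fun y => (y : ℂ) ^ q * (1 - z * y)⁻¹)
    (fun j y => ‖(y : ℂ) ^ q‖ * ‖z‖ ^ j) (fun j => ?_) (fun j => ?_) ?_ ?_ ?_
  · convert! h using 1
    funext j
    have hj : -1 < (q + j).re := by
      rw [add_re, natCast_re]; linarith [Nat.cast_nonneg (α := ℝ) j]
    have hq1 : q + j + 1 ≠ 0 := by
      intro h0
      have := congrArg re h0
      simp only [add_re, natCast_re, one_re, zero_re] at this
      rw [add_re, natCast_re] at hj
      linarith
    have e : ∫ y in Ioc (0 : ℝ) 1, (y : ℂ) ^ q * (z * y) ^ j =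
        ∫ y in Ioc (0 : ℝ) 1, z ^ j * (y : ℂ) ^ (q + j) := by
      refine setIntegral_congr_fun measurableSet_Ioc fun y hy => ?_
      have hy0 : (y : ℂ) ≠ 0 := ofReal_ne_zero.mpr hy.1.ne'
      simp only [cpow_add _ _ hy0, cpow_natCast, mul_pow]
      ring
    rw [e, integral_const_mul, ← intervalIntegral.integral_of_le zero_le_one,
      integral_cpow (Or.inl hj)]
    simp [zero_cpow hq1, div_eq_mul_inv]
  · exact (integrable_cpow_unit hq).aestronglyMeasurable.mul
      (by fun_prop : Continuous fun y : ℝ => (z * (y : ℂ)) ^ j).aestronglyMeasurable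
  · refine (ae_restrict_mem measurableSet_Ioc).mono fun y hy => ?_
    have h2 : ‖(y : ℂ)‖ ≤ 1 := by
      rw [norm_real, Real.norm_of_nonneg hy.1.le]; exact hy.2
    rw [norm_mul, norm_pow, norm_mul]
    gcongr
    exact mul_le_of_le_one_right (norm_nonneg _) h2
  · exact Eventually.of_forall fun y =>
      (summable_geometric_of_lt_one (norm_nonneg _) hz).mul_left _
  · simp only [tsum_mul_left]
    exact (integrable_cpow_unit hq).norm.mul_const _
  · refine (ae_restrict_mem measurableSet_Ioc).mono fun y hy => ?_
    have hzy : ‖z * (y : ℂ)‖ < 1 := by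
      rw [norm_mul, norm_real, Real.norm_of_nonneg hy.1.le]
      nlinarith [hy.1, hy.2, norm_nonneg z]
    exact (hasSum_geometric_of_norm_lt_one hzy).mul_left ((y : ℂ) ^ q)

/-- A telescoping quotient. It reduces both the ₂F₁ and the ₁F₂ in play, which have a pair of
parameters differing by 1, to series with the simple denominators m - s. -/
theorem ascPochhammer_ratio {b : ℂ} (hb : ∀ m : ℕ, b + m ≠ 0) (n : ℕ) :
    (ascPochhammer ℂ n).eval b * ((ascPochhammer ℂ n).eval (b + 1))⁻¹ = b / (b + n) := by
  have hne : ∀ n : ℕ, (ascPochhammer ℂ n).eval (b + 1) ≠ 0 := by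
    intro n h
    obtain ⟨k, -, hk⟩ := (ascPochhammer_eval_eq_zero_iff n _).mp h
    exact hb (k + 1) (by push_cast; linear_combination hk)
  induction n with
  | zero => simpa using (div_self (by simpa using hb 0)).symm
  | succ n ih =>
    have h1 := hb n
    have h2 := hb (n + 1)
    have h3 := hne n
    have h4 := hne (n + 1)
    push_cast at h2
    rw [ascPochhammer_succ_eval] at h4 ⊢
    rw [ascPochhammer_succ_eval]
    have h5 : b + 1 + n ≠ 0 := right_ne_zero_of_mul h4
    rw [← div_eq_mul_inv, div_eq_div_iff h3 h1] at ih
    rw [← div_eq_mul_inv, div_eq_div_iff h4 (by push_cast; exact h2)]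
    push_cast
    linear_combination (b + 1 + n) * ih

theorem summable_shifted_geometric {s : ℂ} (hs : ∀ m : ℕ, s ≠ m) {z : ℂ} (hz : ‖z‖ < 1) :
    Summable fun n : ℕ => z ^ n / (n + 1 - s) := by
  obtain ⟨δ, hδ, h⟩ := exists_le_norm_natCast_sub hs
  refine .of_norm_bounded ((summable_geometric_of_lt_one (norm_nonneg z) hz).mul_right δ⁻¹)
    fun n => ?_
  have := h (n + 1)
  push_cast at this
  rw [norm_div, norm_pow, div_eq_mul_inv]
  gcongr

theorem hasSum_ordinaryHypergeometric {s : ℂ} (hs : ∀ m : ℕ, s ≠ m) {z : ℂ} (hz : ‖z‖ < 1) :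
    HasSum (fun n : ℕ => (1 - s) * (z ^ n / (n + 1 - s)))
      (ordinaryHypergeometric 1 (1 - s) (2 - s) z) := by
  have e : ordinaryHypergeometric 1 (1 - s) (2 - s) z =
      ∑' n : ℕ, (1 - s) * (z ^ n / (n + 1 - s)) := by
    rw [ordinaryHypergeometric_eq_tsum]
    refine tsum_congr fun n => ?_
    have h := ascPochhammer_ratio (b := 1 - s) (fun m hm => hs (m + 1) (by
      push_cast; linear_combination -hm)) n
    rw [show 2 - s = 1 - s + 1 by ring, ascPochhammer_eval_one, smul_eq_mul]
    have hf : (n.factorial : ℂ) ≠ 0 := Nat.cast_ne_zero.mpr n.factorial_ne_zero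
    rw [inv_mul_cancel₀ hf, one_mul, h, show 1 - s + n = n + 1 - s by ring]
    ring
  rw [e]
  exact ((summable_shifted_geometric hs hz).mul_left _).hasSum

/-- Euler's integral of y^{-s} diverges at 0 when Re s ≥ 1. Splitting off the first M ≥ Re s terms
of ∑ z^n/(n + 1 - s) leaves z^M times the integral with exponent M - s, which converges. Existence
is what makes the choice in `gaussPrincipal` meaningful. -/
theorem exists_isGaussContinuation {s : ℂ} (hs : ∀ m : ℕ, s ≠ m) :
    ∃ F, IsGaussContinuation 1 (1 - s) (2 - s) F := by
  set M := ⌈s.re⌉₊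
  have hM : s.re ≤ M := Nat.le_ceil _
  have hq : -1 < ((M : ℂ) - s).re := by rw [sub_re, natCast_re]; linarith
  refine ⟨fun z => (1 - s) * (∑ n ∈ Finset.range M, z ^ n / (n + 1 - s) +
    z ^ M * eulerIntegral (M - s) z), ?_, fun z hz => ?_⟩
  · refine DifferentiableOn.analyticOnNhd ?_ isOpen_cutPlane
    refine DifferentiableOn.const_mul (DifferentiableOn.fun_add (by fun_prop) ?_) _
    exact (differentiableOn_pow M).fun_mul (differentiableOn_eulerIntegral hq)
  · have h := (summable_shifted_geometric hs hz).hasSum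
    simp only
    rw [← (hasSum_ordinaryHypergeometric hs hz).tsum_eq, tsum_mul_left,
      ← (summable_shifted_geometric hs hz).sum_add_tsum_nat_add M]
    congr 2
    rw [← ((hasSum_eulerIntegral hq hz).mul_left (z ^ M)).tsum_eq]
    refine tsum_congr fun j => ?_
    push_cast
    rw [pow_add, show (M : ℂ) - s + j + 1 = j + M + 1 - s by ring]
    ring

theorem isGaussContinuation_gaussPrincipal {s : ℂ} (hs : ∀ m : ℕ, s ≠ m) :
    IsGaussContinuation 1 (1 - s) (2 - s) (gaussPrincipal 1 (1 - s) (2 - s)) :=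
  Classical.epsilon_spec (exists_isGaussContinuation hs)

/-- The function `z ₂F₁(1, 1 - s; 2 - s; z) / (1 - s) = ∑_{m ≥ 1} z^m / (m - s)`, continued to the
cut plane. -/
noncomputable def gaussLift (s z : ℂ) : ℂ :=
  z * (gaussPrincipal 1 (1 - s) (2 - s) z / (1 - s))

theorem differentiableOn_gaussLift {s : ℂ} (hs : ∀ m : ℕ, s ≠ m) :
    DifferentiableOn ℂ (gaussLift s) cutPlane :=
  differentiableOn_id.fun_mul
    ((isGaussContinuation_gaussPrincipal hs).1.differentiableOn.div_const _)

theorem hasSum_gaussLift {s : ℂ} (hs : ∀ m : ℕ, s ≠ m) {z : ℂ} (hz : ‖z‖ < 1) :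
    HasSum (fun n : ℕ => z ^ (n + 1) / (n + 1 - s)) (gaussLift s z) := by
  have h1 : 1 - s ≠ 0 := sub_ne_zero.mpr (by simpa using (hs 1).symm)
  have h := ((hasSum_ordinaryHypergeometric hs hz).div_const (1 - s)).mul_left z
  rw [← (isGaussContinuation_gaussPrincipal hs).2 z hz] at h
  convert! h using 1
  funext n
  rw [mul_div_cancel_left₀ _ h1, pow_succ]
  ring

/-- Near 0 the power series gives it through m/(m - s) = 1 + s/(m - s). Both sides are analytic on
the connected cut plane. -/
theorem gaussLift_ode {s : ℂ} (hs : ∀ m : ℕ, s ≠ m) {z : ℂ} (hz : z ∈ cutPlane) :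
    z * deriv (gaussLift s) z = s * gaussLift s z + z / (1 - z) := by
  have hG := (differentiableOn_gaussLift hs).analyticOnNhd isOpen_cutPlane
  have h1 : AnalyticOnNhd ℂ (fun z => z * deriv (gaussLift s) z) cutPlane :=
    analyticOnNhd_id.mul hG.deriv
  have h2 : AnalyticOnNhd ℂ (fun z => s * gaussLift s z + z / (1 - z)) cutPlane :=
    (analyticOnNhd_const.mul hG).add (analyticOnNhd_id.div
      (analyticOnNhd_const.sub analyticOnNhd_id) fun z hz => ne_one_of_mem_cutPlane hz)
  refine h1.eqOn_of_preconnected_of_eventuallyEq h2 isPreconnected_cutPlane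
    (mem_cutPlane_of_norm_lt_one (z := 0) (by simp)) ?_ hz
  filter_upwards [Metric.ball_mem_nhds (0 : ℂ) (by norm_num : (0 : ℝ) < 1 / 2)] with x hx
  obtain ⟨δ, hδ, h⟩ := exists_le_norm_natCast_sub hs
  have hU : IsOpen (Metric.ball (0 : ℂ) (1 / 2)) := Metric.isOpen_ball
  have hd : ∀ (n : ℕ) (y : ℂ), HasDerivAt (fun y => y ^ (n + 1) / (n + 1 - s))
      (((n + 1 : ℕ) : ℂ) * y ^ n / (n + 1 - s)) y :=
    fun n y => (hasDerivAt_pow (n + 1) y).div_const _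
  have hu : Summable fun n : ℕ => (1 / 2 : ℝ) ^ (n + 1) * δ⁻¹ :=
    ((summable_nat_add_iff 1).mpr summable_geometric_two).mul_right _
  have hle : ∀ (n : ℕ) (y : ℂ), y ∈ Metric.ball (0 : ℂ) (1 / 2) →
      ‖y ^ (n + 1) / (n + 1 - s)‖ ≤ (1 / 2 : ℝ) ^ (n + 1) * δ⁻¹ := by
    intro n y hy
    have := h (n + 1)
    push_cast at this
    rw [norm_div, norm_pow, div_eq_mul_inv]
    have hy' := (mem_ball_zero_iff.mp hy).le
    gcongr
  have hs2 := hasSum_deriv_of_summable_norm hu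
    (fun n y _ => (hd n y).differentiableAt.differentiableWithinAt) hU hle hx
  have hev : gaussLift s =ᶠ[𝓝 x] fun y => ∑' n : ℕ, y ^ (n + 1) / (n + 1 - s) := by
    filter_upwards [hU.mem_nhds hx] with y hy
    exact (hasSum_gaussLift hs ((mem_ball_zero_iff.mp hy).trans (by norm_num))).tsum_eq.symm
  rw [← hev.deriv_eq] at hs2
  have hx1 : ‖x‖ < 1 := (mem_ball_zero_iff.mp hx).trans (by norm_num)
  have hs3 := ((hasSum_gaussLift hs hx1).mul_left s).add
    ((hasSum_geometric_of_norm_lt_one hx1).mul_left x)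
  rw [div_eq_mul_inv]
  refine (hs2.mul_left x).unique ?_
  convert! hs3 using 1
  funext n
  have hm : (n : ℂ) + 1 - s ≠ 0 := by
    have := (hs (n + 1)).symm
    push_cast at this
    exact sub_ne_zero.mpr this
  rw [(hd n x).deriv]
  push_cast
  field_simp
  ring

theorem hasDerivAt_gaussLift {s : ℂ} (hs : ∀ m : ℕ, s ≠ m) {z : ℂ} (hz : z ∈ cutPlane)
    (hz0 : z ≠ 0) : HasDerivAt (gaussLift s) ((s * gaussLift s z) / z + 1 / (1 - z)) z := by
  refine ((differentiableOn_gaussLift hs).differentiableAt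
    (isOpen_cutPlane.mem_nhds hz)).hasDerivAt.congr_deriv ?_
  have h1 := ne_one_of_mem_cutPlane hz
  have h := gaussLift_ode hs hz
  field_simp at h ⊢
  linear_combination h

/-- By the differential equation (z^{-s}G)' = z^{-s}/(1 - z). Adding log(1 - z) turns the derivative
into (z^{-s} - 1)/(1 - z), whose singularity at 1 is removable, so a primitive of it crosses the
cut: all branching of G at the points of the disc sits in the logarithm. The disc with centre and
radius R lies in the right half-plane, where z^{-s} is holomorphic, and contains (0, 2R). -/
theorem exists_gaussLift_regular {s : ℂ} (hs : ∀ m : ℕ, s ≠ m) {R : ℝ} (hR : 1 ≤ R) :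
    ∃ H : ℂ → ℂ, DifferentiableOn ℂ H (Metric.ball (R : ℂ) R) ∧
      ∀ z ∈ Metric.ball (R : ℂ) R, z ∈ cutPlane →
        gaussLift s z = z ^ s * (H z - log (1 - z)) := by
  set B := Metric.ball (R : ℂ) R
  have hB : ∀ z ∈ B, 0 < z.re := by
    intro z hz
    have h1 := (abs_re_le_norm (z - R)).trans_lt (mem_ball_iff_norm.mp hz)
    rw [sub_re, ofReal_re] at h1
    linarith [(abs_lt.mp h1).1]
  have hreal : ∀ x : ℝ, 0 < x → x < 2 * R → (x : ℂ) ∈ B := by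
    intro x h0 h1
    rw [mem_ball_iff_norm, ← ofReal_sub, norm_real, Real.norm_eq_abs, abs_lt]
    constructor <;> linarith
  have h1B : (1 : ℂ) ∈ B := by simpa using hreal 1 one_pos (by linarith)
  have hhB : ((1 / 2 : ℝ) : ℂ) ∈ B := hreal _ (by norm_num) (by linarith)
  have hBo : IsOpen B := Metric.isOpen_ball
  have hpow : DifferentiableOn ℂ (fun z : ℂ => z ^ (-s)) B := fun z hz =>
    (differentiableAt_id.cpow_const (Or.inl (hB z hz))).differentiableWithinAt
  have hf : DifferentiableOn ℂ (dslope (fun z : ℂ => z ^ (-s)) 1) B :=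
    (differentiableOn_dslope (hBo.mem_nhds h1B)).mpr hpow
  obtain ⟨g, hg⟩ := hf.isExactOn_ball
  set V := B ∩ cutPlane
  have hV : IsOpen V := hBo.inter isOpen_cutPlane
  have hVc : IsPreconnected V := by
    -- The disc minus the cut is star-shaped about 1/2, hence connected, so a single constant of
    -- integration serves for all of it.
    have hst : StarConvex ℝ ((1 / 2 : ℝ) : ℂ) V :=
      ((convex_ball _ _).starConvex hhB).inter (starConvex_cutPlane (by norm_num))
    exact (hst.isPathConnected
      ⟨hhB, ofReal_mem_cutPlane.mpr (by norm_num)⟩).isConnected.isPreconnected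
  have hd : ∀ z ∈ V, HasDerivAt
      (fun z => z ^ (-s) * gaussLift s z + log (1 - z) + g z) 0 z := by
    intro z hz
    have hz0 : z ≠ 0 := slitPlane_ne_zero (Or.inl (hB z hz.1))
    have h1 := (hasDerivAt_id' z).cpow_const (c := -s) (Or.inl (hB z hz.1))
    have h2 := hasDerivAt_gaussLift hs hz.2 hz0
    have h3 := ((hasDerivAt_id' z).const_sub 1).clog hz.2
    refine (((h1.fun_mul h2).fun_add h3).fun_add (hg z hz.1)).congr_deriv ?_
    have h4 := ne_one_of_mem_cutPlane hz.2
    have h5 : z - 1 ≠ 0 := by rw [← neg_sub]; exact neg_ne_zero.mpr h4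
    have h6 : z ≠ 1 := sub_ne_zero.mp h5
    rw [dslope_of_ne _ h6, slope_def_field, one_cpow, cpow_sub _ _ hz0, cpow_one,
      show z - 1 = -(1 - z) by ring]
    field_simp
    ring
  obtain ⟨K, hK⟩ := hV.exists_is_const_of_deriv_eq_zero hVc
    (fun z hz => (hd z hz).differentiableAt.differentiableWithinAt)
    (fun z hz => (hd z hz).deriv)
  refine ⟨fun z => K - g z, fun z hz =>
    ((hg z hz).differentiableAt.const_sub K).differentiableWithinAt, fun z hzB hzc => ?_⟩
  have hz0 : z ≠ 0 := slitPlane_ne_zero (Or.inl (hB z hzB))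
  have h := hK z ⟨hzB, hzc⟩
  have h0 : z ^ s * z ^ (-s) = 1 := by rw [← cpow_add _ _ hz0]; simp
  linear_combination (-gaussLift s z) * h0 + z ^ s * h

end ZetaZeros
-- The digamma function as the regular value of the Gauss function at 1.
namespace ZetaZeros
open Complex Filter MeasureTheory Set

/-- Pointwise convergence of bounded holomorphic functions implies convergence of derivatives. -/
theorem tendsto_deriv_of_bounded {f : ℕ → ℂ → ℂ} {g : ℂ → ℂ} {c : ℂ} {R M : ℝ} (hR : 0 < R)
    (hf : ∀ n, DifferentiableOn ℂ (f n) (Metric.closedBall c R))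
    (hg : DifferentiableOn ℂ g (Metric.closedBall c R))
    (hM : ∀ᶠ n in atTop, ∀ z ∈ Metric.sphere c R, ‖f n z‖ ≤ M)
    (hlim : ∀ z ∈ Metric.sphere c R, Tendsto (fun n => f n z) atTop (𝓝 (g z))) :
    Tendsto (fun n => deriv (f n) c) atTop (𝓝 (deriv g c)) := by
  have hpi : (2 * Real.pi * I : ℂ) ≠ 0 := two_pi_I_ne_zero
  have hsub : Metric.sphere c R ⊆ Metric.closedBall c R := Metric.sphere_subset_closedBall
  -- Cauchy's formula for the derivative reduces the claim to convergence of circle integrals, which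
  -- M dominates.
  have key : Tendsto (fun n => ∮ z in C(c, R), (1 / (z - c) ^ 2) • f n z) atTop
      (𝓝 (∮ z in C(c, R), (1 / (z - c) ^ 2) • g z)) := by
    have hcirc : ∀ θ, circleMap c R θ ∈ Metric.sphere c R := fun θ => circleMap_mem_sphere c hR.le θ
    have hz : ∀ θ, ‖1 / (circleMap c R θ - c) ^ 2‖ = 1 / R ^ 2 := fun θ => by
      rw [norm_div, norm_one, norm_pow, mem_sphere_iff_norm.mp (hcirc θ)]
    refine intervalIntegral.tendsto_integral_filter_of_dominated_convergence
      (fun _ => R * (1 / R ^ 2 * M)) ?_ ?_ intervalIntegrable_const ?_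
    · refine Eventually.of_forall fun n => Continuous.aestronglyMeasurable ?_
      have h1 : Continuous fun θ => f n (circleMap c R θ) :=
        (hf n).continuousOn.comp_continuous (continuous_circleMap c R) fun θ => hsub (hcirc θ)
      have h2 : Continuous fun θ => 1 / (circleMap c R θ - c) ^ 2 := by
        refine continuous_const.div (((continuous_circleMap c R).sub continuous_const).pow 2)
          fun θ => ?_
        rw [circleMap_sub_center]
        exact pow_ne_zero 2 (circleMap_ne_center hR.ne')
      simp only [deriv_circleMap, smul_eq_mul]
      exact ((continuous_circleMap 0 R).mul continuous_const).mul (h2.mul h1)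
    · filter_upwards [hM] with n hn
      refine Eventually.of_forall fun θ _ => ?_
      rw [norm_smul, norm_smul, hz, deriv_circleMap, norm_mul, norm_circleMap_zero, norm_I,
        mul_one, abs_of_pos hR]
      gcongr
      exact hn _ (hcirc θ)
    · exact Eventually.of_forall fun θ _ => ((hlim _ (hcirc θ)).const_smul _).const_smul _
  have h1 : ∀ n, ∮ z in C(c, R), (1 / (z - c) ^ 2) • f n z = (2 * Real.pi * I) • deriv (f n) c :=
    fun n => (hf n).deriv_eq_smul_circleIntegral hR
  have h2 := hg.deriv_eq_smul_circleIntegral hR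
  rw [h2] at key
  simp only [h1] at key
  simp only [smul_eq_mul] at key
  have := key.const_mul (2 * Real.pi * I : ℂ)⁻¹
  simpa only [inv_mul_cancel_left₀ hpi] using this

/-- On the positive axis the approximants lie below Γ by log-convexity (the Bohr–Mollerup
inequality), and |z + j| ≥ Re z + j reduces the complex case to that one. -/
theorem norm_GammaSeq_le {z : ℂ} (hz : 0 < z.re) {n : ℕ} (hn : n ≠ 0) :
    ‖GammaSeq z n‖ ≤ Real.Gamma z.re := by
  have hn0 : (0 : ℝ) < n := by exact_mod_cast Nat.pos_of_ne_zero hn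
  have h1 : Real.BohrMollerup.logGammaSeq z.re n ≤ Real.log (Real.Gamma z.re) := by
    have h := Real.BohrMollerup.ge_logGammaSeq Real.convexOn_log_Gamma (fun {y} hy => by
      rw [Function.comp_apply, Real.Gamma_add_one hy.ne',
        Real.log_mul hy.ne' (Real.Gamma_pos_of_pos hy).ne', add_comm, Function.comp_apply]) hz hn
    simpa using h
  have hpos : ∀ j : ℕ, 0 < z.re + j := fun j => by positivity
  have h2 : (n : ℝ) ^ z.re * n.factorial / ∏ j ∈ Finset.range (n + 1), (z.re + j) =
      Real.exp (Real.BohrMollerup.logGammaSeq z.re n) := by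
    rw [Real.BohrMollerup.logGammaSeq, Real.exp_sub, Real.exp_add, Real.exp_sum,
      Real.exp_log (by positivity), Real.rpow_def_of_pos hn0, mul_comm z.re]
    congr 1
    exact Finset.prod_congr rfl fun j _ => (Real.exp_log (hpos j)).symm
  calc ‖GammaSeq z n‖ = (n : ℝ) ^ z.re * n.factorial / ∏ j ∈ Finset.range (n + 1), ‖z + j‖ := by
        rw [GammaSeq, norm_div, norm_mul, norm_natCast_cpow_of_pos (Nat.pos_of_ne_zero hn),
          norm_natCast, norm_prod]
    _ ≤ (n : ℝ) ^ z.re * n.factorial / ∏ j ∈ Finset.range (n + 1), (z.re + j) := by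
        refine div_le_div_of_nonneg_left (by positivity)
          (Finset.prod_pos fun j _ => hpos j) ?_
        refine Finset.prod_le_prod (fun j _ => (hpos j).le) fun j _ => ?_
        calc z.re + j = (z + j).re := by simp
          _ ≤ _ := re_le_norm _
    _ ≤ Real.Gamma z.re := by
        rw [h2, ← Real.exp_log (Real.Gamma_pos_of_pos hz)]
        exact Real.exp_le_exp.mpr h1

theorem hasDerivAt_GammaSeq {z : ℂ} (hz : ∀ j : ℕ, z + j ≠ 0) {n : ℕ} (hn : n ≠ 0) :
    HasDerivAt (fun z => GammaSeq z n)
      (GammaSeq z n * (Complex.log n - ∑ j ∈ Finset.range (n + 1), 1 / (z + j))) z := by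
  have hn0 : (n : ℂ) ≠ 0 := Nat.cast_ne_zero.mpr hn
  have hP : ∏ j ∈ Finset.range (n + 1), (z + j) ≠ 0 := Finset.prod_ne_zero_iff.mpr fun j _ => hz j
  have h1 : HasDerivAt (fun z : ℂ => (n : ℂ) ^ z * n.factorial)
      ((n : ℂ) ^ z * Complex.log n * n.factorial) z := by
    simpa using ((hasDerivAt_id' z).const_cpow (c := (n : ℂ)) (Or.inl hn0)).mul_const
      (n.factorial : ℂ)
  have hPd : DifferentiableAt ℂ (fun z : ℂ => ∏ j ∈ Finset.range (n + 1), (z + j)) z := by fun_prop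
  have h2 := logDeriv_prod (s := Finset.range (n + 1)) (f := fun (j : ℕ) (z : ℂ) => z + j) (x := z)
    (fun j _ => hz j) (fun j _ => by fun_prop)
  have h3 : deriv (fun z : ℂ => ∏ j ∈ Finset.range (n + 1), (z + j)) z =
      (∑ j ∈ Finset.range (n + 1), 1 / (z + j)) * ∏ j ∈ Finset.range (n + 1), (z + j) := by
    rw [logDeriv_apply, div_eq_iff hP] at h2
    rw [h2]
    congr 1
    refine Finset.sum_congr rfl fun j _ => ?_
    rw [logDeriv_apply]
    simp
  have h4 := h1.fun_div hPd.hasDerivAt hP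
  refine h4.congr_deriv ?_
  rw [h3, GammaSeq]
  field_simp

/-- The sequence consists of the logarithmic derivatives of `GammaSeq`. These functions are
holomorphic, locally bounded and pointwise convergent to Γ, so their derivatives converge as well.
-/
theorem tendsto_log_sub_sum_digamma_of_re_pos {z : ℂ} (hz : 0 < z.re) :
    Tendsto (fun n : ℕ => Complex.log n - ∑ j ∈ Finset.range (n + 1), 1 / (z + j)) atTop
      (𝓝 (digamma z)) := by
  have hre : ∀ v ∈ Metric.closedBall z (z.re / 2), 0 < v.re := by
    intro v hv
    have h1 := (abs_re_le_norm (v - z)).trans (mem_closedBall_iff_norm.mp hv)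
    rw [sub_re] at h1
    linarith [(abs_le.mp h1).1]
  have hne : ∀ v ∈ Metric.closedBall z (z.re / 2), ∀ j : ℕ, v + j ≠ 0 := by
    intro v hv j h
    have := congrArg re h
    rw [add_re, natCast_re, zero_re] at this
    linarith [hre v hv, Nat.cast_nonneg (α := ℝ) j]
  have hΓ : DifferentiableOn ℂ Gamma (Metric.closedBall z (z.re / 2)) := fun v hv =>
    (differentiableAt_Gamma v fun m hm => hne v hv m (by rw [hm]; ring)).differentiableWithinAt
  obtain ⟨M, hM⟩ := (isCompact_sphere z (z.re / 2)).exists_bound_of_continuousOn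
    (f := fun v : ℂ => Real.Gamma v.re) (fun v hv => by
      have hv0 := hre v (Metric.sphere_subset_closedBall hv)
      have := (Real.differentiableAt_Gamma (s := v.re) fun m hm => by
        linarith [Nat.cast_nonneg (α := ℝ) m]).continuousAt
      exact (ContinuousAt.comp (f := re) this continuous_re.continuousAt).continuousWithinAt)
  have hself : z ∈ Metric.closedBall z (z.re / 2) := Metric.mem_closedBall_self (by linarith)
  have key := tendsto_deriv_of_bounded (f := fun n v => GammaSeq v (n + 1)) (g := Gamma)
    (c := z) (R := z.re / 2) (M := M) (by linarith)
    (fun n v hv => (hasDerivAt_GammaSeq (hne v hv) n.succ_ne_zero).differentiableAt.differentiableWithinAt)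
    hΓ
    (Eventually.of_forall fun n v hv => (norm_GammaSeq_le
      (hre v (Metric.sphere_subset_closedBall hv)) n.succ_ne_zero).trans
        ((le_abs_self _).trans (hM v hv)))
    (fun v _ => (GammaSeq_tendsto_Gamma v).comp (tendsto_add_atTop_nat 1))
  have hΓ0 : Gamma z ≠ 0 := Gamma_ne_zero_of_re_pos hz
  have h2 := key.div ((GammaSeq_tendsto_Gamma z).comp (tendsto_add_atTop_nat 1)) hΓ0
  rw [digamma_def, logDeriv_apply]
  refine (tendsto_add_atTop_iff_nat 1).mp (h2.congr' ?_)
  refine Eventually.of_forall fun n => ?_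
  have hP : GammaSeq z (n + 1) ≠ 0 := by
    rw [GammaSeq]
    refine div_ne_zero (mul_ne_zero ?_ (Nat.cast_ne_zero.mpr (Nat.factorial_ne_zero _)))
      (Finset.prod_ne_zero_iff.mpr fun j _ => hne z hself j)
    rw [Ne, cpow_eq_zero_iff]
    exact fun h => Nat.cast_ne_zero.mpr n.succ_ne_zero h.1
  simp only [Pi.div_apply, Function.comp_apply]
  rw [(hasDerivAt_GammaSeq (hne z hself) n.succ_ne_zero).deriv, mul_div_cancel_left₀ _ hP]

/-- Induction on half-planes further and further to the left: passing from z to z + 1 changes the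
sum by 1/z and a vanishing end term, in step with ψ(z + 1) = ψ(z) + 1/z. -/
theorem tendsto_log_sub_sum_digamma {z : ℂ} (hz : ∀ m : ℕ, z ≠ -m) :
    Tendsto (fun n : ℕ => Complex.log n - ∑ j ∈ Finset.range (n + 1), 1 / (z + j)) atTop
      (𝓝 (digamma z)) := by
  suffices H : ∀ (N : ℕ) (z : ℂ), (∀ m : ℕ, z ≠ -m) → -(N : ℝ) < z.re →
      Tendsto (fun n : ℕ => Complex.log n - ∑ j ∈ Finset.range (n + 1), 1 / (z + j)) atTop
        (𝓝 (digamma z)) by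
    obtain ⟨N, hN⟩ := exists_nat_gt (-z.re)
    exact H N z hz (by linarith)
  intro N
  induction N with
  | zero => intro z _ hz; exact tendsto_log_sub_sum_digamma_of_re_pos (by simpa using hz)
  | succ N ih =>
    intro z hz hre
    have h := ih (z + 1) (fun m hm => hz (m + 1) (by push_cast; linear_combination hm)) (by
      rw [add_re, one_re]; push_cast at hre; linarith)
    rw [digamma_apply_add_one z hz] at h
    have h0 : Tendsto (fun n : ℕ => 1 / (z + 1 + n)) atTop (𝓝 0) := by
      have h1 : Tendsto (fun n : ℕ => ‖z + 1 + n‖) atTop atTop := by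
        refine tendsto_atTop_mono (fun n => ?_)
          (tendsto_atTop_add_const_right _ (-‖z + 1‖) (tendsto_natCast_atTop_atTop (R := ℝ)))
        have := norm_sub_le (z + 1 + n) (z + 1)
        rw [add_sub_cancel_left, norm_natCast] at this
        linarith
      simp only [one_div]
      exact tendsto_inv₀_cobounded.comp (tendsto_norm_atTop_iff_cobounded.mp h1)
    have h2 := (h.sub_const z⁻¹).add h0
    rw [add_sub_cancel_right, add_zero] at h2
    refine h2.congr fun n => ?_
    have eL := Finset.sum_range_succ (fun j : ℕ => 1 / (z + 1 + (j : ℂ))) n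
    have eR := Finset.sum_range_succ' (fun j : ℕ => 1 / (z + (j : ℂ))) n
    have e : ∑ j ∈ Finset.range n, 1 / (z + 1 + j) =
        ∑ j ∈ Finset.range n, 1 / (z + ((j + 1 : ℕ) : ℂ)) :=
      Finset.sum_congr rfl fun j _ => by push_cast; ring_nf
    rw [eL, eR, e]
    simp only [Nat.cast_zero, add_zero, one_div]
    ring

theorem summable_digamma_terms {s : ℂ} (hs : ∀ m : ℕ, s ≠ m) :
    ∃ C : ℝ, ∀ n : ℕ, ‖1 / ((n : ℂ) + 1 - s) - 1 / (n + 1)‖ ≤ C * (1 / ((n : ℝ) + 1) ^ 2) := by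
  obtain ⟨δ, hδ, h⟩ := exists_le_norm_natCast_sub hs
  refine ⟨‖s‖ * (1 + ‖s‖ / δ), fun n => ?_⟩
  have h1 := h (n + 1)
  push_cast at h1
  have hn : (0 : ℝ) < n + 1 := by positivity
  have hnc : ((n : ℂ) + 1) ≠ 0 := Nat.cast_add_one_ne_zero n
  have hns : (n : ℂ) + 1 - s ≠ 0 := norm_pos_iff.mp (hδ.trans_le h1)
  have hnn : ‖(n : ℂ) + 1‖ = n + 1 := by
    rw [← Nat.cast_add_one, norm_natCast, Nat.cast_add_one]
  have e : 1 / ((n : ℂ) + 1 - s) - 1 / (n + 1) = s / ((n + 1 - s) * (n + 1)) := by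
    field_simp; ring
  have h2 : (n : ℝ) + 1 ≤ (1 + ‖s‖ / δ) * ‖(n : ℂ) + 1 - s‖ := by
    have h3 := norm_add_le ((n : ℂ) + 1 - s) s
    rw [sub_add_cancel, hnn] at h3
    have h4 : ‖s‖ ≤ ‖s‖ / δ * ‖(n : ℂ) + 1 - s‖ := by
      calc ‖s‖ = ‖s‖ / δ * δ := by field_simp
        _ ≤ _ := by gcongr
    linarith
  have hpos := hδ.trans_le h1
  rw [e, norm_div, norm_mul, hnn, div_le_iff₀ (by positivity)]
  calc ‖s‖ = ‖s‖ * (n + 1) * (n + 1) * (1 / ((n : ℝ) + 1) ^ 2) := by field_simp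
    _ ≤ ‖s‖ * ((1 + ‖s‖ / δ) * ‖(n : ℂ) + 1 - s‖) * (n + 1) * (1 / ((n : ℝ) + 1) ^ 2) := by gcongr
    _ = _ := by ring

/-- In the partial sums log n cancels between the limit for ψ(1 - s) and the limit defining γ. -/
theorem hasSum_digamma {s : ℂ} (hs : ∀ m : ℕ, s ≠ m) :
    HasSum (fun n : ℕ => 1 / ((n : ℂ) + 1 - s) - 1 / (n + 1))
      (-(digamma (1 - s) + Real.eulerMascheroniConstant)) := by
  obtain ⟨C, hC⟩ := summable_digamma_terms hs
  have hsum : Summable fun n : ℕ => 1 / ((n : ℂ) + 1 - s) - 1 / (n + 1) :=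
    .of_norm_bounded (summable_one_div_succ_sq.mul_left C) hC
  refine (hsum.hasSum_iff_tendsto_nat).mpr ((tendsto_add_atTop_iff_nat 1).mp ?_)
  have h1 := tendsto_log_sub_sum_digamma (z := 1 - s) fun m hm => hs (m + 1) (by
    push_cast; linear_combination -hm)
  have h2 : Tendsto (fun n : ℕ => ((harmonic (n + 1) : ℚ) : ℂ) - Complex.log n) atTop
      (𝓝 (Real.eulerMascheroniConstant : ℂ)) := by
    -- The harmonic number is needed up to n + 1 against log n, which adds the vanishing term 1/(n +
    -- 1).
    have h3 : Tendsto (fun n : ℕ => ((harmonic n : ℚ) : ℝ) - Real.log n + 1 / ((n : ℝ) + 1)) atTop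
        (𝓝 (Real.eulerMascheroniConstant + 0)) :=
      Real.tendsto_harmonic_sub_log.add tendsto_one_div_add_atTop_nhds_zero_nat
    rw [add_zero] at h3
    have h4 := (continuous_ofReal.tendsto _).comp h3
    refine h4.congr fun n => ?_
    simp only [Function.comp_apply]
    rw [harmonic_succ]
    push_cast
    rw [← natCast_log]
    simp
    ring
  refine (h1.add h2).neg.congr fun n => ?_
  rw [harmonic, Finset.sum_sub_distrib]
  push_cast
  have e : ∑ j ∈ Finset.range (n + 1), 1 / (1 - s + j) =
      ∑ j ∈ Finset.range (n + 1), 1 / ((j : ℂ) + 1 - s) :=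
    Finset.sum_congr rfl fun j _ => by rw [show 1 - s + j = (j : ℂ) + 1 - s by ring]
  rw [e]
  simp only [one_div]
  ring

/-- Logarithmic differentiation of Γ(s)Γ(1 - s) = π/sin πs, combined with ψ(1 + s) = ψ(s) + 1/s. -/
theorem digamma_reflection {s : ℂ} (hs : ∀ m : ℤ, s ≠ m) :
    -(digamma (1 - s) + Real.eulerMascheroniConstant) =
      1 / s - (digamma (1 + s) + Real.eulerMascheroniConstant) - Real.pi * cot (Real.pi * s) := by
  have hs0 : s ≠ 0 := by simpa using hs 0
  have hneg : ∀ m : ℕ, s ≠ -m := fun m => by simpa using hs (-m)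
  have hneg1 : ∀ m : ℕ, 1 - s ≠ -m := fun m hm => hs (m + 1) (by
    push_cast; linear_combination -hm)
  have hπ : (Real.pi : ℂ) ≠ 0 := ofReal_ne_zero.mpr Real.pi_ne_zero
  have hsin : sin (Real.pi * s) ≠ 0 := by
    rw [Ne, sin_eq_zero_iff]
    rintro ⟨k, hk⟩
    exact hs k (mul_left_cancel₀ hπ (by rw [hk]; ring))
  have h1 : logDeriv (fun s => Gamma s * Gamma (1 - s)) s = digamma s - digamma (1 - s) := by
    have hd : HasDerivAt (fun s => Gamma (1 - s)) (-deriv Gamma (1 - s)) s := by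
      exact ((differentiableAt_Gamma _ hneg1).hasDerivAt.comp s
        ((hasDerivAt_id' s).const_sub 1)).congr_deriv (by ring)
    have hΓ := (differentiableAt_Gamma _ hneg).hasDerivAt
    rw [logDeriv_apply, (hΓ.fun_mul hd).deriv, digamma_def, logDeriv_apply, logDeriv_apply]
    have g1 := Gamma_ne_zero hneg
    have g2 := Gamma_ne_zero hneg1
    field_simp
    ring
  have h2 : logDeriv (fun s => Gamma s * Gamma (1 - s)) s = -(Real.pi * cot (Real.pi * s)) := by
    have e : (fun s => Gamma s * Gamma (1 - s)) = fun s => Real.pi / sin (Real.pi * s) :=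
      funext Gamma_mul_Gamma_one_sub
    have hd : HasDerivAt (fun s : ℂ => sin (Real.pi * s)) (cos (Real.pi * s) * Real.pi) s := by
      simpa using ((hasDerivAt_id' s).const_mul (Real.pi : ℂ)).csin
    have hd2 := (hasDerivAt_const s (Real.pi : ℂ)).fun_div hd hsin
    rw [e, logDeriv_apply, hd2.deriv, cot]
    field_simp
    ring
  have h3 := digamma_apply_add_one s hneg
  rw [add_comm 1 s, h3, ← one_div]
  linear_combination -h1 + h2

theorem tendsto_mul_log_nhds_zero : Tendsto (fun u : ℂ => u * log u) (𝓝 0) (𝓝 0) := by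
  have h1 : Tendsto (fun u : ℂ => |‖u‖ * Real.log ‖u‖| + ‖u‖ * Real.pi) (𝓝 0) (𝓝 0) := by
    have h2 : Continuous fun u : ℂ => |‖u‖ * Real.log ‖u‖| + ‖u‖ * Real.pi :=
      (Real.continuous_mul_log.comp continuous_norm).abs.add
        (continuous_norm.mul continuous_const)
    simpa using h2.tendsto 0
  refine squeeze_zero_norm (fun u => ?_) h1
  rw [norm_mul, abs_mul, abs_norm, ← mul_add]
  gcongr
  calc ‖log u‖ ≤ |(log u).re| + |(log u).im| := norm_le_abs_re_add_abs_im _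
    _ ≤ _ := by
      rw [log_re, log_im]
      gcongr
      exact abs_arg_le_pi u

/-- A first-order zero beats a logarithm. Near 1 this allows z^s log(1 - z) to be replaced by log(1
- z). -/
theorem tendsto_one_sub_cpow_mul_log (s : ℂ) :
    Tendsto (fun z : ℂ => (1 - z ^ s) * log (1 - z)) (𝓝[≠] 1) (𝓝 0) := by
  have h1 : HasDerivAt (fun z : ℂ => z ^ s) (s * 1 ^ (s - 1) * 1) 1 :=
    (hasDerivAt_id' (1 : ℂ)).cpow_const (Or.inl (by simp))
  have h2 := hasDerivAt_iff_tendsto_slope.mp h1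
  have h3 : Tendsto (fun z : ℂ => (1 - z) * log (1 - z)) (𝓝[≠] 1) (𝓝 0) := by
    have : Tendsto (fun z : ℂ => 1 - z) (𝓝[≠] 1) (𝓝 0) := by
      have h := (by fun_prop : Continuous fun z : ℂ => 1 - z).tendsto 1
      rw [sub_self] at h
      exact h.mono_left nhdsWithin_le_nhds
    exact tendsto_mul_log_nhds_zero.comp this
  have h4 := h2.mul h3
  rw [mul_zero] at h4
  refine h4.congr' ?_
  filter_upwards [self_mem_nhdsWithin] with z hz
  have hz1 : z - 1 ≠ 0 := sub_ne_zero.mpr hz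
  rw [slope_def_field, one_cpow]
  field_simp
  ring

/-- As x → 1⁻, G(x) + log(1 - x) tends to H(1). It is also the power series with coefficients 1/(n +
1 - s) - 1/(n + 1) = O(n⁻²), which tends to its value at 1, the digamma series. -/
theorem gaussLift_regular_at_one {s : ℂ} (hs : ∀ m : ℕ, s ≠ m) {R : ℝ} (hR : 1 ≤ R)
    {H : ℂ → ℂ} (hH : DifferentiableOn ℂ H (Metric.ball (R : ℂ) R))
    (hG : ∀ z ∈ Metric.ball (R : ℂ) R, z ∈ cutPlane →
      gaussLift s z = z ^ s * (H z - log (1 - z))) :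
    H 1 = -(digamma (1 - s) + Real.eulerMascheroniConstant) := by
  have hreal : ∀ x : ℝ, 0 < x → x < 2 * R → (x : ℂ) ∈ Metric.ball (R : ℂ) R := by
    intro x h0 h1
    rw [mem_ball_iff_norm, ← ofReal_sub, norm_real, Real.norm_eq_abs, abs_lt]
    constructor <;> linarith
  have h1B : (1 : ℂ) ∈ Metric.ball (R : ℂ) R := by simpa using hreal 1 one_pos (by linarith)
  have hx1 : Tendsto (fun x : ℝ => (x : ℂ)) (𝓝[<] 1) (𝓝 1) := by
    simpa using (continuous_ofReal.tendsto 1).mono_left (nhdsWithin_le_nhds (s := Iio 1))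
  have hx1' : Tendsto (fun x : ℝ => (x : ℂ)) (𝓝[<] 1) (𝓝[≠] 1) := by
    refine tendsto_nhdsWithin_iff.mpr ⟨hx1, ?_⟩
    filter_upwards [self_mem_nhdsWithin] with x hx
    exact fun h => (mem_Iio.mp hx).ne (ofReal_eq_one.mp (mem_singleton_iff.mp h))
  have hev : ∀ᶠ x : ℝ in 𝓝[<] 1, x ∈ Ioo (0 : ℝ) 1 := Ioo_mem_nhdsLT one_pos
  have hA : Tendsto (fun x : ℝ => gaussLift s x + log (1 - x)) (𝓝[<] 1) (𝓝 (H 1)) := by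
    have h1 : Tendsto (fun x : ℝ => (x : ℂ) ^ s * H x) (𝓝[<] 1) (𝓝 ((1 : ℂ) ^ s * H 1)) := by
      refine (hx1.cpow tendsto_const_nhds (Or.inl (by simp))).mul ?_
      exact (hH.continuousOn.continuousAt (Metric.isOpen_ball.mem_nhds h1B)).tendsto.comp hx1
    have h2 := h1.add ((tendsto_one_sub_cpow_mul_log s).comp hx1')
    rw [one_cpow, one_mul, add_zero] at h2
    refine h2.congr' ?_
    filter_upwards [hev] with x hx
    rw [hG x (hreal x hx.1 (by linarith [hx.2])) (ofReal_mem_cutPlane.mpr hx.2)]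
    simp only [Function.comp_apply]
    ring
  obtain ⟨C, hC⟩ := summable_digamma_terms hs
  have hB : Tendsto (fun x : ℝ => ∑' n : ℕ, (x : ℂ) ^ (n + 1) *
      (1 / ((n : ℂ) + 1 - s) - 1 / (n + 1))) (𝓝[<] 1)
      (𝓝 (∑' n : ℕ, (1 / ((n : ℂ) + 1 - s) - 1 / (n + 1)))) := by
    refine tendsto_tsum_of_dominated_convergence (summable_one_div_succ_sq.mul_left C)
      (fun n => ?_) ?_
    · simpa using (hx1.pow (n + 1)).mul_const (1 / ((n : ℂ) + 1 - s) - 1 / (n + 1))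
    · filter_upwards [hev] with x hx n
      rw [norm_mul, norm_pow, norm_real, Real.norm_of_nonneg hx.1.le]
      calc _ ≤ 1 * ‖1 / ((n : ℂ) + 1 - s) - 1 / (n + 1)‖ := by
            gcongr; exact pow_le_one₀ hx.1.le hx.2.le
        _ ≤ _ := by rw [one_mul]; exact hC n
  rw [(hasSum_digamma hs).tsum_eq] at hB
  refine tendsto_nhds_unique hA (hB.congr' ?_)
  filter_upwards [hev] with x hx
  have hn : ‖(x : ℂ)‖ < 1 := by rw [norm_real, Real.norm_of_nonneg hx.1.le]; exact hx.2
  have h1 := hasSum_gaussLift hs hn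
  have h2 := (hasSum_nat_add_iff' 1).mpr (hasSum_taylorSeries_neg_log hn)
  have h3 := h1.sub h2
  simp only [Finset.sum_range_one, Nat.cast_zero, div_zero, sub_zero, sub_neg_eq_add] at h3
  rw [← h3.tsum_eq]
  refine tsum_congr fun n => ?_
  push_cast
  ring

end ZetaZeros
-- The paired Gauss sum and the cotangent.
namespace ZetaZeros
open Complex Filter MeasureTheory Set

/-- The linear terms at z and -z cancel, which leaves a quadratic bound. This is why the indices k
and -k have to be added first. Of the constant 4, one factor 2 counts the two series and the other
bounds (1 - ‖z‖)⁻¹. -/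
theorem norm_gaussLift_add_neg_le {s : ℂ} {δ : ℝ} (hδ : 0 < δ) (h : ∀ m : ℕ, δ ≤ ‖(m : ℂ) - s‖)
    {z : ℂ} (hz : ‖z‖ ≤ 1 / 2) :
    ‖gaussLift s z + gaussLift s (-z)‖ ≤ 4 / δ * ‖z‖ ^ 2 := by
  have hs : ∀ m : ℕ, s ≠ m := by
    rintro m rfl
    have := h m
    rw [sub_self, norm_zero] at this
    linarith
  have hz1 : ‖z‖ < 1 := by linarith
  have h1 := (hasSum_gaussLift hs hz1).add (hasSum_gaussLift hs (z := -z) (by rwa [norm_neg]))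
  have h2 := (hasSum_nat_add_iff' 1).mpr h1
  simp only [Finset.sum_range_one, zero_add, pow_one, Nat.cast_zero, ← add_div, add_neg_cancel,
    zero_div, sub_zero] at h2
  have h3 : HasSum (fun n : ℕ => 2 * δ⁻¹ * ‖z‖ ^ 2 * ‖z‖ ^ n)
      (2 * δ⁻¹ * ‖z‖ ^ 2 * (1 - ‖z‖)⁻¹) :=
    (hasSum_geometric_of_lt_one (norm_nonneg z) hz1).mul_left _
  rw [← h2.tsum_eq]
  refine (tsum_of_norm_bounded h3 fun n => ?_).trans ?_
  · have h4 := h (n + 1 + 1)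
    push_cast at h4
    rw [norm_div, div_eq_mul_inv]
    push_cast
    calc _ ≤ (2 * ‖z‖ ^ (n + 1 + 1)) * δ⁻¹ := by
          gcongr
          refine (norm_add_le _ _).trans_eq ?_
          rw [norm_pow, norm_pow, norm_neg]; ring
      _ = _ := by ring
  · have h5 : (1 - ‖z‖)⁻¹ ≤ 2 := by
      rw [inv_le_comm₀ (by linarith) two_pos]; linarith
    calc _ ≤ 2 * δ⁻¹ * ‖z‖ ^ 2 * 2 := by gcongr
      _ = _ := by ring

/-- The sum of the terms of index `k + 1` and `-(k + 1)`. -/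
noncomputable def pairTerm (s w : ℂ) (k : ℕ) : ℂ :=
  gaussLift s (w / (k + 1)) + gaussLift s (-(w / (k + 1)))

/-- The sum of all the paired terms. -/
noncomputable def pairSum (s w : ℂ) : ℂ := ∑' k, pairTerm s w k

theorem norm_natCast_succ (k : ℕ) : ‖(k : ℂ) + 1‖ = k + 1 := by
  rw [← Nat.cast_add_one, norm_natCast, Nat.cast_add_one]

theorem norm_pairTerm_le {s : ℂ} {δ : ℝ} (hδ : 0 < δ) (h : ∀ m : ℕ, δ ≤ ‖(m : ℂ) - s‖)
    {w : ℂ} {k : ℕ} (hw : 2 * ‖w‖ ≤ k + 1) :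
    ‖pairTerm s w k‖ ≤ 4 / δ * ‖w‖ ^ 2 * (1 / ((k : ℝ) + 1) ^ 2) := by
  have hk : (0 : ℝ) < k + 1 := by positivity
  have hz : ‖w / (k + 1)‖ = ‖w‖ / (k + 1) := by rw [norm_div, norm_natCast_succ]
  refine (norm_gaussLift_add_neg_le hδ h ?_).trans_eq ?_
  · rw [hz, div_le_iff₀ hk]; linarith
  · rw [hz]; field_simp

theorem summable_pairTerm {s : ℂ} (hs : ∀ m : ℕ, s ≠ m) (w : ℂ) : Summable (pairTerm s w) := by
  obtain ⟨δ, hδ, h⟩ := exists_le_norm_natCast_sub hs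
  refine .of_norm_bounded_eventually_nat
    (summable_one_div_succ_sq.mul_left (4 / δ * ‖w‖ ^ 2)) ?_
  filter_upwards [eventually_ge_atTop ⌈2 * ‖w‖⌉₊] with k hk
  refine norm_pairTerm_le hδ h ?_
  have := Nat.ceil_le.mp hk
  linarith

theorem differentiableOn_gaussLift_parameter {z : ℂ} (hz : ‖z‖ < 1) :
    DifferentiableOn ℂ (fun s => gaussLift s z) (range ((↑) : ℕ → ℂ))ᶜ := by
  intro s hs
  have hs' : ∀ m : ℕ, s ≠ m := fun m hm => hs ⟨m, hm.symm⟩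
  obtain ⟨δ, hδ, h⟩ := exists_eventually_le_norm_natCast_sub hs'
  obtain ⟨U, hU, hUo, hsU⟩ := eventually_nhds_iff.mp h
  have hne : ∀ t ∈ U, ∀ m : ℕ, t ≠ m := by
    rintro _ ht m rfl
    have := hU _ ht m
    rw [sub_self, norm_zero] at this
    linarith
  have key : DifferentiableOn ℂ (fun t => ∑' n : ℕ, z ^ (n + 1) / (n + 1 - t)) U := by
    refine differentiableOn_tsum_of_summable_norm (u := fun n : ℕ => ‖z‖ ^ n * δ⁻¹)
      ((summable_geometric_of_lt_one (norm_nonneg z) hz).mul_right _) (fun n t ht => ?_) hUo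
      fun n t ht => ?_
    · have hm : (n : ℂ) + 1 - t ≠ 0 := by
        have := (hne t ht (n + 1)).symm
        push_cast at this
        exact sub_ne_zero.mpr this
      exact (DifferentiableAt.fun_div (differentiableAt_const _)
        (by fun_prop : DifferentiableAt ℂ (fun t => (n : ℂ) + 1 - t) t)
        hm).differentiableWithinAt
    · have := hU t ht (n + 1)
      push_cast at this
      rw [norm_div, norm_pow, div_eq_mul_inv]
      exact mul_le_mul (pow_le_pow_of_le_one (norm_nonneg z) hz.le n.le_succ)
        (inv_anti₀ hδ this) (by positivity) (by positivity)
  refine ((key.congr fun t ht => ?_).differentiableAt (hUo.mem_nhds hsU)).differentiableWithinAt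
  exact (hasSum_gaussLift (hne t ht) hz).tsum_eq.symm

/-- For ‖w‖ ≤ 1/2 all arguments ±w/(k + 1) lie in the unit disc, so the dependence on s is read off
the power series. Outside the disc `gaussPrincipal` is only known as a continuation for each s
separately. -/
theorem differentiableOn_pairSum_parameter {w : ℂ} (hw : ‖w‖ ≤ 1 / 2) :
    DifferentiableOn ℂ (fun s => pairSum s w) (range ((↑) : ℕ → ℂ))ᶜ := by
  intro s hs
  have hs' : ∀ m : ℕ, s ≠ m := fun m hm => hs ⟨m, hm.symm⟩
  obtain ⟨δ, hδ, h⟩ := exists_eventually_le_norm_natCast_sub hs'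
  obtain ⟨U, hU, hUo, hsU⟩ := eventually_nhds_iff.mp h
  have hUsub : U ⊆ (range ((↑) : ℕ → ℂ))ᶜ := by
    rintro _ ht ⟨m, rfl⟩
    have := hU _ ht m
    rw [sub_self, norm_zero] at this
    linarith
  have hn : ∀ k : ℕ, ‖w / (k + 1)‖ < 1 := by
    intro k
    rw [norm_div, norm_natCast_succ, div_lt_one (by positivity)]
    linarith [Nat.cast_nonneg (α := ℝ) k]
  refine ((differentiableOn_tsum_of_summable_norm
    (summable_one_div_succ_sq.mul_left (4 / δ * ‖w‖ ^ 2)) (fun k => ?_) hUo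
    fun k t ht => norm_pairTerm_le hδ (hU t ht) ?_).differentiableAt
      (hUo.mem_nhds hsU)).differentiableWithinAt
  · exact ((differentiableOn_gaussLift_parameter (hn k)).add
      (differentiableOn_gaussLift_parameter (by rw [norm_neg]; exact hn k))).mono hUsub
  · linarith [Nat.cast_nonneg (α := ℝ) k]

variable {τ : ℂ}

theorem abs_im_eq (hτ : τ = I ∨ τ = -I) (w : ℂ) : |w.im| = |(τ * w).re| := by
  rcases hτ with rfl | rfl <;> simp

theorem im_ne_zero_of_re_neg (hτ : τ = I ∨ τ = -I) {w : ℂ} (hw : (τ * w).re < 0) : w.im ≠ 0 := by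
  rw [← abs_pos, abs_im_eq hτ]
  exact abs_pos.mpr hw.ne

theorem div_succ_mem_cutPlane {w : ℂ} (hw : w.im ≠ 0) (k : ℕ) :
    w / (k + 1) ∈ cutPlane ∧ -(w / (k + 1)) ∈ cutPlane := by
  have h1 : (w / (k + 1)).im ≠ 0 := by
    rw [← Nat.cast_add_one, div_natCast_im]
    exact div_ne_zero hw (by positivity)
  exact ⟨mem_cutPlane_of_im_ne_zero h1, mem_cutPlane_of_im_ne_zero (by simpa using h1)⟩

/-- The factor w^{-s} is an integrating factor for the equation of G, so only partial fractions
remain. -/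
theorem hasDerivAt_cpow_mul_pairTerm {s : ℂ} (hs : ∀ m : ℕ, s ≠ m) {w : ℂ} (hw : 0 < w.re)
    (hi : w.im ≠ 0) (k : ℕ) :
    HasDerivAt (fun w => w ^ (-s) * pairTerm s w k)
      (w ^ (-s) * (1 / (k + 1 - w) - 1 / (k + 1 + w))) w := by
  have hk : (k : ℂ) + 1 ≠ 0 := Nat.cast_add_one_ne_zero k
  have hw0 : w ≠ 0 := slitPlane_ne_zero (Or.inl hw)
  obtain ⟨m1, m2⟩ := div_succ_mem_cutPlane hi k
  have hz0 : w / (k + 1) ≠ 0 := div_ne_zero hw0 hk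
  have hlin : HasDerivAt (fun w : ℂ => w / (k + 1)) (1 / (k + 1)) w :=
    (hasDerivAt_id' w).div_const _
  have h1 := (hasDerivAt_gaussLift hs m1 hz0).comp w hlin
  have h2 := (hasDerivAt_gaussLift hs m2 (neg_ne_zero.mpr hz0)).comp w hlin.fun_neg
  have h3 := (hasDerivAt_id' w).cpow_const (c := -s) (Or.inl hw)
  refine (h3.fun_mul (h1.add h2)).congr_deriv ?_
  have e1 := ne_one_of_mem_cutPlane m1
  have e2 := ne_one_of_mem_cutPlane m2
  have e3 : (k : ℂ) + 1 - w ≠ 0 := by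
    intro h; apply e1; field_simp; rw [h, mul_zero]
  have e4 : (k : ℂ) + 1 + w ≠ 0 := by
    intro h; apply e2; field_simp; linear_combination h
  have d1 : 1 / (1 - w / ((k : ℂ) + 1)) = (k + 1) / (k + 1 - w) := by
    rw [div_eq_div_iff e1 e3]; field_simp
  have d2 : 1 / (1 - -(w / ((k : ℂ) + 1))) = (k + 1) / (k + 1 + w) := by
    rw [div_eq_div_iff e2 e4]; field_simp; ring
  rw [d1, d2, cpow_sub _ _ hw0, cpow_one]
  simp only [Pi.add_apply, Function.comp_apply]
  field_simp
  ring

/-- Away from the real axis k + 1 is at most a constant times |k + 1 - w|, so the difference of the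
fractions decays quadratically, locally uniformly in w. -/
theorem norm_pair_deriv_le {w : ℂ} {a R : ℝ} (ha : 0 < a) (hw : 0 < w.re) (hi : a ≤ |w.im|)
    (hR : ‖w‖ ≤ R) (k : ℕ) :
    ‖(1 / ((k : ℂ) + 1 - w) - 1 / (k + 1 + w))‖ ≤
      2 * R * (1 + R / a) * (1 / ((k : ℝ) + 1) ^ 2) := by
  have hk : (0 : ℝ) < k + 1 := by positivity
  have hR0 : 0 ≤ R := (norm_nonneg w).trans hR
  have h1 : (k : ℝ) + 1 ≤ (1 + R / a) * ‖(k : ℂ) + 1 - w‖ := by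
    have h2 : a ≤ ‖(k : ℂ) + 1 - w‖ := by
      refine hi.trans ?_
      have := abs_im_le_norm ((k : ℂ) + 1 - w)
      simpa using this
    have h3 := norm_add_le ((k : ℂ) + 1 - w) w
    rw [sub_add_cancel, norm_natCast_succ] at h3
    have h4 : R ≤ R / a * ‖(k : ℂ) + 1 - w‖ := by
      calc R = R / a * a := by field_simp
        _ ≤ _ := by gcongr
    linarith
  have h5 : (k : ℝ) + 1 ≤ ‖(k : ℂ) + 1 + w‖ := by
    calc (k : ℝ) + 1 ≤ ((k : ℂ) + 1 + w).re := by simp; linarith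
      _ ≤ _ := re_le_norm _
  have p1 : 0 < ‖(k : ℂ) + 1 - w‖ := by
    have : 0 < (1 + R / a) * ‖(k : ℂ) + 1 - w‖ := hk.trans_le h1
    exact pos_of_mul_pos_right this (by positivity)
  have p2 : 0 < ‖(k : ℂ) + 1 + w‖ := hk.trans_le h5
  have n1 := norm_pos_iff.mp p1
  have n2 := norm_pos_iff.mp p2
  have e : 1 / ((k : ℂ) + 1 - w) - 1 / (k + 1 + w) = 2 * w / ((k + 1 - w) * (k + 1 + w)) := by
    field_simp; ring
  rw [e, norm_div, norm_mul, norm_mul, div_le_iff₀ (by positivity), RCLike.norm_ofNat]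
  calc 2 * ‖w‖ ≤ 2 * R := by gcongr
    _ = 2 * R * (((k : ℝ) + 1) * (k + 1)) * (1 / ((k : ℝ) + 1) ^ 2) := by field_simp
    _ ≤ 2 * R * (((1 + R / a) * ‖(k : ℂ) + 1 - w‖) * ‖(k : ℂ) + 1 + w‖) *
        (1 / ((k : ℝ) + 1) ^ 2) := by gcongr
    _ = _ := by ring

/-- The partial fractions of the paired terms add up to the Mittag-Leffler expansion of the
cotangent. -/
theorem hasDerivAt_cpow_mul_pairSum (hτ : τ = I ∨ τ = -I) {s : ℂ} (hs : ∀ m : ℕ, s ≠ m) {w : ℂ}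
    (hw : 0 < w.re) (hτw : (τ * w).re < 0) :
    HasDerivAt (fun w => w ^ (-s) * pairSum s w)
      (w ^ (-s) * (1 / w - Real.pi * cot (Real.pi * w))) w := by
  set a : ℝ := -(τ * w).re / 2 with ha
  have ha0 : 0 < a := by rw [ha]; linarith
  -- A convex neighbourhood of w on which Re v and |Im v| are bounded below and ‖v‖ above, so that
  -- one majorant serves throughout.
  set t : Set ℂ := {v | w.re / 2 < v.re} ∩ ({v | (τ * v).re < -a} ∩ Metric.ball 0 (‖w‖ + 1))
  have hto : IsOpen t := (isOpen_lt continuous_const continuous_re).inter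
    ((isOpen_lt (continuous_re.comp (continuous_const_mul τ)) continuous_const).inter
      Metric.isOpen_ball)
  have htc : Convex ℝ t := by
    refine (convex_halfSpace_re_gt _).inter (Convex.inter ?_ (convex_ball _ _))
    exact convex_halfSpace_lt (f := fun v : ℂ => (τ * v).re)
      ⟨fun x y => by simp [mul_add], fun c x => by
        rw [real_smul, mul_left_comm, re_ofReal_mul, smul_eq_mul]⟩ (-a)
  have hwt : w ∈ t := ⟨show w.re / 2 < w.re by linarith,
    show (τ * w).re < -a by rw [ha]; linarith, by simp⟩
  have him : ∀ v ∈ t, a ≤ |v.im| := by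
    intro v hv
    rw [abs_im_eq hτ]
    have := neg_le_abs (τ * v).re
    have h2 : (τ * v).re < -a := hv.2.1
    linarith
  have hre : ∀ v ∈ t, w.re / 2 < v.re := fun v hv => hv.1
  have hnorm : ∀ v ∈ t, ‖v‖ ≤ ‖w‖ + 1 := fun v hv => (mem_ball_zero_iff.mp hv.2.2).le
  set Cw : ℝ := ⌈|(-s).re|⌉₊.factorial *
    Real.exp (‖w‖ + 1 + (w.re / 2)⁻¹ + Real.pi * |(-s).im|) with hCw
  have hpow : ∀ v ∈ t, ‖v ^ (-s)‖ ≤ Cw := by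
    intro v hv
    have hv0 : 0 < v.re := by linarith [hre v hv]
    refine (norm_cpow_le_factorial_mul_exp (slitPlane_ne_zero (Or.inl hv0))
      (Nat.le_ceil _)).trans ?_
    have h1 : ‖v‖⁻¹ ≤ (w.re / 2)⁻¹ := by
      gcongr
      exact (hre v hv).le.trans (re_le_norm v)
    have h2 := hnorm v hv
    rw [hCw]
    gcongr
  have key := hasDerivAt_tsum_of_isPreconnected
    (g := fun k v => v ^ (-s) * pairTerm s v k)
    (g' := fun k v => v ^ (-s) * (1 / (k + 1 - v) - 1 / (k + 1 + v)))
    (summable_one_div_succ_sq.mul_left (Cw * (2 * (‖w‖ + 1) * (1 + (‖w‖ + 1) / a))))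
    hto htc.isPreconnected (fun k v hv => hasDerivAt_cpow_mul_pairTerm hs
      (by linarith [hre v hv]) (abs_pos.mp (ha0.trans_le (him v hv))) k)
    (fun k v hv => ?_) hwt ((summable_pairTerm hs w).mul_left _) hwt
  · simp only [tsum_mul_left] at key
    refine key.congr_deriv ?_
    have hint : w ∈ integerComplement := by
      rintro ⟨m, rfl⟩
      exact im_ne_zero_of_re_neg hτ hτw (by simp)
    have hc := cot_series_rep' hint
    rw [← neg_sub (_ * cot _), hc, ← tsum_neg]
    congr 1
    refine tsum_congr fun k => ?_
    rw [← neg_sub w, one_div, inv_neg]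
    ring
  · rw [norm_mul, mul_assoc]
    gcongr
    · exact hpow v hv
    · exact norm_pair_deriv_le ha0 (by linarith [hre v hv]) (him v hv) (hnorm v hv) k

theorem hasDerivAt_log_one_sub_nome (hτ : τ = I ∨ τ = -I) {w : ℂ} (hτw : (τ * w).re < 0) :
    HasDerivAt (fun w => log (1 - cexp (2 * Real.pi * τ * w)))
      (Real.pi * cot (Real.pi * w) + Real.pi * τ) w := by
  have hq := norm_nome_lt_one hτw
  have h1 : HasDerivAt (fun w => cexp (2 * Real.pi * τ * w))
      (cexp (2 * Real.pi * τ * w) * (2 * Real.pi * τ)) w := by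
    simpa using ((hasDerivAt_id' w).const_mul (2 * Real.pi * τ)).cexp
  have hslit := mem_cutPlane_of_norm_lt_one hq
  refine ((h1.const_sub 1).clog hslit).congr_deriv ?_
  have hne := ne_one_of_mem_cutPlane hslit
  rw [cot_pi_eq_exp_ratio]
  rcases hτ with rfl | rfl
  · have e : (2 : ℂ) * Real.pi * I * w = 2 * Real.pi * I * w := rfl
    set q := cexp (2 * Real.pi * I * w)
    have hI := I_ne_zero
    have hne' : I * (1 - q) ≠ 0 := mul_ne_zero hI hne
    field_simp
    ring_nf
    simp only [I_sq]
    ring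
  · have e : cexp (2 * Real.pi * -I * w) = (cexp (2 * Real.pi * I * w))⁻¹ := by
      rw [← Complex.exp_neg]; ring_nf
    rw [e] at hne ⊢
    have hq0 : cexp (2 * Real.pi * I * w) ≠ 0 := Complex.exp_ne_zero _
    set q := cexp (2 * Real.pi * I * w)
    have hI := I_ne_zero
    have h2 : q - 1 ≠ 0 := by
      intro h; apply hne; rw [sub_eq_zero.mp h]; simp
    have h3 : 1 - q ≠ 0 := by rw [← neg_sub]; exact neg_ne_zero.mpr h2
    have h4 : 1 - q⁻¹ = (q - 1) / q := by field_simp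
    rw [h4]
    field_simp
    ring_nf
    simp only [I_sq]
    ring

end ZetaZeros
-- The function `balance`: constancy in w and its value.
namespace ZetaZeros
open Complex Filter MeasureTheory Set

variable {τ : ℂ}

/-- The combination of the tail sum and the Gauss sum that does not depend on `w`. -/
noncomputable def balance (τ s w : ℂ) : ℂ :=
  s * tailSum τ s w + w ^ (-s) * (log (1 - cexp (2 * Real.pi * τ * w)) + pairSum s w + 1 / s -
    Real.pi * τ * w / (1 - s))

/-- The derivative of s times the tail sum cancels the one that w^{-s} contributes in front of log(1
- q). The cotangents cancel, 1/w is absorbed by 1/s, and the leftover πτ by the linear term. -/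
theorem hasDerivAt_balance (hτ : τ = I ∨ τ = -I) {s : ℂ} (hs : ∀ m : ℕ, s ≠ m) {w : ℂ}
    (hw : 0 < w.re) (hτw : (τ * w).re < 0) : HasDerivAt (balance τ s) 0 w := by
  have hw0 : w ≠ 0 := slitPlane_ne_zero (Or.inl hw)
  have hs0 : s ≠ 0 := by simpa using hs 0
  have hs1 : 1 - s ≠ 0 := sub_ne_zero.mpr (by simpa using (hs 1).symm)
  have h1 := (hasDerivAt_tailSum hτ s hw hτw).const_mul s
  have h2 := (hasDerivAt_id' w).cpow_const (c := -s) (Or.inl hw)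
  have h3 := hasDerivAt_cpow_mul_pairSum hτ hs hw hτw
  have h4 := (((hasDerivAt_log_one_sub_nome hτ hτw).add_const (1 / s)).fun_sub
    (((hasDerivAt_id' w).const_mul (Real.pi * τ)).div_const (1 - s)))
  have h5 := (h1.fun_add (h2.fun_mul h4)).fun_add h3
  have e : balance τ s = fun v => s * tailSum τ s v + v ^ (-s) *
      (log (1 - cexp (2 * Real.pi * τ * v)) + 1 / s - Real.pi * τ * v / (1 - s)) +
      v ^ (-s) * pairSum s v := by
    funext v
    simp only [balance]
    ring
  rw [e]
  refine h5.congr_deriv ?_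
  rw [cpow_sub _ _ hw0, cpow_one]
  field_simp
  ring

theorem balance_eq (hτ : τ = I ∨ τ = -I) {s : ℂ} (hs : ∀ m : ℕ, s ≠ m) {v w : ℂ}
    (hv : 0 < v.re) (hτv : (τ * v).re < 0) (hw : 0 < w.re) (hτw : (τ * w).re < 0) :
    balance τ s v = balance τ s w := by
  set Q : Set ℂ := {v | 0 < v.re} ∩ {v | (τ * v).re < 0}
  have hQo : IsOpen Q := (isOpen_lt continuous_const continuous_re).inter
    (isOpen_lt (continuous_re.comp (continuous_const_mul τ)) continuous_const)
  have hQc : Convex ℝ Q := (convex_halfSpace_re_gt _).inter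
    (convex_halfSpace_lt (f := fun v : ℂ => (τ * v).re)
      ⟨fun x y => by simp [mul_add], fun c x => by
        rw [real_smul, mul_left_comm, re_ofReal_mul, smul_eq_mul]⟩ 0)
  exact hQo.is_const_of_deriv_eq_zero hQc.isPreconnected
    (fun x hx => (hasDerivAt_balance hτ hs hx.1 hx.2).differentiableAt.differentiableWithinAt)
    (fun x hx => (hasDerivAt_balance hτ hs hx.1 hx.2).deriv) ⟨hv, hτv⟩ ⟨hw, hτw⟩

theorem tendsto_cpow_corner {p : ℂ} (hp : 0 < p.re) :
    Tendsto (fun ε : ℝ => ((1 + τ) * (ε : ℂ)) ^ p) (𝓝[>] 0) (𝓝 0) := by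
  have hp0 : p ≠ 0 := by rintro rfl; simp at hp
  have h1 : Tendsto (fun z : ℂ => z ^ p) (𝓝 0) (𝓝 (0 ^ p)) :=
    (continuousAt_cpow_zero_of_re_pos hp).tendsto.comp
      (tendsto_id.prodMk_nhds tendsto_const_nhds)
  rw [zero_cpow hp0] at h1
  exact h1.comp tendsto_corner

/-- The product is split as w^{-s-1} · w/(1 - q) · (1 - q) log(1 - q). The outer factors tend to 0,
the first because Re s < -1, and the middle one has a finite limit. -/
theorem tendsto_cpow_mul_log_corner (hτ : τ = I ∨ τ = -I) {s : ℂ} (hs : s.re < -1) :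
    Tendsto (fun ε : ℝ => ((1 + τ) * (ε : ℂ)) ^ (-s) *
      log (1 - cexp (2 * Real.pi * τ * ((1 + τ) * ε)))) (𝓝[>] 0) (𝓝 0) := by
  set c : ℂ := 2 * Real.pi * τ with hc
  have hc0 : c ≠ 0 := mul_ne_zero (by simp [Real.pi_ne_zero]) (direction_ne_zero hτ)
  have h1 : HasDerivAt (fun w : ℂ => 1 - cexp (c * w)) (-c) 0 := by
    simpa using (((hasDerivAt_id' (0 : ℂ)).const_mul c).cexp).const_sub 1
  have h2 := (hasDerivAt_iff_tendsto_slope.mp h1).inv₀ (neg_ne_zero.mpr hc0)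
  have hcor : Tendsto (fun ε : ℝ => (1 + τ) * (ε : ℂ)) (𝓝[>] 0) (𝓝[≠] 0) := by
    refine tendsto_nhdsWithin_iff.mpr ⟨tendsto_corner, ?_⟩
    filter_upwards [self_mem_nhdsWithin] with ε hε
    exact slitPlane_ne_zero (Or.inl (corner_mem hτ hε).1)
  have h3 : Tendsto (fun ε : ℝ => (1 - cexp (c * ((1 + τ) * ε))) *
      log (1 - cexp (c * ((1 + τ) * ε)))) (𝓝[>] 0) (𝓝 0) := by
    refine tendsto_mul_log_nhds_zero.comp (f := fun ε : ℝ => 1 - cexp (c * ((1 + τ) * ε))) ?_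
    have := h1.continuousAt.tendsto.comp (tendsto_corner (τ := τ))
    simp only [mul_zero, Complex.exp_zero, sub_self] at this
    exact this
  have h4 := ((tendsto_cpow_corner (τ := τ) (p := -s - 1) (by
    rw [sub_re, neg_re, one_re]; linarith)).mul (h2.comp hcor)).mul h3
  rw [zero_mul, zero_mul] at h4
  refine h4.congr' ?_
  filter_upwards [self_mem_nhdsWithin] with ε hε
  have hw0 := slitPlane_ne_zero (Or.inl (corner_mem hτ hε).1)
  have hne : 1 - cexp (c * ((1 + τ) * ε)) ≠ 0 :=
    ne_one_of_mem_cutPlane (mem_cutPlane_of_norm_lt_one (norm_nome_lt_one (corner_mem hτ hε).2))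
  simp only [Function.comp_apply]
  rw [slope_def_field, mul_zero, Complex.exp_zero, sub_self, sub_zero, sub_zero,
    cpow_sub _ _ hw0, cpow_one]
  generalize 1 - cexp (c * ((1 + τ) * ε)) = A at hne
  generalize (1 + τ) * (ε : ℂ) = v at hw0
  field_simp

theorem tendsto_pairSum_corner_bounded {s : ℂ} (hs : ∀ m : ℕ, s ≠ m) (hs1 : 0 < (-s).re) :
    Tendsto (fun ε : ℝ => ((1 + τ) * (ε : ℂ)) ^ (-s) * pairSum s ((1 + τ) * ε))
      (𝓝[>] 0) (𝓝 0) := by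
  obtain ⟨δ, hδ, h⟩ := exists_le_norm_natCast_sub hs
  have hb : ∀ᶠ ε : ℝ in 𝓝[>] 0, ‖pairSum s ((1 + τ) * ε)‖ ≤
      ∑' k : ℕ, 4 / δ * 1 ^ 2 * (1 / ((k : ℝ) + 1) ^ 2) := by
    have hn := (tendsto_corner (τ := τ)).norm
    rw [norm_zero] at hn
    filter_upwards [hn.eventually (gt_mem_nhds (by norm_num : (0 : ℝ) < 1 / 2))] with ε hε
    refine tsum_of_norm_bounded (summable_one_div_succ_sq.mul_left _).hasSum fun k => ?_
    refine (norm_pairTerm_le hδ h (by linarith [Nat.cast_nonneg (α := ℝ) k])).trans ?_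
    gcongr
    linarith
  exact (tendsto_cpow_corner hs1).zero_mul_isBoundedUnder_le ⟨_, eventually_map.mpr hb⟩

/-- As w → 0 on the diagonal, everything carrying the factor w^{-s} vanishes, and only the tail sum
remains. -/
theorem balance_eq_of_re_lt (hτ : τ = I ∨ τ = -I) {s : ℂ} (hs : s.re < -1) {w : ℂ}
    (hw : 0 < w.re) (hτw : (τ * w).re < 0) :
    balance τ s w = s * (τ ^ (-s) * (2 * Real.pi : ℂ) ^ s * Gamma (-s) * riemannZeta (1 - s)) := by
  have hs' : ∀ m : ℕ, s ≠ m := by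
    rintro m rfl
    rw [natCast_re] at hs
    linarith [Nat.cast_nonneg (α := ℝ) m]
  have hre : 0 < (-s).re := by rw [neg_re]; linarith
  have h1 := (tendsto_tailSum_corner hτ hs).const_mul s
  have h2 := tendsto_cpow_mul_log_corner hτ hs
  have h3 := tendsto_pairSum_corner_bounded (τ := τ) hs' hre
  have h4 : Tendsto (fun ε : ℝ => ((1 + τ) * (ε : ℂ)) ^ (-s) *
      (1 / s - Real.pi * τ * ((1 + τ) * ε) / (1 - s))) (𝓝[>] 0)
      (𝓝 (0 * (1 / s - Real.pi * τ * 0 / (1 - s)))) :=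
    (tendsto_cpow_corner hre).mul
      (tendsto_const_nhds.sub ((tendsto_corner.const_mul _).div_const _))
  have h5 := h1.add ((h2.add h3).add h4)
  simp only [zero_mul, add_zero] at h5
  refine tendsto_nhds_unique (tendsto_const_nhds.congr' ?_) h5
  filter_upwards [self_mem_nhdsWithin] with ε hε
  rw [balance_eq hτ hs' hw hτw (corner_mem hτ hε).1 (corner_mem hτ hε).2, balance]
  ring

theorem isPreconnected_compl_range_intCast : IsPreconnected (range ((↑) : ℤ → ℂ))ᶜ :=
  ((countable_range _).isPathConnected_compl_of_one_lt_rank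
    (by rw [rank_real_complex]; norm_num)).isConnected.isPreconnected

theorem balance_eq_zeta_one_sub (hτ : τ = I ∨ τ = -I) {s : ℂ} (hs : ∀ m : ℤ, s ≠ m) {w : ℂ}
    (hw : 0 < w.re) (hτw : (τ * w).re < 0) :
    balance τ s w = s * (τ ^ (-s) * (2 * Real.pi : ℂ) ^ s * Gamma (-s) * riemannZeta (1 - s)) := by
  -- Constancy in w moves the problem to this fixed v with ‖v‖ ≤ 1/2, where the Gauss sum is
  -- holomorphic in s and the identity theorem applies.
  set v : ℂ := (1 + τ) * ((1 / 4 : ℝ) : ℂ)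
  obtain ⟨hv, hτv⟩ := corner_mem hτ (by norm_num : (0 : ℝ) < 1 / 4)
  change 0 < v.re at hv
  change (τ * v).re < 0 at hτv
  have hvn : ‖v‖ ≤ 1 / 2 := by
    rw [norm_mul, norm_real, Real.norm_of_nonneg (by norm_num)]
    have : ‖(1 : ℂ) + τ‖ ≤ 2 := (norm_add_le _ _).trans (by rw [norm_direction hτ]; norm_num)
    linarith
  have hv0 : v ≠ 0 := slitPlane_ne_zero (Or.inl hv)
  have hsub : (range ((↑) : ℤ → ℂ))ᶜ ⊆ (range ((↑) : ℕ → ℂ))ᶜ := by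
    rintro t ht ⟨m, rfl⟩
    exact ht ⟨m, by simp⟩
  have hs' : ∀ m : ℕ, s ≠ m := fun m => by simpa using hs m
  have hU : IsOpen (range ((↑) : ℤ → ℂ))ᶜ := isOpen_compl_range_intCast
  have hne : ∀ t ∈ (range ((↑) : ℤ → ℂ))ᶜ, ∀ m : ℤ, t ≠ m := fun t ht m hm => ht ⟨m, hm.symm⟩
  have hf : DifferentiableOn ℂ (fun s => balance τ s v) (range ((↑) : ℤ → ℂ))ᶜ := by
    intro t ht
    have ht0 : t ≠ 0 := by simpa using hne t ht 0
    have ht1 : 1 - t ≠ 0 := sub_ne_zero.mpr (by simpa using (hne t ht 1).symm)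
    have hp : DifferentiableAt ℂ (fun s => pairSum s v) t :=
      (differentiableOn_pairSum_parameter hvn).differentiableAt
        (isClosed_range_natCast.isOpen_compl.mem_nhds (hsub ht))
    have hT := differentiable_tailSum hτ hv hτv.le t
    have hc : DifferentiableAt ℂ (fun s : ℂ => v ^ (-s)) t :=
      differentiableAt_id.neg.const_cpow (Or.inl hv0)
    have h1 : DifferentiableAt ℂ (fun s : ℂ => 1 / s) t :=
      DifferentiableAt.fun_div (by fun_prop) (by fun_prop) ht0
    have h2 : DifferentiableAt ℂ (fun s : ℂ => Real.pi * τ * v / (1 - s)) t :=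
      DifferentiableAt.fun_div (by fun_prop) (by fun_prop) ht1
    exact ((differentiableAt_id.fun_mul hT).fun_add (hc.fun_mul
      ((((differentiableAt_const _).fun_add hp).fun_add h1).fun_sub h2))).differentiableWithinAt
  have hg : DifferentiableOn ℂ (fun s => s * (τ ^ (-s) * (2 * Real.pi : ℂ) ^ s * Gamma (-s) *
      riemannZeta (1 - s))) (range ((↑) : ℤ → ℂ))ᶜ := by
    intro t ht
    have hπ : (2 * Real.pi : ℂ) ≠ 0 := by simp [Real.pi_ne_zero]
    have h1 : DifferentiableAt ℂ (fun s : ℂ => τ ^ (-s)) t :=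
      differentiableAt_id.neg.const_cpow (Or.inl (direction_ne_zero hτ))
    have h2 : DifferentiableAt ℂ (fun s : ℂ => (2 * Real.pi : ℂ) ^ s) t :=
      differentiableAt_id.const_cpow (Or.inl hπ)
    have h3 : DifferentiableAt ℂ (fun s : ℂ => Gamma (-s)) t :=
      (differentiableAt_Gamma (-t) fun m hm => hne t ht m (by
        rw [Int.cast_natCast]; exact neg_injective hm)).comp t differentiableAt_id.neg
    have h4 : DifferentiableAt ℂ (fun s : ℂ => riemannZeta (1 - s)) t :=
      (differentiableAt_riemannZeta (s := 1 - t) (fun h => hne t ht 0 (by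
        rw [Int.cast_zero]; linear_combination -h))).comp t (differentiableAt_id.const_sub 1)
    exact (differentiableAt_id.fun_mul (((h1.fun_mul h2).fun_mul h3).fun_mul
      h4)).differentiableWithinAt
  have hmem : (-5 / 2 : ℂ) ∈ (range ((↑) : ℤ → ℂ))ᶜ := by
    rintro ⟨m, hm⟩
    have h2 : ((2 * m : ℤ) : ℂ) = ((-5 : ℤ) : ℂ) := by push_cast; rw [hm]; ring
    have h3 : 2 * m = -5 := by exact_mod_cast h2
    omega
  have hnear : {t : ℂ | t.re < -1} ∈ 𝓝 (-5 / 2 : ℂ) :=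
    (isOpen_lt continuous_re continuous_const).mem_nhds (by
      have : (-5 / 2 : ℂ) = ((-5 / 2 : ℝ) : ℂ) := by push_cast; ring
      rw [mem_ofPred_eq, this, ofReal_re]; norm_num)
  rw [balance_eq hτ hs' hw hτw hv hτv]
  refine (hf.analyticOnNhd hU).eqOn_of_preconnected_of_eventuallyEq (hg.analyticOnNhd hU)
    isPreconnected_compl_range_intCast hmem ?_ (fun ⟨m, hm⟩ => hs m hm.symm)
  filter_upwards [hnear] with t ht
  exact balance_eq_of_re_lt hτ ht hv hτv

theorem direction_cpow_neg {σ : ℝ} (hσ : σ = 1 ∨ σ = -1) (s : ℂ) :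
    ((σ : ℂ) * I) ^ (-s) = cos (Real.pi / 2 * s) - σ * I * sin (Real.pi / 2 * s) := by
  have h : log ((σ : ℂ) * I) = σ * (Real.pi / 2 * I) := by
    rcases hσ with rfl | rfl
    · rw [ofReal_one, one_mul, one_mul, log_I]
    · rw [ofReal_neg, ofReal_one, neg_one_mul, neg_one_mul, log_neg_I]; ring
  have hne : (σ : ℂ) * I ≠ 0 := by rcases hσ with rfl | rfl <;> simp
  rw [cpow_def_of_ne_zero hne, h,
    show (σ : ℂ) * (Real.pi / 2 * I) * -s = (-(σ * (Real.pi / 2 * s))) * I by ring, exp_mul_I,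
    cos_neg, sin_neg]
  rcases hσ with rfl | rfl
  · simp; ring
  · simp; ring

theorem direction_eq {σ : ℝ} (hσ : σ = 1 ∨ σ = -1) : (σ : ℂ) * I = I ∨ (σ : ℂ) * I = -I := by
  rcases hσ with rfl | rfl <;> simp

theorem sin_pi_div_two_mul_ne_zero {s : ℂ} (hs : ∀ m : ℤ, s ≠ m) : sin (Real.pi / 2 * s) ≠ 0 := by
  rw [Ne, sin_eq_zero_iff]
  rintro ⟨k, hk⟩
  have hπ : (Real.pi : ℂ) ≠ 0 := ofReal_ne_zero.mpr Real.pi_ne_zero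
  refine hs (2 * k) (mul_left_cancel₀ hπ ?_)
  push_cast
  linear_combination 2 * hk

/-- The functional equation replaces ζ(1 - s) by ζ(s), and the reflection formula collapses the
Gamma factors. The surviving (σi)^{-s}/sin(πs/2) is cot(πs/2) - σi. -/
theorem balance_eq_zeta {σ : ℝ} (hσ : σ = 1 ∨ σ = -1) {s : ℂ} (hs : ∀ m : ℤ, s ≠ m) {w : ℂ}
    (hw : 0 < w.re) (hτw : ((σ : ℂ) * I * w).re < 0) :
    balance ((σ : ℂ) * I) s w = -(Real.pi * riemannZeta s *
      (cos (Real.pi / 2 * s) / sin (Real.pi / 2 * s) - σ * I)) := by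
  have hs0 : s ≠ 0 := by simpa using hs 0
  have hs1 : s ≠ 1 := by simpa using hs 1
  have hneg : ∀ m : ℕ, s ≠ -m := fun m => by simpa using hs (-m)
  have hsin := sin_pi_div_two_mul_ne_zero hs
  have hπ2 : (2 * Real.pi : ℂ) ≠ 0 := by simp [Real.pi_ne_zero]
  have hπ : (Real.pi : ℂ) ≠ 0 := ofReal_ne_zero.mpr Real.pi_ne_zero
  rw [balance_eq_zeta_one_sub (direction_eq hσ) hs hw hτw, riemannZeta_one_sub hneg hs1,
    direction_cpow_neg hσ]
  have h1 := Gamma_mul_Gamma_one_sub s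
  have h2 : Gamma (1 - s) = -s * Gamma (-s) := by
    have := Gamma_add_one (-s) (neg_ne_zero.mpr hs0)
    rw [← this]; ring_nf
  have h3 : sin (Real.pi * s) = 2 * sin (Real.pi / 2 * s) * cos (Real.pi / 2 * s) := by
    rw [← sin_two_mul]; ring_nf
  have h4 : (2 * Real.pi : ℂ) ^ s * (2 * Real.pi : ℂ) ^ (-s) = 1 := by
    rw [← cpow_add _ _ hπ2]; simp
  have hsinπ : sin (Real.pi * s) ≠ 0 := by
    rw [Ne, sin_eq_zero_iff]
    rintro ⟨k, hk⟩
    exact hs k (mul_left_cancel₀ hπ (by rw [hk]; ring))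
  have hcos : cos (Real.pi / 2 * s) ≠ 0 := by
    intro h; apply hsinπ; rw [h3, h, mul_zero]
  have h5 : s * Gamma (-s) * Gamma s =
      -(Real.pi / (2 * sin (Real.pi / 2 * s) * cos (Real.pi / 2 * s))) := by
    rw [← h3, ← h1, h2]; ring
  rw [show (Real.pi : ℂ) * s / 2 = Real.pi / 2 * s by ring]
  have h6 : s * ((cos (Real.pi / 2 * s) - σ * I * sin (Real.pi / 2 * s)) * (2 * Real.pi : ℂ) ^ s *
      Gamma (-s) * (2 * (2 * Real.pi : ℂ) ^ (-s) * Gamma s * cos (Real.pi / 2 * s) *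
        riemannZeta s)) = (s * Gamma (-s) * Gamma s) *
      ((2 * Real.pi : ℂ) ^ s * (2 * Real.pi : ℂ) ^ (-s)) * (2 * cos (Real.pi / 2 * s) *
        riemannZeta s * (cos (Real.pi / 2 * s) - σ * I * sin (Real.pi / 2 * s))) := by ring
  rw [h6, h5, h4]
  generalize sin (Real.pi / 2 * s) = a at hsin
  generalize cos (Real.pi / 2 * s) = b at hcos
  field_simp

end ZetaZeros
-- One-sided boundary values of the Gauss sum on the real axis.
namespace ZetaZeros
open Complex Filter MeasureTheory Set

/-- The boundary value of `gaussLift s` at a real point, taken from the side `σ * Im z > 0`. -/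
noncomputable def sideLift (σ : ℝ) (s : ℂ) (x : ℝ) : ℂ :=
  (x : ℂ) * (gaussSide σ 1 (1 - s) (2 - s) (x : ℂ) / (1 - s))

theorem sideLift_of_lt_one (σ : ℝ) (s : ℂ) {x : ℝ} (hx : x < 1) :
    sideLift σ s x = gaussLift s x := by
  have h : 1 - (x : ℂ) ∈ slitPlane := ofReal_mem_cutPlane.mpr hx
  rw [sideLift, gaussSide, if_pos h, gaussLift]

theorem nhdsWithin_side_neBot {σ : ℝ} (hσ : σ = 1 ∨ σ = -1) (x : ℝ) :
    (𝓝[{w : ℂ | 0 < σ * w.im}] (x : ℂ)).NeBot := by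
  rw [← mem_closure_iff_nhdsWithin_neBot]
  have h : Tendsto (fun ε : ℝ => (x : ℂ) + σ * I * ε) (𝓝[>] 0) (𝓝 x) := by
    have : Tendsto (fun ε : ℝ => (x : ℂ) + σ * I * ε) (𝓝 0) (𝓝 (x + σ * I * (0 : ℝ))) :=
      Continuous.tendsto (by fun_prop) 0
    simpa using this.mono_left nhdsWithin_le_nhds
  refine mem_closure_of_tendsto h ?_
  filter_upwards [self_mem_nhdsWithin] with ε hε
  have hε' : 0 < ε := hε
  rcases hσ with rfl | rfl <;> simpa using hε'

theorem tendsto_log_one_sub_side {σ : ℝ} (hσ : σ = 1 ∨ σ = -1) {x : ℝ} (hx : 1 < x) :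
    Tendsto (fun z : ℂ => log (1 - z)) (𝓝[{w : ℂ | 0 < σ * w.im}] (x : ℂ))
      (𝓝 (Real.log (x - 1) - σ * Real.pi * I)) := by
  have hre : (1 - (x : ℂ)).re < 0 := by simpa using hx
  have him : (1 - (x : ℂ)).im = 0 := by simp
  have hn : ‖1 - (x : ℂ)‖ = x - 1 := by
    rw [← ofReal_one, ← ofReal_sub, norm_real, Real.norm_of_nonpos (by linarith)]; ring
  have hc : Tendsto (fun z : ℂ => 1 - z) (𝓝[{w : ℂ | 0 < σ * w.im}] (x : ℂ))
      (𝓝 (1 - (x : ℂ))) :=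
    (Continuous.tendsto (by fun_prop) _).mono_left nhdsWithin_le_nhds
  rcases hσ with rfl | rfl
  · have h := tendsto_log_nhdsWithin_im_neg_of_re_neg_of_im_zero hre him
    rw [hn] at h
    rw [ofReal_one, one_mul]
    refine h.comp (tendsto_nhdsWithin_iff.mpr ⟨hc, ?_⟩)
    filter_upwards [self_mem_nhdsWithin] with z hz
    simpa using hz
  · have h := tendsto_log_nhdsWithin_im_nonneg_of_re_neg_of_im_zero hre him
    rw [hn] at h
    rw [ofReal_neg, ofReal_one, neg_one_mul, neg_mul, sub_neg_eq_add]
    refine h.comp (tendsto_nhdsWithin_iff.mpr ⟨hc, ?_⟩)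
    filter_upwards [self_mem_nhdsWithin] with z hz
    have : z.im < 0 := by simpa using hz
    simpa using this.le

theorem im_ne_zero_of_side {σ : ℝ} {z : ℂ} (hz : 0 < σ * z.im) : z.im ≠ 0 := by
  intro h
  rw [h, mul_zero] at hz
  exact hz.false

theorem sideLift_eq_of_tendsto {σ : ℝ} (hσ : σ = 1 ∨ σ = -1) {s : ℂ} (hs : ∀ m : ℕ, s ≠ m) {x : ℝ}
    (hx : 1 ≤ x) {y : ℂ}
    (h : Tendsto (gaussLift s) (𝓝[{w : ℂ | 0 < σ * w.im}] (x : ℂ)) (𝓝 y)) :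
    sideLift σ s x = y := by
  have h1 : 1 - s ≠ 0 := sub_ne_zero.mpr (by simpa using (hs 1).symm)
  have hx0 : (x : ℂ) ≠ 0 := ofReal_ne_zero.mpr (by linarith)
  have hn : 1 - (x : ℂ) ∉ slitPlane := fun h => by
    have := ofReal_mem_cutPlane.mp h
    linarith
  have := nhdsWithin_side_neBot hσ x
  have h2 : Tendsto (gaussPrincipal 1 (1 - s) (2 - s)) (𝓝[{w : ℂ | 0 < σ * w.im}] (x : ℂ))
      (𝓝 (y / x * (1 - s))) := by
    have h3 := (h.div (tendsto_id.mono_left nhdsWithin_le_nhds) hx0).mul_const (1 - s)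
    refine h3.congr' ?_
    filter_upwards [self_mem_nhdsWithin] with z hz
    have hz0 : z ≠ 0 := by
      rintro rfl
      exact im_ne_zero_of_side hz rfl
    simp only [Pi.div_apply, gaussLift, id]
    field_simp
  rw [sideLift, gaussSide, if_neg hn, h2.limUnder_eq]
  field_simp

theorem tendsto_gaussLift_side_of_lt_one {σ : ℝ} {s : ℂ} (hs : ∀ m : ℕ, s ≠ m) {x : ℝ}
    (hx : x < 1) : Tendsto (gaussLift s) (𝓝 (x : ℂ)) (𝓝 (sideLift σ s x)) := by
  rw [sideLift_of_lt_one σ s hx]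
  exact ((differentiableOn_gaussLift hs).differentiableAt
    (isOpen_cutPlane.mem_nhds (ofReal_mem_cutPlane.mpr hx))).continuousAt

/-- In `exists_gaussLift_regular` with R = x only the logarithm depends on the side: log(1 - z)
tends to log(x - 1) - σπi. Hence one y serves both signs and the jump is 2πi x^s. -/
theorem exists_tendsto_gaussLift_side {s : ℂ} (hs : ∀ m : ℕ, s ≠ m) {x : ℝ} (hx : 1 < x) :
    ∃ y : ℂ, ∀ σ : ℝ, (σ = 1 ∨ σ = -1) →
      Tendsto (gaussLift s) (𝓝[{w : ℂ | 0 < σ * w.im}] (x : ℂ))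
        (𝓝 (y + σ * Real.pi * I * (x : ℂ) ^ s)) := by
  obtain ⟨H, hH, hG⟩ := exists_gaussLift_regular hs hx.le
  have hB : (x : ℂ) ∈ Metric.ball (x : ℂ) x := Metric.mem_ball_self (by linarith)
  refine ⟨(x : ℂ) ^ s * (H x - Real.log (x - 1)), fun σ hσ => ?_⟩
  have h1 : Tendsto (fun z : ℂ => z ^ s) (𝓝[{w : ℂ | 0 < σ * w.im}] (x : ℂ)) (𝓝 ((x : ℂ) ^ s)) :=
    ((differentiableAt_id.cpow_const (Or.inl (by simpa using by linarith))).continuousAt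
      (x := (x : ℂ))).tendsto.mono_left nhdsWithin_le_nhds
  have h2 : Tendsto H (𝓝[{w : ℂ | 0 < σ * w.im}] (x : ℂ)) (𝓝 (H x)) :=
    (hH.differentiableAt (Metric.isOpen_ball.mem_nhds hB)).continuousAt.tendsto.mono_left
      nhdsWithin_le_nhds
  have h3 := h1.mul (h2.sub (tendsto_log_one_sub_side hσ hx))
  have e : (x : ℂ) ^ s * (H x - Real.log (x - 1)) + σ * Real.pi * I * (x : ℂ) ^ s =
      (x : ℂ) ^ s * (H x - (Real.log (x - 1) - σ * Real.pi * I)) := by ring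
  rw [e]
  refine h3.congr' ?_
  filter_upwards [self_mem_nhdsWithin, mem_nhdsWithin_of_mem_nhds (Metric.isOpen_ball.mem_nhds hB)]
    with z hz hzB
  exact (hG z hzB (mem_cutPlane_of_im_ne_zero (im_ne_zero_of_side hz))).symm

theorem tendsto_gaussLift_side {σ : ℝ} (hσ : σ = 1 ∨ σ = -1) {s : ℂ} (hs : ∀ m : ℕ, s ≠ m) {x : ℝ}
    (hx : x ≠ 1) :
    Tendsto (gaussLift s) (𝓝[{w : ℂ | 0 < σ * w.im}] (x : ℂ)) (𝓝 (sideLift σ s x)) := by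
  rcases hx.lt_or_gt with hx | hx
  · exact (tendsto_gaussLift_side_of_lt_one hs hx).mono_left nhdsWithin_le_nhds
  · obtain ⟨y, hy⟩ := exists_tendsto_gaussLift_side hs hx
    rw [sideLift_eq_of_tendsto hσ hs hx.le (hy σ hσ)]
    exact hy σ hσ

theorem sideLift_sub_sideLift {s : ℂ} (hs : ∀ m : ℕ, s ≠ m) {x : ℝ} (hx : 1 < x) :
    sideLift 1 s x - sideLift (-1) s x = 2 * Real.pi * I * (x : ℂ) ^ s := by
  obtain ⟨y, hy⟩ := exists_tendsto_gaussLift_side hs hx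
  rw [sideLift_eq_of_tendsto (Or.inl rfl) hs hx.le (hy 1 (Or.inl rfl)),
    sideLift_eq_of_tendsto (Or.inr rfl) hs hx.le (hy (-1) (Or.inr rfl))]
  push_cast
  ring

open Classical in
/-- The sum of the boundary values at `D / (k + 1)` and `-D / (k + 1)`, without the value at `1`. -/
noncomputable def sidePair (σ : ℝ) (s : ℂ) (D : ℝ) (k : ℕ) : ℂ :=
  (if (k : ℝ) + 1 = D then 0 else sideLift σ s (D / (k + 1))) + sideLift σ s (-(D / (k + 1)))

theorem sidePair_of_lt {σ : ℝ} {s : ℂ} {D : ℝ} (hD : 0 < D) {k : ℕ} (hk : D < k + 1) :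
    sidePair σ s D k = pairTerm s D k := by
  have h0 : (0 : ℝ) < k + 1 := by positivity
  have h1 : D / (k + 1) < 1 := by rwa [div_lt_one h0]
  have h2 : -(D / (k + 1)) < 1 := by
    have : 0 < D / (k + 1) := by positivity
    linarith
  rw [sidePair, if_neg hk.ne', sideLift_of_lt_one σ s h1, sideLift_of_lt_one σ s h2, pairTerm]
  push_cast
  rfl

theorem summable_sidePair {σ : ℝ} {s : ℂ} (hs : ∀ m : ℕ, s ≠ m) {D : ℝ} (hD : 0 < D) :
    Summable (sidePair σ s D) := by
  refine (summable_pairTerm hs D).congr_cofinite ?_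
  rw [Nat.cofinite_eq_atTop]
  filter_upwards [eventually_gt_atTop ⌈D⌉₊] with k hk
  exact (sidePair_of_lt hD (by have := Nat.lt_of_ceil_lt hk; linarith)).symm

open Classical in
/-- `pairTerm` without the contribution that is singular at the point `D`. -/
noncomputable def regularPair (s : ℂ) (D : ℝ) (w : ℂ) (k : ℕ) : ℂ :=
  (if (k : ℝ) + 1 = D then 0 else gaussLift s (w / (k + 1))) + gaussLift s (-(w / (k + 1)))

theorem tendsto_ray {σ : ℝ} (D : ℝ) (k : ℕ) :
    Tendsto (fun ε : ℝ => ((D : ℂ) + σ * I * ε) / (k + 1)) (𝓝[>] 0)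
      (𝓝 ((D / (k + 1) : ℝ) : ℂ)) := by
  have : Tendsto (fun ε : ℝ => ((D : ℂ) + σ * I * ε) / (k + 1)) (𝓝 0)
      (𝓝 (((D : ℂ) + σ * I * (0 : ℝ)) / (k + 1))) := Continuous.tendsto (by fun_prop) 0
  simpa using this.mono_left nhdsWithin_le_nhds

theorem tendsto_regularPair {σ : ℝ} (hσ : σ = 1 ∨ σ = -1) {s : ℂ} (hs : ∀ m : ℕ, s ≠ m) {D : ℝ}
    (hD : 0 < D) (k : ℕ) :
    Tendsto (fun ε : ℝ => regularPair s D (D + σ * I * ε) k) (𝓝[>] 0)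
      (𝓝 (sidePair σ s D k)) := by
  have h0 : (0 : ℝ) < k + 1 := by positivity
  have hneg : -(D / (k + 1)) < 1 := by
    have : 0 < D / (k + 1) := by positivity
    linarith
  refine Tendsto.add ?_ ?_
  · split_ifs with hk
    · exact tendsto_const_nhds
    · have hne : D / (k + 1) ≠ 1 := by
        rw [Ne, div_eq_one_iff_eq h0.ne']
        exact fun h => hk h.symm
      refine (tendsto_gaussLift_side hσ hs hne).comp
        (tendsto_nhdsWithin_iff.mpr ⟨tendsto_ray D k, ?_⟩)
      filter_upwards [self_mem_nhdsWithin] with ε hε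
      have hε' : 0 < ε := hε
      change 0 < σ * (((D : ℂ) + σ * I * ε) / (k + 1)).im
      rw [← Nat.cast_add_one (R := ℂ), div_natCast_im]
      rcases hσ with rfl | rfl
      · simp; positivity
      · simp; rw [neg_div]; linarith [show 0 < ε / ((k : ℝ) + 1) by positivity]
  · have h1 := (tendsto_ray (σ := σ) D k).neg
    rw [← ofReal_neg] at h1
    exact (tendsto_gaussLift_side_of_lt_one hs hneg).comp h1

theorem tendsto_tsum_regularPair {σ : ℝ} (hσ : σ = 1 ∨ σ = -1) {s : ℂ} (hs : ∀ m : ℕ, s ≠ m) {D : ℝ}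
    (hD : 0 < D) :
    Tendsto (fun ε : ℝ => ∑' k, regularPair s D (D + σ * I * ε) k) (𝓝[>] 0)
      (𝓝 (∑' k, sidePair σ s D k)) := by
  obtain ⟨δ, hδ, h⟩ := exists_le_norm_natCast_sub hs
  obtain ⟨N, hN⟩ := exists_nat_ge (2 * (D + 1))
  -- The finitely many terms whose argument may come near the cut are bounded by their limits plus
  -- 1. The others obey the quadratic bound, since ‖w‖ ≤ D + 1 and k ≥ N ≥ 2(D + 1).
  have hsum : Summable fun k : ℕ => if k < N then ‖sidePair σ s D k‖ + 1 else
      4 / δ * (D + 1) ^ 2 * (1 / ((k : ℝ) + 1) ^ 2) := by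
    refine (summable_one_div_succ_sq.mul_left (4 / δ * (D + 1) ^ 2)).congr_cofinite ?_
    rw [Nat.cofinite_eq_atTop]
    filter_upwards [eventually_ge_atTop N] with k hk
    rw [if_neg (not_lt.mpr hk)]
  have hfin : ∀ᶠ ε : ℝ in 𝓝[>] 0, ∀ k ∈ Finset.range N,
      ‖regularPair s D (D + σ * I * ε) k‖ < ‖sidePair σ s D k‖ + 1 :=
    (Finset.range N).eventually_all.mpr fun k _ =>
      (tendsto_regularPair hσ hs hD k).norm.eventually (gt_mem_nhds (by linarith))
  refine tendsto_tsum_of_dominated_convergence hsum (tendsto_regularPair hσ hs hD) ?_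
  filter_upwards [hfin, Ioo_mem_nhdsGT (zero_lt_one' ℝ)] with ε h1 hε k
  split_ifs with hk
  · exact (h1 k (Finset.mem_range.mpr hk)).le
  · have hkN : (N : ℝ) ≤ k := by exact_mod_cast not_lt.mp hk
    have hnorm : ‖(D : ℂ) + σ * I * ε‖ ≤ D + 1 := by
      refine (norm_add_le _ _).trans ?_
      have hσn : ‖(σ : ℂ) * I‖ = 1 := norm_direction (direction_eq hσ)
      rw [norm_mul, hσn, norm_real, norm_real, Real.norm_of_nonneg hD.le,
        Real.norm_of_nonneg hε.1.le]
      linarith [hε.2]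
    have hkD : ¬ (k : ℝ) + 1 = D := by
      intro he
      linarith
    have e : regularPair s D (D + σ * I * ε) k = pairTerm s (D + σ * I * ε) k := by
      rw [regularPair, if_neg hkD, pairTerm]
    rw [e]
    refine (norm_pairTerm_le hδ h (by linarith)).trans ?_
    gcongr

end ZetaZeros
-- Boundary values of log(1 - q), and the cancellation of singularities at integers.
namespace ZetaZeros
open Complex Filter MeasureTheory Set

open Classical in
/-- The part of the logarithmic boundary value that does not depend on the side. -/
noncomputable def logMean (s : ℂ) (D : ℝ) : ℂ :=
  if D ∈ range ((↑) : ℤ → ℝ) then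
    Real.log (2 * Real.pi * D) - (digamma (1 - s) + Real.eulerMascheroniConstant)
  else Real.log 2 + Real.log (Real.sin (Real.pi * D) ^ 2) / 2

theorem sin_sq_pi_mul_fract (D : ℝ) :
    Real.sin (Real.pi * Int.fract D) ^ 2 = Real.sin (Real.pi * D) ^ 2 := by
  rw [Int.fract, mul_sub, mul_comm Real.pi (⌊D⌋ : ℝ), Real.sin_sub_int_mul_pi, mul_pow,
    sq ((-1 : ℝ) ^ ⌊D⌋), ← mul_zpow]
  simp

/-- This is 1 - e^{2iθ} = -2i sin θ · e^{iθ}. Replacing D by its fractional part makes the sine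
nonnegative and keeps the angle σπ({D} - 1/2) within [-π/2, π/2], where the principal logarithm
reads it off. -/
theorem one_sub_exp_direction {σ : ℝ} (hσ : σ = 1 ∨ σ = -1) (D : ℝ) :
    1 - cexp (2 * Real.pi * (σ * I) * D) =
      2 * Real.sin (Real.pi * Int.fract D) *
        cexp (σ * Real.pi * I * (Int.fract D - 1 / 2)) := by
  set f := Int.fract D
  have hD : (D : ℂ) = (⌊D⌋ : ℤ) + f := by
    have := Int.floor_add_fract D
    exact_mod_cast this.symm
  have h1 : cexp (2 * Real.pi * (σ * I) * D) = cexp (2 * (σ * Real.pi * I * f)) := by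
    rcases hσ with rfl | rfl
    · rw [hD]
      refine Complex.exp_eq_exp_iff_exists_int.mpr ⟨⌊D⌋, ?_⟩
      push_cast
      ring
    · rw [hD]
      refine Complex.exp_eq_exp_iff_exists_int.mpr ⟨-⌊D⌋, ?_⟩
      push_cast
      ring
  have h2 : cexp (σ * Real.pi * I * (f - 1 / 2)) = cexp (σ * Real.pi * I * f) * (-(σ * I)) := by
    rw [mul_sub, Complex.exp_sub, div_eq_mul_inv, ← Complex.exp_neg]
    congr 1
    rcases hσ with rfl | rfl
    · rw [show -(((1 : ℝ) : ℂ) * Real.pi * I * (1 / 2)) = -(Real.pi / 2 * I) by push_cast; ring,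
        Complex.exp_neg, Complex.exp_pi_div_two_mul_I]
      simp
    · rw [show -(((-1 : ℝ) : ℂ) * Real.pi * I * (1 / 2)) = Real.pi / 2 * I by push_cast; ring,
        Complex.exp_pi_div_two_mul_I]
      simp
  have h3 : (Real.sin (Real.pi * f) : ℂ) =
      (cexp (-(Real.pi * I * f)) - cexp (Real.pi * I * f)) * I / 2 := by
    rw [ofReal_sin, Complex.sin]
    push_cast
    ring_nf
  rw [h1, h2, h3, two_mul, Complex.exp_add]
  rcases hσ with rfl | rfl
  · simp only [ofReal_one, one_mul, Complex.exp_neg]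
    have := Complex.exp_ne_zero (Real.pi * I * f)
    generalize cexp (Real.pi * I * f) = u at this
    field_simp
    ring_nf
    simp only [I_sq]
    ring
  · simp only [ofReal_neg, ofReal_one, neg_mul, one_mul, Complex.exp_neg]
    have := Complex.exp_ne_zero (Real.pi * I * f)
    generalize cexp (Real.pi * I * f) = u at this
    field_simp
    ring_nf
    simp only [I_sq]
    ring

theorem fract_pos_of_notMem {D : ℝ} (h : D ∉ range ((↑) : ℤ → ℝ)) : 0 < Int.fract D :=
  Int.fract_pos.mpr fun he => h ⟨⌊D⌋, he.symm⟩

theorem sin_pi_mul_fract_pos {D : ℝ} (h : D ∉ range ((↑) : ℤ → ℝ)) :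
    0 < Real.sin (Real.pi * Int.fract D) := by
  have := fract_pos_of_notMem h
  refine Real.sin_pos_of_pos_of_lt_pi (by positivity) ?_
  nlinarith [Real.pi_pos, Int.fract_lt_one D]

theorem one_sub_exp_direction_eq_exp {σ : ℝ} (hσ : σ = 1 ∨ σ = -1) {D : ℝ}
    (h : D ∉ range ((↑) : ℤ → ℝ)) :
    1 - cexp (2 * Real.pi * (σ * I) * D) =
      cexp (Real.log 2 + Real.log (Real.sin (Real.pi * D) ^ 2) / 2 +
        σ * Real.pi * I * (Int.fract D - 1 / 2)) := by
  have hp := sin_pi_mul_fract_pos h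
  rw [one_sub_exp_direction hσ, Complex.exp_add, ← sin_sq_pi_mul_fract, Real.log_pow,
    show (Real.log 2 : ℂ) + ((2 : ℕ) * Real.log (Real.sin (Real.pi * Int.fract D)) : ℝ) / 2 =
      ((Real.log 2 + Real.log (Real.sin (Real.pi * Int.fract D)) : ℝ) : ℂ) by push_cast; ring,
    ← ofReal_exp, Real.exp_add, Real.exp_log two_pos, Real.exp_log hp, ofReal_mul, ofReal_ofNat]

theorem im_log_direction_lt {σ : ℝ} (hσ : σ = 1 ∨ σ = -1) (D a : ℝ) :
    -(Real.pi) < ((a : ℂ) + σ * Real.pi * I * (Int.fract D - 1 / 2)).im ∧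
      ((a : ℂ) + σ * Real.pi * I * (Int.fract D - 1 / 2)).im < Real.pi := by
  have h0 := Int.fract_nonneg D
  have h1 := Int.fract_lt_one D
  have e : ((a : ℂ) + σ * Real.pi * I * (Int.fract D - 1 / 2)).im =
      σ * Real.pi * (Int.fract D - 1 / 2) := by
    rw [show (a : ℂ) + σ * Real.pi * I * (Int.fract D - 1 / 2) =
      (a : ℂ) + ((σ * Real.pi * (Int.fract D - 1 / 2) : ℝ) : ℂ) * I by push_cast; ring]
    simp
  rw [e]
  rcases hσ with rfl | rfl <;> constructor <;> nlinarith [Real.pi_pos]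

theorem log_one_sub_exp_direction {σ : ℝ} (hσ : σ = 1 ∨ σ = -1) {D : ℝ}
    (h : D ∉ range ((↑) : ℤ → ℝ)) :
    log (1 - cexp (2 * Real.pi * (σ * I) * D)) =
      Real.log 2 + Real.log (Real.sin (Real.pi * D) ^ 2) / 2 +
        σ * Real.pi * I * (Int.fract D - 1 / 2) := by
  rw [one_sub_exp_direction_eq_exp hσ h]
  have := im_log_direction_lt hσ D (Real.log 2 + Real.log (Real.sin (Real.pi * D) ^ 2) / 2)
  push_cast at this
  exact Complex.log_exp this.1 this.2.le

theorem one_sub_exp_direction_mem_slitPlane {σ : ℝ} (hσ : σ = 1 ∨ σ = -1) {D : ℝ}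
    (h : D ∉ range ((↑) : ℤ → ℝ)) : 1 - cexp (2 * Real.pi * (σ * I) * D) ∈ slitPlane := by
  rw [mem_slitPlane_iff_arg, ← log_im, log_one_sub_exp_direction hσ h]
  have := im_log_direction_lt hσ D (Real.log 2 + Real.log (Real.sin (Real.pi * D) ^ 2) / 2)
  push_cast at this
  refine ⟨this.2.ne, ?_⟩
  rw [one_sub_exp_direction_eq_exp hσ h]
  exact Complex.exp_ne_zero _

theorem tendsto_vertical (σ D : ℝ) :
    Tendsto (fun ε : ℝ => (D : ℂ) + σ * I * ε) (𝓝[>] 0) (𝓝 D) := by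
  have : Tendsto (fun ε : ℝ => (D : ℂ) + σ * I * ε) (𝓝 0) (𝓝 ((D : ℂ) + σ * I * (0 : ℝ))) :=
    Continuous.tendsto (by fun_prop) 0
  simpa using this.mono_left nhdsWithin_le_nhds

theorem tendsto_log_nome_of_notMem {σ : ℝ} (hσ : σ = 1 ∨ σ = -1) {D : ℝ}
    (h : D ∉ range ((↑) : ℤ → ℝ)) :
    Tendsto (fun ε : ℝ => log (1 - cexp (2 * Real.pi * (σ * I) * (D + σ * I * ε)))) (𝓝[>] 0)
      (𝓝 (Real.log 2 + Real.log (Real.sin (Real.pi * D) ^ 2) / 2 +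
        σ * Real.pi * I * (Int.fract D - 1 / 2))) := by
  rw [← log_one_sub_exp_direction hσ h]
  have hc : Continuous fun w : ℂ => 1 - cexp (2 * Real.pi * (σ * I) * w) := by fun_prop
  exact ((hc.tendsto _).clog (one_sub_exp_direction_mem_slitPlane hσ h)).comp
    (tendsto_vertical σ D)

theorem exp_direction_vertical {σ : ℝ} (hσ : σ = 1 ∨ σ = -1) (k : ℕ) (ε : ℝ) :
    cexp (2 * Real.pi * (σ * I) * (k + 1 + σ * I * ε)) = (Real.exp (-(2 * Real.pi * ε)) : ℝ) := by
  rw [ofReal_exp]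
  refine Complex.exp_eq_exp_iff_exists_int.mpr ?_
  rcases hσ with rfl | rfl
  · refine ⟨k + 1, ?_⟩
    push_cast
    linear_combination (2 * Real.pi * ε : ℂ) * I_mul_I
  · refine ⟨-(k + 1), ?_⟩
    push_cast
    linear_combination (2 * Real.pi * ε : ℂ) * I_mul_I

theorem log_neg_direction {σ : ℝ} (hσ : σ = 1 ∨ σ = -1) {r : ℝ} (hr : 0 < r) :
    log (-(σ * I * r)) = Real.log r - σ * Real.pi / 2 * I := by
  rw [show -((σ : ℂ) * I * r) = r * (-(σ * I)) by ring,
    log_ofReal_mul hr (by rcases hσ with rfl | rfl <;> simp)]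
  rcases hσ with rfl | rfl
  · rw [ofReal_one, one_mul, log_neg_I]
    ring
  · rw [show -(((-1 : ℝ) : ℂ) * I) = I by push_cast; ring, log_I]
    push_cast
    ring

theorem tendsto_log_one_sub_exp_sub_log {D : ℝ} (hD : 0 < D) :
    Tendsto (fun ε : ℝ => Real.log (1 - Real.exp (-(2 * Real.pi * ε))) - Real.log (ε / D)) (𝓝[>] 0)
      (𝓝 (Real.log (2 * Real.pi * D))) := by
  have h1 : HasDerivAt (fun ε : ℝ => 1 - Real.exp (-(2 * Real.pi * ε))) (2 * Real.pi) 0 := by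
    simpa using (((hasDerivAt_id' (0 : ℝ)).const_mul (2 * Real.pi)).fun_neg.exp).const_sub 1
  have h2 := (((hasDerivAt_iff_tendsto_slope.mp h1).mono_left
    (nhdsGT_le_nhdsNE 0)).mul_const D).log (by positivity)
  refine h2.congr' ?_
  filter_upwards [self_mem_nhdsWithin] with ε hε
  have hε' : 0 < ε := hε
  have hpos : 0 < 1 - Real.exp (-(2 * Real.pi * ε)) := by
    rw [sub_pos, Real.exp_lt_one_iff]
    have := Real.pi_pos
    nlinarith [mul_pos this hε']
  rw [slope_def_field, ← Real.log_div hpos.ne' (by positivity)]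
  congr 1
  simp only [mul_zero, neg_zero, Real.exp_zero, sub_self, sub_zero]
  generalize Real.exp (-(2 * Real.pi * ε)) = u
  field_simp

/-- Above an integer q is real, and log(1 - q) behaves like log(2πε). With z = w/(k + 1), the
singular part of G is -log(1 - z) = -log(ε/(k + 1)) + σπi/2. The logarithms of ε cancel, leaving
log(2π(k + 1)), the quarter turn, and the regular value H(1), a digamma value. -/
theorem tendsto_log_nome_add_gaussLift {σ : ℝ} (hσ : σ = 1 ∨ σ = -1) {s : ℂ}
    (hs : ∀ m : ℕ, s ≠ m) (k : ℕ) :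
    Tendsto (fun ε : ℝ => log (1 - cexp (2 * Real.pi * (σ * I) * (k + 1 + σ * I * ε))) +
      gaussLift s ((k + 1 + σ * I * ε) / (k + 1))) (𝓝[>] 0)
      (𝓝 (Real.log (2 * Real.pi * (k + 1)) - (digamma (1 - s) + Real.eulerMascheroniConstant) +
        σ * Real.pi * I / 2)) := by
  obtain ⟨H, hH, hG⟩ := exists_gaussLift_regular hs le_rfl
  have hD : (0 : ℝ) < k + 1 := by positivity
  have hk : (k : ℂ) + 1 ≠ 0 := Nat.cast_add_one_ne_zero k
  have hσ0 : (σ : ℂ) * I ≠ 0 := direction_ne_zero (direction_eq hσ)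
  have hB : (1 : ℂ) ∈ Metric.ball ((1 : ℝ) : ℂ) 1 := by simp
  have hz : Tendsto (fun ε : ℝ => ((k : ℂ) + 1 + σ * I * ε) / (k + 1)) (𝓝[>] 0) (𝓝 1) := by
    have := (tendsto_vertical σ (k + 1)).div_const (k + 1 : ℂ)
    push_cast at this
    rwa [div_self hk] at this
  have hz1 : ∀ ε : ℝ, 1 - ((k : ℂ) + 1 + σ * I * ε) / (k + 1) = -(σ * I * (ε / (k + 1) : ℝ)) := by
    intro ε
    push_cast
    field_simp
    ring
  have hzne : Tendsto (fun ε : ℝ => ((k : ℂ) + 1 + σ * I * ε) / (k + 1)) (𝓝[>] 0) (𝓝[≠] 1) := by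
    refine tendsto_nhdsWithin_iff.mpr ⟨hz, ?_⟩
    filter_upwards [self_mem_nhdsWithin] with ε hε
    have hε' : 0 < ε := hε
    have : 1 - ((k : ℂ) + 1 + σ * I * ε) / (k + 1) ≠ 0 := by
      rw [hz1, neg_ne_zero]
      exact mul_ne_zero hσ0 (ofReal_ne_zero.mpr (by positivity))
    exact fun h => this (sub_eq_zero.mpr (mem_singleton_iff.mp h).symm)
  have h1 := (tendsto_one_sub_cpow_mul_log s).comp hzne
  have h2 : Tendsto (fun z : ℂ => z ^ s * H z) (𝓝 1) (𝓝 ((1 : ℂ) ^ s * H 1)) :=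
    (((differentiableAt_id.cpow_const (Or.inl (by simp))).continuousAt (x := (1 : ℂ))).mul
      (hH.differentiableAt (Metric.isOpen_ball.mem_nhds hB)).continuousAt).tendsto
  have h3 := ((continuous_ofReal.tendsto _).comp (tendsto_log_one_sub_exp_sub_log hD)).add_const
    (σ * Real.pi * I / 2 : ℂ)
  have h4 := (h3.add h1).add (h2.comp hz)
  rw [one_cpow, one_mul, gaussLift_regular_at_one hs le_rfl hH hG, add_zero] at h4
  have e : (Real.log (2 * Real.pi * (k + 1)) : ℂ) -
      (digamma (1 - s) + Real.eulerMascheroniConstant) + σ * Real.pi * I / 2 =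
      (Real.log (2 * Real.pi * (k + 1)) : ℂ) + σ * Real.pi * I / 2 +
      -(digamma (1 - s) + Real.eulerMascheroniConstant) := by ring
  rw [e]
  refine h4.congr' ?_
  filter_upwards [self_mem_nhdsWithin, hz (Metric.isOpen_ball.mem_nhds hB)] with ε hε hεB
  have hε' : 0 < ε := hε
  have hpos : 0 < 1 - Real.exp (-(2 * Real.pi * ε)) := by
    rw [sub_pos, Real.exp_lt_one_iff]
    have := Real.pi_pos
    nlinarith [mul_pos this hε']
  have hcut : ((k : ℂ) + 1 + σ * I * ε) / (k + 1) ∈ cutPlane := by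
    change 1 - _ ∈ slitPlane
    rw [hz1]
    right
    have hr : 0 < ε / ((k : ℝ) + 1) := by positivity
    generalize ε / ((k : ℝ) + 1) = r at hr
    rcases hσ with rfl | rfl <;> simp [hr.ne']
  rw [exp_direction_vertical hσ, ← ofReal_one, ← ofReal_sub, ← ofReal_log hpos.le]
  simp only [Function.comp_apply, ofReal_one]
  rw [hG _ hεB hcut, hz1, log_neg_direction hσ (by positivity)]
  push_cast
  ring

end ZetaZeros
-- The boundary identities: one side, mean and difference.
namespace ZetaZeros
open Complex Filter MeasureTheory Set

theorem regularPair_eq {s : ℂ} {D : ℝ} {w : ℂ} {k : ℕ} (hk : ¬ (k : ℝ) + 1 = D) :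
    regularPair s D w k = pairTerm s w k := by
  rw [regularPair, if_neg hk, pairTerm]

theorem intIndicator_of_notMem {D : ℝ} (h : D ∉ range ((↑) : ℤ → ℝ)) : intIndicator D = 0 :=
  indicator_of_notMem h _

theorem intIndicator_of_mem {D : ℝ} (h : D ∈ range ((↑) : ℤ → ℝ)) : intIndicator D = 1 :=
  indicator_of_mem h _

theorem exists_eq_natCast_succ {D : ℝ} (hD : 0 < D) (h : D ∈ range ((↑) : ℤ → ℝ)) :
    ∃ k : ℕ, D = (k : ℝ) + 1 := by
  obtain ⟨m, rfl⟩ := h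
  have hm : 0 < m := by exact_mod_cast hD
  refine ⟨(m - 1).toNat, ?_⟩
  have : ((m - 1).toNat : ℤ) + 1 = m := by omega
  exact_mod_cast this.symm

theorem natCast_succ_mem_range (k : ℕ) : (k : ℝ) + 1 ∈ range ((↑) : ℤ → ℝ) :=
  ⟨k + 1, by push_cast; rfl⟩

/-- The boundary value of `log (1 - q)` plus the sum of the paired terms. -/
theorem tendsto_log_nome_add_pairSum {σ : ℝ} (hσ : σ = 1 ∨ σ = -1) {s : ℂ}
    (hs : ∀ m : ℕ, s ≠ m) {D : ℝ} (hD : 0 < D) :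
    Tendsto (fun ε : ℝ => log (1 - cexp (2 * Real.pi * (σ * I) * (D + σ * I * ε))) +
      pairSum s (D + σ * I * ε)) (𝓝[>] 0)
      (𝓝 (logMean s D + σ * Real.pi * I * (Int.fract D - 1 / 2 + intIndicator D) +
        ∑' k, sidePair σ s D k)) := by
  have hR := tendsto_tsum_regularPair hσ hs hD
  by_cases h : D ∈ range ((↑) : ℤ → ℝ)
  · obtain ⟨k, rfl⟩ := exists_eq_natCast_succ hD h
    have h1 := (tendsto_log_nome_add_gaussLift hσ hs k).add hR
    rw [logMean, if_pos h, intIndicator_of_mem h]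
    have hf : Int.fract ((k : ℝ) + 1) = 0 := by
      rw [Int.fract_add_one, Int.fract_natCast]
    have e : (Real.log (2 * Real.pi * ((k : ℝ) + 1)) : ℂ) -
        (digamma (1 - s) + Real.eulerMascheroniConstant) +
        σ * Real.pi * I * ((Int.fract ((k : ℝ) + 1) : ℝ) - 1 / 2 + 1) =
        (Real.log (2 * Real.pi * ((k : ℝ) + 1)) : ℂ) -
        (digamma (1 - s) + Real.eulerMascheroniConstant) + σ * Real.pi * I / 2 := by
      rw [hf, ofReal_zero]
      ring
    rw [e]
    refine h1.congr fun ε => ?_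
    push_cast
    set w : ℂ := (k : ℂ) + 1 + σ * I * ε
    -- The singular term, removed from the sum, is the one that was paired with the logarithm; it is
    -- put back here.
    have h2 : regularPair s ((k : ℝ) + 1) w = fun j => pairTerm s w j -
        if j = k then gaussLift s (w / (k + 1)) else 0 := by
      funext j
      by_cases hj : j = k
      · subst hj
        rw [regularPair, if_pos rfl, if_pos rfl, pairTerm]
        ring
      · rw [regularPair_eq fun h => hj (by exact_mod_cast add_right_cancel h), if_neg hj, sub_zero]
    have h3 := hasSum_ite_eq k (gaussLift s (w / (k + 1)))
    rw [h2, (summable_pairTerm hs w).tsum_sub h3.summable, h3.tsum_eq, pairSum]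
    ring
  · have h1 := (tendsto_log_nome_of_notMem hσ h).add hR
    rw [logMean, if_neg h, intIndicator_of_notMem h, add_zero]
    refine h1.congr fun ε => ?_
    rw [pairSum]
    congr 1
    exact tsum_congr fun j => regularPair_eq fun he => h (he ▸ natCast_succ_mem_range j)

/-- Obtained from the constancy of `balance` by letting w = D + σiε with ε → 0⁺. -/
theorem boundary_identity {σ : ℝ} (hσ : σ = 1 ∨ σ = -1) {s : ℂ} (hs : ∀ m : ℤ, s ≠ m) {D : ℝ}
    (hD : 0 < D) :
    s * tailSum (σ * I) s D + (D : ℂ) ^ (-s) * (logMean s D + 1 / s + ∑' k, sidePair σ s D k +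
      σ * Real.pi * I * (Int.fract D - 1 / 2 + intIndicator D - D / (1 - s))) =
      -(Real.pi * riemannZeta s * (cos (Real.pi / 2 * s) / sin (Real.pi / 2 * s) - σ * I)) := by
  have hs' : ∀ m : ℕ, s ≠ m := fun m => by simpa using hs m
  have hτ := direction_eq hσ
  have h1 := (tendsto_tailSum_boundary hτ s hD).const_mul s
  have h2 := tendsto_log_nome_add_pairSum hσ hs' hD
  have hv := tendsto_vertical σ D
  have h3 : Tendsto (fun ε : ℝ => ((D : ℂ) + σ * I * ε) ^ (-s)) (𝓝[>] 0) (𝓝 ((D : ℂ) ^ (-s))) :=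
    ((differentiableAt_id.cpow_const (Or.inl (by simpa using hD))).continuousAt
      (x := (D : ℂ))).tendsto.comp hv
  have h4 := (hv.const_mul (Real.pi * (σ * I))).div_const (1 - s)
  have h5 := h1.add (h3.mul ((h2.add_const (1 / s)).sub h4))
  have e : s * tailSum (σ * I) s D + (D : ℂ) ^ (-s) * (logMean s D + 1 / s +
      ∑' k, sidePair σ s D k +
      σ * Real.pi * I * (Int.fract D - 1 / 2 + intIndicator D - D / (1 - s))) =
      s * tailSum (σ * I) s D + (D : ℂ) ^ (-s) * (logMean s D + σ * Real.pi * I *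
        (Int.fract D - 1 / 2 + intIndicator D) + ∑' k, sidePair σ s D k + 1 / s -
          Real.pi * (σ * I) * D / (1 - s)) := by ring
  rw [e]
  refine tendsto_nhds_unique h5 (tendsto_const_nhds.congr' ?_)
  filter_upwards [self_mem_nhdsWithin] with ε hε
  have hε' : 0 < ε := hε
  have hre : 0 < ((D : ℂ) + σ * I * ε).re := by
    rcases hσ with rfl | rfl <;> simpa using hD
  have him : ((σ : ℂ) * I * (D + σ * I * ε)).re < 0 := by
    rcases hσ with rfl | rfl <;> simpa using hε'
  rw [← balance_eq_zeta hσ hs hre him, balance]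

theorem sidePair_sub_sidePair {s : ℂ} (hs : ∀ m : ℕ, s ≠ m) {D : ℝ} (hD : 0 < D) (k : ℕ) :
    sidePair 1 s D k - sidePair (-1) s D k =
      if (k : ℝ) + 1 < D then 2 * Real.pi * I * ((D : ℂ) / (k + 1)) ^ s else 0 := by
  have h0 : (0 : ℝ) < k + 1 := by positivity
  have hneg : -(D / (k + 1)) < 1 := by
    have : 0 < D / (k + 1) := by positivity
    linarith
  rw [sidePair, sidePair, sideLift_of_lt_one _ _ hneg, sideLift_of_lt_one _ _ hneg,
    add_sub_add_right_eq_sub]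
  split_ifs with h1 h2 h2
  · exact absurd h1 h2.ne
  · rw [sub_zero]
  · rw [sideLift_sub_sideLift hs ((one_lt_div h0).mpr h2)]
    push_cast
    rfl
  · have h3 : D / (k + 1) < 1 := by
      rw [div_lt_one h0]
      exact lt_of_le_of_ne (not_lt.mp h2) (Ne.symm h1)
    rw [sideLift_of_lt_one _ _ h3, sideLift_of_lt_one _ _ h3, sub_self]

/-- Only arguments D/(k + 1) > 1 jump. The floor sum also contains k + 1 = D when D is an integer;
that index is left out of the Gauss sum and would contribute 1^s = 1, hence the indicator. -/
theorem tsum_sidePair_sub {s : ℂ} (hs : ∀ m : ℕ, s ≠ m) {D : ℝ} (hD : 0 < D) :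
    ∑' k, sidePair 1 s D k - ∑' k, sidePair (-1) s D k = 2 * Real.pi * I *
      (∑ k ∈ Finset.range ⌊D⌋₊, ((D : ℂ) / (k + 1)) ^ s - intIndicator D) := by
  have hDle : ∀ k : ℕ, k < ⌊D⌋₊ ↔ (k : ℝ) + 1 ≤ D := by
    intro k
    rw [← Nat.succ_le_iff, Nat.le_floor_iff hD.le]
    push_cast
    rfl
  have h1 : ∀ k ∉ Finset.range ⌊D⌋₊, sidePair 1 s D k - sidePair (-1) s D k = 0 := by
    intro k hk
    rw [Finset.mem_range, hDle, not_le] at hk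
    rw [sidePair_sub_sidePair hs hD, if_neg hk.le.not_gt]
  rw [← (summable_sidePair hs hD).tsum_sub (summable_sidePair hs hD), tsum_eq_sum h1,
    Finset.sum_congr rfl fun k _ => sidePair_sub_sidePair hs hD k]
  by_cases h : D ∈ range ((↑) : ℤ → ℝ)
  · obtain ⟨m, rfl⟩ := exists_eq_natCast_succ hD h
    have hm : ⌊(m : ℝ) + 1⌋₊ = m + 1 := by exact_mod_cast Nat.floor_natCast (m + 1)
    have hm0 : (m : ℂ) + 1 ≠ 0 := Nat.cast_add_one_ne_zero m
    rw [hm, Finset.sum_range_succ, if_neg (lt_irrefl _), add_zero, Finset.sum_range_succ,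
      intIndicator_of_mem h]
    push_cast
    rw [div_self hm0, one_cpow, add_sub_cancel_right, Finset.mul_sum]
    refine Finset.sum_congr rfl fun k hk => if_pos ?_
    have : k < m := Finset.mem_range.mp hk
    exact_mod_cast Nat.succ_lt_succ this
  · rw [intIndicator_of_notMem h, sub_zero, Finset.mul_sum]
    refine Finset.sum_congr rfl fun k hk => if_pos ?_
    refine lt_of_le_of_ne ((hDle k).mp (Finset.mem_range.mp hk)) ?_
    rintro rfl
    exact h (natCast_succ_mem_range k)

theorem tsum_sidePair_eq_mean {σ : ℝ} (hσ : σ = 1 ∨ σ = -1) {s : ℂ} (hs : ∀ m : ℕ, s ≠ m) {D : ℝ}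
    (hD : 0 < D) :
    ∑' k, sidePair σ s D k = (∑' k, sidePair 1 s D k + ∑' k, sidePair (-1) s D k) / 2 +
      σ * Real.pi * I *
        (∑ k ∈ Finset.range ⌊D⌋₊, ((D : ℂ) / (k + 1)) ^ s - intIndicator D) := by
  have h := tsum_sidePair_sub hs hD
  rcases hσ with rfl | rfl
  · push_cast
    linear_combination h / 2
  · push_cast
    linear_combination -h / 2

/-- The mean of the two boundary identities. -/
theorem boundary_identity_mean {s : ℂ} (hs : ∀ m : ℤ, s ≠ m) {D : ℝ} (hD : 0 < D) :
    s / 2 * (tailSum I s D + tailSum (-I) s D) + (D : ℂ) ^ (-s) * (logMean s D + 1 / s +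
      (∑' k, sidePair 1 s D k + ∑' k, sidePair (-1) s D k) / 2) =
      -(Real.pi * riemannZeta s * (cos (Real.pi / 2 * s) / sin (Real.pi / 2 * s))) := by
  have h1 := boundary_identity (Or.inl rfl) hs hD
  have h2 := boundary_identity (Or.inr rfl) hs hD
  rw [ofReal_one, one_mul] at h1
  rw [ofReal_neg, ofReal_one, neg_one_mul] at h2
  linear_combination (h1 + h2) / 2

/-- The difference of the two boundary identities. -/
theorem boundary_identity_sub {s : ℂ} (hs : ∀ m : ℤ, s ≠ m) {D : ℝ} (hD : 0 < D) :
    s / (2 * Real.pi * I) * (tailSum I s D - tailSum (-I) s D) +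
      (D : ℂ) ^ (-s) * (Int.fract D - 1 / 2 - D / (1 - s) +
        ∑ k ∈ Finset.range ⌊D⌋₊, ((D : ℂ) / (k + 1)) ^ s) = riemannZeta s := by
  have h1 := boundary_identity (Or.inl rfl) hs hD
  have h2 := boundary_identity (Or.inr rfl) hs hD
  have h3 := tsum_sidePair_sub (fun m => by simpa using hs m) hD
  rw [ofReal_one, one_mul] at h1
  rw [ofReal_neg, ofReal_one, neg_one_mul] at h2
  have hπ : (2 * Real.pi * I : ℂ) ≠ 0 := by simp [Real.pi_ne_zero]
  refine mul_left_cancel₀ hπ ?_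
  rw [mul_add, ← mul_assoc, mul_div_cancel₀ _ hπ]
  linear_combination h1 - h2 - (D : ℂ) ^ (-s) * h3

end ZetaZeros
-- The tails as ₁F₂ and Gamma terms.
namespace ZetaZeros
open Complex Filter MeasureTheory Set

theorem factorial_two_mul_eq (n : ℕ) :
    ((2 * n).factorial : ℂ) = 4 ^ n * n.factorial * (ascPochhammer ℂ n).eval (1 / 2) := by
  induction n with
  | zero => simp
  | succ n ih =>
    rw [show 2 * (n + 1) = 2 * n + 1 + 1 by ring, Nat.factorial_succ, Nat.factorial_succ,
      Nat.factorial_succ, ascPochhammer_succ_eval]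
    push_cast
    rw [ih]
    ring

theorem factorial_two_mul_add_one_eq (n : ℕ) :
    ((2 * n + 1).factorial : ℂ) = 4 ^ n * n.factorial * (ascPochhammer ℂ n).eval (3 / 2) := by
  induction n with
  | zero => simp
  | succ n ih =>
    rw [show 2 * (n + 1) + 1 = 2 * n + 1 + 1 + 1 by ring, Nat.factorial_succ, Nat.factorial_succ,
      Nat.factorial_succ n, ascPochhammer_succ_eval]
    push_cast
    rw [ih]
    ring

theorem lowerSeries_even_term {τ s : ℂ} (hτ : τ * τ = -1) (hs : ∀ m : ℕ, s ≠ m) (y : ℂ) (n : ℕ) :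
    (τ * y) ^ (2 * n) / ((2 * n).factorial * ((2 * n : ℕ) - s)) = -(1 / s) *
      ((ascPochhammer ℂ n).eval (-s / 2) /
        ((ascPochhammer ℂ n).eval (1 / 2) * (ascPochhammer ℂ n).eval (1 - s / 2)) *
          ((-(y ^ 2 / 4)) ^ n / n.factorial)) := by
  have hs0 : s ≠ 0 := by simpa using hs 0
  have h1 : ((2 * n : ℕ) : ℂ) - s ≠ 0 := sub_ne_zero.mpr (hs (2 * n)).symm
  have hb : ∀ m : ℕ, -s / 2 + m ≠ 0 := fun m hm => hs (2 * m) (by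
    push_cast; linear_combination -2 * hm)
  have h2 := ascPochhammer_ratio hb n
  have h3 : (ascPochhammer ℂ n).eval (1 / 2) ≠ 0 := by
    have h := Nat.cast_ne_zero (R := ℂ) |>.mpr (2 * n).factorial_ne_zero
    rw [factorial_two_mul_eq] at h
    exact right_ne_zero_of_mul h
  have h4 := Nat.cast_ne_zero (R := ℂ) |>.mpr n.factorial_ne_zero
  have h5 := hb n
  rw [show -s / 2 + 1 = 1 - s / 2 by ring] at h2
  have e : (τ * y) ^ (2 * n) = (-1) ^ n * y ^ (2 * n) := by
    rw [mul_pow, pow_mul τ, sq, hτ]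
  have e2 : (-(y ^ 2 / 4)) ^ n = (-1) ^ n * y ^ (2 * n) / 4 ^ n := by
    rw [neg_pow, div_pow, ← pow_mul]
    ring
  have e3 : (ascPochhammer ℂ n).eval (-s / 2) /
        ((ascPochhammer ℂ n).eval (1 / 2) * (ascPochhammer ℂ n).eval (1 - s / 2)) =
      (-s / 2 / (-s / 2 + n)) / (ascPochhammer ℂ n).eval (1 / 2) := by
    rw [← h2]
    ring
  rw [e, e2, e3, factorial_two_mul_eq, show -s / 2 + n = ((2 * n : ℕ) - s) / 2 by push_cast; ring]
  field_simp

theorem lowerSeries_odd_term {τ s : ℂ} (hτ : τ * τ = -1) (hs : ∀ m : ℕ, s ≠ m) (y : ℂ) (n : ℕ) :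
    (τ * y) ^ (2 * n + 1) / ((2 * n + 1).factorial * ((2 * n + 1 : ℕ) - s)) = τ * y / (1 - s) *
      ((ascPochhammer ℂ n).eval ((1 - s) / 2) /
        ((ascPochhammer ℂ n).eval (3 / 2) * (ascPochhammer ℂ n).eval (1 + (1 - s) / 2)) *
          ((-(y ^ 2 / 4)) ^ n / n.factorial)) := by
  have hs1 : 1 - s ≠ 0 := sub_ne_zero.mpr (by simpa using (hs 1).symm)
  have h1 : ((2 * n + 1 : ℕ) : ℂ) - s ≠ 0 := sub_ne_zero.mpr (hs (2 * n + 1)).symm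
  have hb : ∀ m : ℕ, (1 - s) / 2 + m ≠ 0 := fun m hm => hs (2 * m + 1) (by
    push_cast; linear_combination -2 * hm)
  have h2 := ascPochhammer_ratio hb n
  have h3 : (ascPochhammer ℂ n).eval (3 / 2) ≠ 0 := by
    have h := Nat.cast_ne_zero (R := ℂ) |>.mpr (2 * n + 1).factorial_ne_zero
    rw [factorial_two_mul_add_one_eq] at h
    exact right_ne_zero_of_mul h
  have h4 := Nat.cast_ne_zero (R := ℂ) |>.mpr n.factorial_ne_zero
  rw [add_comm _ (1 : ℂ)] at h2
  have e : (τ * y) ^ (2 * n + 1) = τ * y * ((-1) ^ n * y ^ (2 * n)) := by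
    rw [pow_succ, mul_pow, pow_mul τ, sq, hτ]
    ring
  have e2 : (-(y ^ 2 / 4)) ^ n = (-1) ^ n * y ^ (2 * n) / 4 ^ n := by
    rw [neg_pow, div_pow, ← pow_mul]
    ring
  have e3 : (ascPochhammer ℂ n).eval ((1 - s) / 2) /
        ((ascPochhammer ℂ n).eval (3 / 2) * (ascPochhammer ℂ n).eval (1 + (1 - s) / 2)) =
      ((1 - s) / 2 / ((1 - s) / 2 + n)) / (ascPochhammer ℂ n).eval (3 / 2) := by
    rw [← h2]
    ring
  rw [e, e2, e3, factorial_two_mul_add_one_eq,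
    show (1 - s) / 2 + n = ((2 * n + 1 : ℕ) - s) / 2 by push_cast; ring]
  field_simp

/-- Splitting by parity, (2n)! and (2n + 1)! supply the parameters 1/2 and 3/2, and 1/(m - s)
supplies the pair of Pochhammer symbols differing by 1. The odd part carries the factor τ and so
changes sign with it. -/
theorem lowerSeries_eq_oneFTwo {τ s : ℂ} (hτ : τ * τ = -1) (hs : ∀ m : ℕ, s ≠ m) (y : ℂ) :
    lowerSeries s (τ * y) = -(1 / s) * oneFTwo (-s / 2) (1 / 2) (1 - s / 2) (-(y ^ 2 / 4)) +
      τ * y / (1 - s) *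
        oneFTwo ((1 - s) / 2) (3 / 2) (1 + (1 - s) / 2) (-(y ^ 2 / 4)) := by
  have h := summable_lowerSeries hs (τ * y)
  have h2 : ∀ n, (fun m : ℕ => (τ * y) ^ m / (m.factorial * (m - s))) (2 * n) = _ :=
    fun n => lowerSeries_even_term hτ hs y n
  have h3 : ∀ n, (fun m : ℕ => (τ * y) ^ m / (m.factorial * (m - s))) (2 * n + 1) = _ :=
    fun n => lowerSeries_odd_term hτ hs y n
  rw [lowerSeries, oneFTwo, oneFTwo, ← tsum_mul_left, ← tsum_mul_left]
  generalize (fun m : ℕ => (τ * y) ^ m / (m.factorial * (m - s))) = f at h h2 h3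
  have h0 : Summable fun n => f (2 * n) :=
    h.comp_injective (i := fun n : ℕ => 2 * n) fun a b hab => by simpa using hab
  have h1 : Summable fun n => f (2 * n + 1) :=
    h.comp_injective (i := fun n : ℕ => 2 * n + 1) fun a b hab => by simpa using hab
  rw [← tsum_even_add_odd h0 h1]
  exact congrArg₂ (· + ·) (tsum_congr h2) (tsum_congr h3)

/-- The value of `expTail` at a positive real number, as a combination of `₁F₂` values. -/
theorem expTail_eq_oneFTwo {σ : ℝ} (hσ : σ = 1 ∨ σ = -1) {s : ℂ} (hs : ∀ m : ℕ, s ≠ m) {D : ℝ}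
    (hD : 0 < D) (k : ℕ) :
    s * expTail (freq k) (σ * I) (-s - 1) D =
      -((cos (Real.pi / 2 * s) - σ * I * sin (Real.pi / 2 * s)) * (freq k : ℂ) ^ s *
        Gamma (1 - s)) +
      (D : ℂ) ^ (-s) * (oneFTwo (-s / 2) (1 / 2) (1 - s / 2)
          (-((Real.pi : ℂ) ^ 2 * (D : ℂ) ^ 2 * ((k : ℂ) + 1) ^ 2)) -
        σ * I * (s * (freq k * D) / (1 - s)) *
          oneFTwo ((1 - s) / 2) (3 / 2) (1 + (1 - s) / 2)
            (-((Real.pi : ℂ) ^ 2 * (D : ℂ) ^ 2 * ((k : ℂ) + 1) ^ 2))) := by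
  have hτ := direction_eq hσ
  have hs0 : s ≠ 0 := by simpa using hs 0
  have h := cpow_mul_lowerSeries_add_expTail hτ hs (two_lt_freq k) hD
  have hΓ : Gamma (1 - s) = -s * Gamma (-s) := by
    rw [← Gamma_add_one (-s) (neg_ne_zero.mpr hs0)]
    ring_nf
  have ey : -(((freq k : ℂ) * D) ^ 2 / 4) =
      -((Real.pi : ℂ) ^ 2 * (D : ℂ) ^ 2 * ((k : ℂ) + 1) ^ 2) := by
    rw [freq]
    push_cast
    ring
  rw [show (freq k : ℂ) * (σ * I) * D = (σ * I) * (freq k * D) by ring,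
    lowerSeries_eq_oneFTwo (mul_self_eq_neg_one hτ) hs, ey, direction_cpow_neg hσ] at h
  rw [hΓ, eq_sub_of_add_eq' h]
  field_simp
  ring

theorem ofReal_freq_cpow (k : ℕ) (s : ℂ) :
    (freq k : ℂ) ^ s = (2 * Real.pi) ^ s * ((k : ℂ) + 1) ^ s := by
  have h := ofReal_mul_cpow (r := 2 * Real.pi) (by positivity) (Nat.cast_add_one_ne_zero k) s
  rw [freq]
  push_cast at h ⊢
  exact h

theorem ofReal_mul_cpow_ofReal {a d : ℝ} (ha : 0 < a) (hd : 0 < d) (s : ℂ) :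
    ((a * d : ℝ) : ℂ) ^ s = (a : ℂ) ^ s * (d : ℂ) ^ s := by
  rw [ofReal_mul, ofReal_mul_cpow ha (ofReal_ne_zero.mpr hd.ne')]

/-- In the mean over τ = ±i the odd ₁F₂ and the sine cancel. -/
theorem cosineTerm_eq {s : ℂ} (hs : ∀ m : ℕ, s ≠ m) {a d : ℝ} (ha : a ≠ 0) (hd : 0 < d) (k : ℕ) :
    cosineTerm a d (k + 1) s = ((|a| : ℝ) : ℂ) ^ s *
      (s / 2 * (tailTerm I s (|a| * d : ℝ) k + tailTerm (-I) s (|a| * d : ℝ) k)) := by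
  have ha' : 0 < |a| := abs_pos.mpr ha
  have hD : 0 < |a| * d := mul_pos ha' hd
  have h1 := expTail_eq_oneFTwo (Or.inl rfl) hs hD k
  have h2 := expTail_eq_oneFTwo (Or.inr rfl) hs hD k
  simp only [ofReal_one, one_mul, ofReal_neg, neg_one_mul] at h1 h2
  have hk : (k : ℂ) + 1 ≠ 0 := Nat.cast_add_one_ne_zero k
  have hac : ((|a| : ℝ) : ℂ) ≠ 0 := ofReal_ne_zero.mpr ha'.ne'
  have hdc : (d : ℂ) ≠ 0 := ofReal_ne_zero.mpr hd.ne'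
  have hπ : (2 * Real.pi : ℂ) ≠ 0 := by simp [Real.pi_ne_zero]
  have ez : (Real.pi : ℂ) ^ 2 * ((|a| * d : ℝ) : ℂ) ^ 2 * ((k : ℂ) + 1) ^ 2 =
      (Real.pi : ℂ) ^ 2 * (a : ℂ) ^ 2 * (d : ℂ) ^ 2 * (((k + 1 : ℕ)) : ℂ) ^ 2 := by
    have : ((|a| : ℝ) : ℂ) ^ 2 = (a : ℂ) ^ 2 := by rw [← ofReal_pow, sq_abs, ofReal_pow]
    push_cast
    rw [mul_pow, this]
    ring
  rw [ez, ofReal_freq_cpow, ofReal_mul_cpow_ofReal ha' hd] at h1 h2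
  have hpa : ((|a| : ℝ) : ℂ) ^ s ≠ 0 := by simp [cpow_eq_zero_iff, hac]
  have hpd : (d : ℂ) ^ s ≠ 0 := by simp [cpow_eq_zero_iff, hdc]
  have hpk : ((k : ℂ) + 1) ^ s ≠ 0 := by simp [cpow_eq_zero_iff, hk]
  have hpπ : (2 * Real.pi : ℂ) ^ s ≠ 0 := by simp [cpow_eq_zero_iff, Real.pi_ne_zero]
  rw [cpow_neg, cpow_neg] at h1 h2
  rw [cosineTerm, tailTerm, tailTerm, ← add_div, mul_div_assoc', show s / 2 *
    (expTail (freq k) I (-s - 1) (|a| * d : ℝ) + expTail (freq k) (-I) (-s - 1) (|a| * d : ℝ)) =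
    (s * expTail (freq k) I (-s - 1) (|a| * d : ℝ) +
      s * expTail (freq k) (-I) (-s - 1) (|a| * d : ℝ)) / 2 by ring, h1, h2, cpow_neg,
    Nat.cast_add_one, cpow_sub _ _ hk, cpow_one]
  generalize oneFTwo _ _ _ _ = F
  generalize oneFTwo _ _ _ _ = G
  generalize ((|a| : ℝ) : ℂ) ^ s = A at hpa
  generalize (d : ℂ) ^ s = B at hpd
  generalize ((k : ℂ) + 1) ^ s = C at hpk
  generalize (2 * Real.pi : ℂ) ^ s = E at hpπ
  generalize cos (Real.pi / 2 * s) = u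
  generalize sin (Real.pi / 2 * s) = v
  field_simp
  ring

/-- The entire function of `s` that agrees with the sine terms. -/
noncomputable def sineTail (a d : ℝ) (k : ℕ) (s : ℂ) : ℂ :=
  (a : ℂ) ^ s * (s / (4 * Real.pi * I) *
    (tailTerm I s (a * d : ℝ) k - tailTerm (-I) s (a * d : ℝ) k))

/-- In the difference over τ = ±i the even ₁F₂ and the cosine cancel. -/
theorem sineFormula_eq {s : ℂ} (hs : ∀ m : ℕ, s ≠ m) {a d : ℝ} (ha : 0 < a) (hd : 0 < d) (k : ℕ) :
    sineFormula a d (k + 1) s = sineTail a d k s := by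
  have hD : 0 < a * d := mul_pos ha hd
  have h1 := expTail_eq_oneFTwo (Or.inl rfl) hs hD k
  have h2 := expTail_eq_oneFTwo (Or.inr rfl) hs hD k
  simp only [ofReal_one, one_mul, ofReal_neg, neg_one_mul] at h1 h2
  have hs1 : 1 - s ≠ 0 := sub_ne_zero.mpr (by simpa using (hs 1).symm)
  have hk : (k : ℂ) + 1 ≠ 0 := Nat.cast_add_one_ne_zero k
  have hac : (a : ℂ) ≠ 0 := ofReal_ne_zero.mpr ha.ne'
  have hdc : (d : ℂ) ≠ 0 := ofReal_ne_zero.mpr hd.ne'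
  have hπ' : (Real.pi : ℂ) ≠ 0 := ofReal_ne_zero.mpr Real.pi_ne_zero
  have hπ : (2 * Real.pi : ℂ) ≠ 0 := by simp [Real.pi_ne_zero]
  have ez : (Real.pi : ℂ) ^ 2 * ((a * d : ℝ) : ℂ) ^ 2 * ((k : ℂ) + 1) ^ 2 =
      (Real.pi : ℂ) ^ 2 * (a : ℂ) ^ 2 * (d : ℂ) ^ 2 * (((k + 1 : ℕ)) : ℂ) ^ 2 := by
    push_cast
    ring
  rw [ez, ofReal_freq_cpow, ofReal_mul_cpow_ofReal ha hd] at h1 h2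
  have hpa : (a : ℂ) ^ s ≠ 0 := by simp [cpow_eq_zero_iff, hac]
  have hpd : (d : ℂ) ^ s ≠ 0 := by simp [cpow_eq_zero_iff, hdc]
  have hpk : ((k : ℂ) + 1) ^ s ≠ 0 := by simp [cpow_eq_zero_iff, hk]
  have hpπ : (2 * Real.pi : ℂ) ^ s ≠ 0 := by simp [cpow_eq_zero_iff, Real.pi_ne_zero]
  rw [cpow_neg, cpow_neg] at h1 h2
  rw [sineFormula, sineTail, tailTerm, tailTerm, ← sub_div, mul_div_assoc',
    show s / (4 * Real.pi * I) *
    (expTail (freq k) I (-s - 1) (a * d : ℝ) - expTail (freq k) (-I) (-s - 1) (a * d : ℝ)) =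
    (s * expTail (freq k) I (-s - 1) (a * d : ℝ) -
      s * expTail (freq k) (-I) (-s - 1) (a * d : ℝ)) / (4 * Real.pi * I) by ring, h1, h2,
    Nat.cast_add_one, cpow_sub _ _ hk, cpow_one, cpow_sub _ _ hdc, cpow_one, cpow_sub _ _ hπ,
    cpow_one, freq]
  generalize oneFTwo _ _ _ _ = F
  generalize oneFTwo _ _ _ _ = G
  generalize (a : ℂ) ^ s = A at hpa
  generalize (d : ℂ) ^ s = B at hpd
  generalize ((k : ℂ) + 1) ^ s = C at hpk
  generalize (2 * Real.pi : ℂ) ^ s = E at hpπ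
  generalize cos (Real.pi / 2 * s) = u
  generalize sin (Real.pi / 2 * s) = v
  have hI := I_ne_zero
  push_cast
  field_simp
  ring

theorem direction_mul_ofReal_re_le (D : ℝ) : (I * (D : ℂ)).re ≤ 0 ∧ (-I * (D : ℂ)).re ≤ 0 := by
  simp

theorem differentiable_sineTail {a d : ℝ} (ha : 0 < a) (hd : 0 < d) (k : ℕ) :
    Differentiable ℂ (sineTail a d k) := by
  have hD : 0 < ((a * d : ℝ) : ℂ).re := by rw [ofReal_re]; positivity
  have hac : (a : ℂ) ≠ 0 := ofReal_ne_zero.mpr ha.ne'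
  have h1 := (differentiable_expTail_exponent (Or.inl rfl) (two_lt_freq k) hD).div_const
    ((k : ℂ) + 1)
  have h2 := (differentiable_expTail_exponent (Or.inr rfl) (two_lt_freq k) hD).div_const
    ((k : ℂ) + 1)
  have h3 : Differentiable ℂ fun s : ℂ => (a : ℂ) ^ s :=
    differentiable_id.const_cpow (Or.inl hac)
  exact h3.mul ((differentiable_id.div_const _).mul (h1.sub h2))

theorem eventually_ne_intCast (s : ℂ) : ∀ᶠ t : ℂ in 𝓝[≠] s, ∀ m : ℤ, t ≠ m := by
  have hc : IsClosed (range ((↑) : ℤ → ℂ) \ {s}) := by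
    have h := isClosedEmbedding_intCast.isClosedMap
      (((↑) : ℤ → ℂ) ⁻¹' {s}ᶜ) (isClosed_discrete _)
    rwa [image_preimage_eq_range_inter, inter_comm, ← sdiff_eq_compl_inter] at h
  have h1 : (range ((↑) : ℤ → ℂ) \ {s})ᶜ ∈ 𝓝 s := hc.isOpen_compl.mem_nhds (by simp)
  filter_upwards [mem_nhdsWithin_of_mem_nhds h1, self_mem_nhdsWithin] with t ht hts m hm
  exact ht ⟨⟨m, hm.symm⟩, hts⟩

/-- As `sineTail` is entire, it supplies the limiting values at 2, 3, …. At s = 0, which the parity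
formulas do not cover, both sides vanish. -/
theorem sineTerm_eq {s : ℂ} (hs : s ≠ 1) {a d : ℝ} (ha : 0 < a) (hd : 0 < d) (k : ℕ) :
    sineTerm a d (k + 1) s = sineTail a d k s := by
  rw [sineTerm]
  split_ifs with h
  · refine Tendsto.limUnder_eq ?_
    refine ((differentiable_sineTail ha hd k s).continuousAt.tendsto.mono_left
      nhdsWithin_le_nhds).congr' ?_
    filter_upwards [eventually_ne_intCast s] with t ht
    exact (sineFormula_eq (fun m => by simpa using ht m) ha hd k).symm
  · by_cases h0 : s = 0
    · subst h0
      simp [sineFormula, sineTail]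
    · refine sineFormula_eq (fun m hm => ?_) ha hd k
      rcases m with _ | _ | m
      · exact h0 (by simpa using hm)
      · exact hs (by simpa using hm)
      · exact h ⟨m + 1 + 1, by omega, hm⟩

theorem hasSum_sineTerm {s : ℂ} (hs : s ≠ 1) {a d : ℝ} (ha : 0 < a) (hd : 0 < d) :
    HasSum (fun k : ℕ => sineTerm a d (k + 1) s) ((a : ℂ) ^ s * (s / (4 * Real.pi * I) *
      (tailSum I s (a * d : ℝ) - tailSum (-I) s (a * d : ℝ)))) := by
  have hD : 0 < ((a * d : ℝ) : ℂ).re := by rw [ofReal_re]; positivity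
  have hle := direction_mul_ofReal_re_le (a * d)
  simp only [sineTerm_eq hs ha hd]
  exact (((summable_tailTerm (Or.inl rfl) s hD hle.1).hasSum.sub
    (summable_tailTerm (Or.inr rfl) s hD hle.2).hasSum).mul_left _).mul_left _

theorem hasSum_cosineTerm {s : ℂ} (hs : ∀ m : ℕ, s ≠ m) {a d : ℝ} (ha : a ≠ 0) (hd : 0 < d) :
    HasSum (fun k : ℕ => cosineTerm a d (k + 1) s) (((|a| : ℝ) : ℂ) ^ s * (s / 2 *
      (tailSum I s (|a| * d : ℝ) + tailSum (-I) s (|a| * d : ℝ)))) := by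
  have hD : 0 < ((|a| * d : ℝ) : ℂ).re := by
    rw [ofReal_re]
    exact mul_pos (abs_pos.mpr ha) hd
  have hle := direction_mul_ofReal_re_le (|a| * d)
  simp only [cosineTerm_eq hs ha hd]
  exact (((summable_tailTerm (Or.inl rfl) s hD hle.1).hasSum.add
    (summable_tailTerm (Or.inr rfl) s hD hle.2).hasSum).mul_left _).mul_left _

end ZetaZeros
-- The remainder integral, the Hurwitz term and the two equivalences.
namespace ZetaZeros
open Complex Filter MeasureTheory Set

theorem ofReal_div_succ_cpow {D : ℝ} (hD : 0 < D) (s : ℂ) (k : ℕ) :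
    ((D : ℂ) / (k + 1)) ^ s = (D : ℂ) ^ s * (1 / ((k : ℂ) + 1) ^ s) := by
  have hk : (0 : ℝ) < k + 1 := by positivity
  have h := ofReal_mul_cpow_ofReal (div_pos hD hk) hk s
  rw [div_mul_cancel₀ _ hk.ne'] at h
  push_cast at h
  have h0 : ((k : ℂ) + 1) ^ s ≠ 0 := by simp [cpow_eq_zero_iff, Nat.cast_add_one_ne_zero k]
  rw [h]
  field_simp

theorem sum_ofReal_div_succ_cpow {D : ℝ} (hD : 0 < D) (s : ℂ) (n : ℕ) :
    ∑ k ∈ Finset.range n, ((D : ℂ) / (k + 1)) ^ s =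
      (D : ℂ) ^ s * ∑ k ∈ Finset.range n, 1 / ((k : ℂ) + 1) ^ s := by
  rw [Finset.mul_sum]
  exact Finset.sum_congr rfl fun k _ => ofReal_div_succ_cpow hD s k

theorem ofReal_cpow_neg_mul_cpow {D : ℝ} (hD : 0 < D) (s : ℂ) : (D : ℂ) ^ (-s) * (D : ℂ) ^ s = 1 := by
  rw [← cpow_add _ _ (ofReal_ne_zero.mpr hD.ne')]
  simp

/-- Both sides are continuous at every s ≠ 1, the tail sums being entire in s, so
`boundary_identity_sub` extends to the remaining integers. The Gauss sums, singular there, have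
already dropped out. -/
theorem zeta_eq_tailSum_sub {s : ℂ} (hs : s ≠ 1) {D : ℝ} (hD : 0 < D) :
    s / (2 * Real.pi * I) * (tailSum I s D - tailSum (-I) s D) +
      (D : ℂ) ^ (-s) * (Int.fract D - 1 / 2 - D / (1 - s)) +
        ∑ k ∈ Finset.range ⌊D⌋₊, 1 / ((k : ℂ) + 1) ^ s = riemannZeta s := by
  have hDre : 0 < (D : ℂ).re := hD
  have hDc : (D : ℂ) ≠ 0 := ofReal_ne_zero.mpr hD.ne'
  have hle := direction_mul_ofReal_re_le D
  have h1 := differentiable_tailSum (Or.inl rfl) hDre hle.1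
  have h2 := differentiable_tailSum (Or.inr rfl) hDre hle.2
  have hs1 : 1 - s ≠ 0 := sub_ne_zero.mpr hs.symm
  have hL : ContinuousAt (fun s : ℂ => s / (2 * Real.pi * I) * (tailSum I s D - tailSum (-I) s D) +
      (D : ℂ) ^ (-s) * (Int.fract D - 1 / 2 - D / (1 - s)) +
        ∑ k ∈ Finset.range ⌊D⌋₊, 1 / ((k : ℂ) + 1) ^ s) s := by
    refine DifferentiableAt.continuousAt (𝕜 := ℂ) ?_
    have h3 : DifferentiableAt ℂ (fun s : ℂ => (D : ℂ) ^ (-s)) s :=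
      differentiableAt_id.neg.const_cpow (Or.inl hDc)
    have h4 : DifferentiableAt ℂ (fun s : ℂ => (D : ℂ) / (1 - s)) s :=
      DifferentiableAt.fun_div (by fun_prop) (by fun_prop) hs1
    have h5 : DifferentiableAt ℂ
        (fun s : ℂ => ∑ k ∈ Finset.range ⌊D⌋₊, 1 / ((k : ℂ) + 1) ^ s) s := by
      refine DifferentiableAt.fun_sum fun k _ => ?_
      have hk : ((k : ℂ) + 1) ≠ 0 := Nat.cast_add_one_ne_zero k
      refine (differentiableAt_const _).fun_div (differentiableAt_id.const_cpow (Or.inl hk)) ?_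
      simp [cpow_eq_zero_iff, hk]
    exact (((differentiableAt_id.div_const _).fun_mul ((h1 s).fun_sub (h2 s))).fun_add
      (h3.fun_mul (h4.const_sub _))).fun_add h5
  have hR : ContinuousAt riemannZeta s := (differentiableAt_riemannZeta hs).continuousAt
  refine tendsto_nhds_unique ((hL.tendsto.mono_left nhdsWithin_le_nhds).congr' ?_)
    (hR.tendsto.mono_left (nhdsWithin_le_nhds (s := {s}ᶜ)))
  filter_upwards [eventually_ne_intCast s] with t ht
  rw [← boundary_identity_sub ht hD, sum_ofReal_div_succ_cpow hD]
  linear_combination (-∑ k ∈ Finset.range ⌊D⌋₊, 1 / ((k : ℂ) + 1) ^ t) *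
    ofReal_cpow_neg_mul_cpow hD t

theorem intervalIntegrable_floor_mul_cpow (a : ℝ) (ha : 0 < a) (p : ℂ) {x y : ℝ} (hx : 0 < x)
    (hy : 0 < y) :
    IntervalIntegrable (fun t : ℝ => ((⌊a * t⌋ : ℤ) : ℂ) * (t : ℂ) ^ p) volume x y := by
  have h1 : IntervalIntegrable (fun t : ℝ => ((⌊a * t⌋ : ℤ) : ℝ)) volume x y :=
    Monotone.intervalIntegrable fun t u htu => by
      have : ⌊a * t⌋ ≤ ⌊a * u⌋ := Int.floor_mono (by gcongr)
      exact_mod_cast this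
  have h2 : IntervalIntegrable (fun t : ℝ => ((⌊a * t⌋ : ℤ) : ℂ)) volume x y := by
    have h3 : IntervalIntegrable (fun t : ℝ => (((⌊a * t⌋ : ℤ) : ℝ) : ℂ)) volume x y :=
      ⟨h1.1.ofReal, h1.2.ofReal⟩
    simpa using h3
  refine h2.mul_continuousOn fun t ht => ContinuousAt.continuousWithinAt ?_
  have ht0 : 0 < t := (lt_min hx hy).trans_le ht.1
  exact continuousAt_ofReal_cpow_const t p (Or.inr ht0.ne')

theorem hasDerivAt_ofReal_cpow_neg (s : ℂ) {t : ℝ} (ht : 0 < t) :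
    HasDerivAt (fun t : ℝ => (t : ℂ) ^ (-s)) (-s * (t : ℂ) ^ (-s - 1)) t := by
  have h := ((hasDerivAt_id' (t : ℂ)).cpow_const (c := -s) (Or.inl (by simpa using ht))).comp_ofReal
  exact h.congr_deriv (mul_one _)

theorem mul_integral_floor_mul_cpow (s : ℂ) {b : ℝ} (hb : 0 < b) :
    s * ∫ t in (1 : ℝ)..b, ((⌊t⌋ : ℤ) : ℂ) * (t : ℂ) ^ (-s - 1) =
      ∑ k ∈ Finset.range ⌊b⌋₊, 1 / ((k : ℂ) + 1) ^ s - ⌊b⌋₊ * (b : ℂ) ^ (-s) := by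
  rcases lt_or_ge b 1 with hb1 | hb1
  · rw [Nat.floor_eq_zero.mpr hb1, intervalIntegral.integral_symm,
      intervalIntegral.integral_of_le hb1.le, integral_Ioc_eq_integral_Ioo,
      setIntegral_eq_zero_of_forall_eq_zero]
    · simp
    · intro t ht
      rw [Int.floor_eq_zero_iff.mpr ⟨(hb.trans ht.1).le, ht.2⟩]
      simp
  -- Abel summation of the coefficients 1 over k ≥ 1. Setting c 0 = 0 makes the partial sums up to n
  -- equal to n, matching the floor.
  · set c : ℕ → ℂ := fun k => if k = 0 then 0 else 1
    have hc : ∀ n : ℕ, ∑ k ∈ Finset.Icc 0 n, c k = n := by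
      intro n
      rw [← Nat.range_succ_eq_Icc_zero, Finset.sum_range_succ']
      simp [c]
    have hd : ∀ t ∈ Icc 1 b, HasDerivAt (fun t : ℝ => (t : ℂ) ^ (-s)) (-s * (t : ℂ) ^ (-s - 1)) t :=
      fun t ht => hasDerivAt_ofReal_cpow_neg s (by linarith [ht.1])
    have hint : IntegrableOn (deriv fun t : ℝ => (t : ℂ) ^ (-s)) (Icc 1 b) := by
      have hcont : ContinuousOn (fun t : ℝ => -s * (t : ℂ) ^ (-s - 1)) (Icc 1 b) := fun t ht =>
        ((continuousAt_ofReal_cpow_const t (-s - 1)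
          (Or.inr (by linarith [ht.1]))).const_mul _).continuousWithinAt
      exact (hcont.integrableOn_Icc).congr_fun (fun t ht => (hd t ht).deriv.symm) measurableSet_Icc
    have h := sum_mul_eq_sub_integral_mul₀ (f := fun t : ℝ => (t : ℂ) ^ (-s)) c (by simp [c]) b
      (fun t ht => (hd t ht).differentiableAt) hint
    simp only [hc] at h
    rw [← Nat.range_succ_eq_Icc_zero, Finset.sum_range_succ'] at h
    have h1 : ∫ t in Ioc 1 b, deriv (fun t : ℝ => (t : ℂ) ^ (-s)) t * (⌊t⌋₊ : ℂ) =
        -(s * ∫ t in (1 : ℝ)..b, ((⌊t⌋ : ℤ) : ℂ) * (t : ℂ) ^ (-s - 1)) := by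
      rw [intervalIntegral.integral_of_le hb1, ← neg_mul, ← integral_const_mul]
      refine setIntegral_congr_fun measurableSet_Ioc fun t ht => ?_
      rw [(hd t ⟨ht.1.le, ht.2⟩).deriv, ← ofReal_natCast ⌊t⌋₊,
        natCast_floor_eq_intCast_floor (zero_le_one.trans ht.1.le), ofReal_intCast]
      ring
    have h2 : ∑ k ∈ Finset.range ⌊b⌋₊, 1 / ((k : ℂ) + 1) ^ s =
        ∑ k ∈ Finset.range ⌊b⌋₊, ((((k + 1 : ℕ) : ℝ) : ℂ) ^ (-s)) * c (k + 1) := by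
      refine Finset.sum_congr rfl fun k _ => ?_
      simp [c, cpow_neg]
    have h3 : c 0 = 0 := if_pos rfl
    rw [h1, ← h2, h3] at h
    linear_combination -h

theorem remainder_zero_eq {a d : ℝ} (ha : 0 < a) (hd : 0 < d) (s : ℂ) :
    remainder a 0 d s = ⌊a * d⌋₊ * (d : ℂ) ^ (-s) -
      (a : ℂ) ^ s * ∑ k ∈ Finset.range ⌊a * d⌋₊, 1 / ((k : ℂ) + 1) ^ s := by
  have hac : (a : ℂ) ≠ 0 := ofReal_ne_zero.mpr ha.ne'
  rw [remainder]
  simp only [Int.fract_zero, add_zero, sub_zero]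
  have hi := fun {x y : ℝ} (hx : 0 < x) (hy : 0 < y) =>
    intervalIntegrable_floor_mul_cpow a ha (-s - 1) hx hy
  have ha' : 0 < 1 / a := by positivity
  -- The two integrals from 1 combine into one from d to 1/a, which the substitution t = ax carries
  -- to one from ad to 1.
  rw [intervalIntegral.integral_interval_sub_left (hi one_pos ha') (hi one_pos hd),
    intervalIntegral.integral_symm]
  have h1 : ∫ x in (1 / a)..d, ((⌊a * x⌋ : ℤ) : ℂ) * (x : ℂ) ^ (-s - 1) =
      ∫ x in (1 / a)..d, (a : ℂ) ^ (s + 1) *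
        (((⌊a * x⌋ : ℤ) : ℂ) * ((a * x : ℝ) : ℂ) ^ (-s - 1)) := by
    refine intervalIntegral.integral_congr fun x hx => ?_
    have hx0 : 0 < x := (lt_min ha' hd).trans_le hx.1
    have h2 : (a : ℂ) ^ (s + 1) * (a : ℂ) ^ (-s - 1) = 1 := by
      rw [← cpow_add _ _ hac]
      simp
    rw [ofReal_mul_cpow_ofReal ha hx0]
    linear_combination (-((⌊a * x⌋ : ℤ) : ℂ) * (x : ℂ) ^ (-s - 1)) * h2
  rw [h1, intervalIntegral.integral_const_mul, intervalIntegral.integral_comp_mul_left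
    (f := fun t : ℝ => ((⌊t⌋ : ℤ) : ℂ) * (t : ℂ) ^ (-s - 1)) ha.ne', mul_one_div_cancel ha.ne',
    real_smul, ofReal_inv, cpow_add _ _ hac, cpow_one]
  have h3 := mul_integral_floor_mul_cpow s (mul_pos ha hd)
  rw [ofReal_mul_cpow_ofReal ha hd] at h3
  have h4 := ofReal_cpow_neg_mul_cpow ha s
  generalize (∫ t in (1 : ℝ)..a * d, ((⌊t⌋ : ℤ) : ℂ) * (t : ℂ) ^ (-s - 1)) = J at h3
  have h5 : (a : ℂ) * (a : ℂ)⁻¹ = 1 := mul_inv_cancel₀ hac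
  linear_combination (-s * (a : ℂ) ^ s * J) * h5 - (a : ℂ) ^ s * h3 +
    (⌊a * d⌋₊ * (d : ℂ) ^ (-s)) * h4

theorem zeta_eq_zero_iff_sineTerm {s : ℂ} (hs : s ≠ 1) {a d : ℝ} (ha : 0 < a) (hd : 0 < d) :
    riemannZeta s = 0 ↔
      1 / 2 * (((d : ℂ) * (a * s / (1 - s)) + 1 / 2) * (d : ℂ) ^ (-s) + remainder a 0 d s) =
        ∑' k : ℕ, sineTerm a d (k + 1) s := by
  have hD : 0 < a * d := mul_pos ha hd
  have hac : (a : ℂ) ≠ 0 := ofReal_ne_zero.mpr ha.ne'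
  have hpa : (a : ℂ) ^ s ≠ 0 := by simp [cpow_eq_zero_iff, hac]
  have hs1 : 1 - s ≠ 0 := sub_ne_zero.mpr hs.symm
  have h := zeta_eq_tailSum_sub hs hD
  have h4 := ofReal_cpow_neg_mul_cpow ha s
  have hfl : (⌊a * d⌋₊ : ℂ) = a * d - Int.fract (a * d) := by
    rw [← ofReal_natCast, natCast_floor_eq_intCast_floor hD.le, ← Int.self_sub_fract]
    push_cast
    ring
  rw [ofReal_mul_cpow_ofReal ha hd] at h
  -- The exact discrepancy between the two sides is a^s ζ(s)/2, and a^s never vanishes.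
  have key : ∑' k : ℕ, sineTerm a d (k + 1) s -
      1 / 2 * (((d : ℂ) * (a * s / (1 - s)) + 1 / 2) * (d : ℂ) ^ (-s) + remainder a 0 d s) =
      1 / 2 * (a : ℂ) ^ s * riemannZeta s := by
    rw [(hasSum_sineTerm hs ha hd).tsum_eq, remainder_zero_eq ha hd, hfl, ← h]
    have e : s / (4 * Real.pi * I) = s / (2 * Real.pi * I) / 2 := by
      have hπ : (Real.pi : ℂ) ≠ 0 := ofReal_ne_zero.mpr Real.pi_ne_zero
      have hI := I_ne_zero
      field_simp
      ring
    have e2 : (d : ℂ) * (a * s / (1 - s)) = a * d / (1 - s) - a * d := by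
      field_simp
      ring
    rw [e, e2, ofReal_mul]
    linear_combination (-(d : ℂ) ^ (-s) * ((Int.fract (a * d) : ℝ) - 1 / 2 - a * d / (1 - s)) / 2) * h4
  rw [eq_comm (b := ∑' k : ℕ, sineTerm a d (k + 1) s), ← sub_eq_zero (a := ∑' k : ℕ, _), key]
  simp [hpa]

/-- The Hurwitz value at n omits precisely the terms of ζ that the jumps of the Gauss sum supply, so
the two combine to ζ(s). -/
theorem floor_succ_of_isLeast {D : ℝ} (hD : 0 ≤ D) {n : ℕ} (hn : IsLeast {m : ℕ | D < m} n) :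
    n - 1 = ⌊D⌋₊ := by
  have h1 : ⌊D⌋₊ < n := (Nat.floor_lt hD).mpr hn.1
  have h2 : n ≤ ⌊D⌋₊ + 1 := hn.2 (by
    change D < ((⌊D⌋₊ + 1 : ℕ) : ℝ)
    push_cast
    exact Nat.lt_floor_add_one D)
  omega

/-- A change of sign of a merely exchanges the indices k and -k, so the pair depends on |a|d alone.
-/
theorem gaussTerm_pair_eq {σ : ℝ} {s : ℂ} {a d : ℝ} (ha : a ≠ 0) (hd : 0 < d) (k : ℕ) :
    gaussTerm σ a d s (k + 1) + gaussTerm σ a d s (-(k + 1)) = sidePair σ s (|a| * d) k := by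
  have hk : (0 : ℝ) < k + 1 := by positivity
  have e : ∀ j : ℤ, gaussTerm σ a d s j =
      if (j : ℝ) = a * d then 0 else sideLift σ s (a * d / j) := fun j => rfl
  rw [e, e, sidePair]
  push_cast
  rw [div_neg]
  rcases ha.lt_or_gt with ha | ha
  · have hn : a * d < 0 := mul_neg_of_neg_of_pos ha hd
    have h1 : ¬ (k : ℝ) + 1 = a * d := by linarith
    have h2 : -((k : ℝ) + 1) = a * d ↔ (k : ℝ) + 1 = |a| * d := by
      rw [abs_of_neg ha, neg_mul, neg_eq_iff_eq_neg]
    have h3 : |a| * d / (k + 1) = -(a * d / (k + 1)) := by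
      rw [abs_of_neg ha]
      ring
    rw [if_neg h1, h3, neg_neg, add_comm]
    congr 1
    exact if_congr h2 rfl rfl
  · have hp : 0 < a * d := mul_pos ha hd
    have h2 : ¬ -((k : ℝ) + 1) = a * d := by linarith
    rw [if_neg h2, abs_of_pos ha]

theorem mem_range_intCast_abs_mul (a d : ℝ) :
    |a| * d ∈ range ((↑) : ℤ → ℝ) ↔ a * d ∈ range ((↑) : ℤ → ℝ) := by
  rcases abs_choice a with h | h
  · rw [h]
  · rw [h, neg_mul]
    constructor
    · rintro ⟨m, hm⟩
      exact ⟨-m, by push_cast; linarith⟩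
    · rintro ⟨m, hm⟩
      exact ⟨-m, by push_cast; linarith⟩

theorem sin_sq_abs_mul (a d : ℝ) :
    Real.sin (Real.pi * (|a| * d)) ^ 2 = Real.sin (Real.pi * (a * d)) ^ 2 := by
  rcases abs_choice a with h | h
  · rw [h]
  · rw [h, neg_mul, mul_neg, Real.sin_neg, neg_sq]

theorem logMean_eq {s : ℂ} (hs : ∀ m : ℤ, s ≠ m) {a d : ℝ} (ha : a ≠ 0) (hd : 0 < d) :
    logMean s (|a| * d) = Real.log 2 + (1 - intIndicator (a * d)) *
        (Real.log (Real.sin (Real.pi * (a * d)) ^ 2) / 2) +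
      intIndicator (a * d) * (1 / s - (digamma (1 + s) + Real.eulerMascheroniConstant) -
        Real.pi * cot (Real.pi * s) + 1 / 2 * Real.log ((Real.pi * a * d) ^ 2)) := by
  rw [logMean]
  by_cases h : a * d ∈ range ((↑) : ℤ → ℝ)
  · rw [if_pos ((mem_range_intCast_abs_mul a d).mpr h), intIndicator_of_mem h, sub_eq_add_neg,
      digamma_reflection hs]
    have hD : 0 < |a| * d := mul_pos (abs_pos.mpr ha) hd
    have h1 : (Real.pi * a * d) ^ 2 = (Real.pi * (|a| * d)) ^ 2 := by
      rw [mul_pow, mul_pow, mul_pow, mul_pow, sq_abs]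
      ring
    rw [h1, Real.log_pow (n := 2) (x := Real.pi * (|a| * d)), mul_assoc 2 Real.pi, Real.log_mul two_ne_zero (by positivity)]
    push_cast
    ring
  · rw [if_neg fun h' => h ((mem_range_intCast_abs_mul a d).mp h'), intIndicator_of_notMem h,
      sin_sq_abs_mul]
    ring

theorem zeta_eq_zero_iff_cosineTerm {s : ℂ} (hs : ∀ m : ℤ, s ≠ m) {a d : ℝ} (ha : a ≠ 0)
    (hd : 0 < d) {n : ℕ} (hn : IsLeast {m : ℕ | |a| * d < m} n) {σ : ℝ} (hσ : σ = 1 ∨ σ = -1) :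
    riemannZeta s = 0 ↔
      (Real.log 2 : ℂ) / (d : ℂ) ^ s +
        (1 - intIndicator (a * d)) *
          ((Real.log (Real.sin (Real.pi * (a * d)) ^ 2) : ℂ) / (2 * (d : ℂ) ^ s)) +
        1 / (s * (d : ℂ) ^ s) +
        1 / (d : ℂ) ^ s * intIndicator (a * d) *
          (1 / s - (digamma (1 + s) + (Real.eulerMascheroniConstant : ℂ)) -
            Real.pi * cot (Real.pi * s) + σ * I * Real.pi +
            1 / 2 * (Real.log ((Real.pi * a * d) ^ 2) : ℂ)) +
        1 / (d : ℂ) ^ s *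
          ∑' k : ℕ, (gaussTerm σ a d s (k + 1) + gaussTerm σ a d s (-(k + 1))) +
        σ * I * Real.pi * ((|a| : ℝ) : ℂ) ^ s * hurwitzNat s n =
      -∑' k : ℕ, cosineTerm a d (k + 1) s := by
  have hs' : ∀ m : ℕ, s ≠ m := fun m => by simpa using hs m
  have ha' : 0 < |a| := abs_pos.mpr ha
  have hD : 0 < |a| * d := mul_pos ha' hd
  have hs0 : s ≠ 0 := by simpa using hs 0
  have hdc : (d : ℂ) ≠ 0 := ofReal_ne_zero.mpr hd.ne'
  have hpd : (d : ℂ) ^ s ≠ 0 := by simp [cpow_eq_zero_iff, hdc]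
  have hac : ((|a| : ℝ) : ℂ) ≠ 0 := ofReal_ne_zero.mpr ha'.ne'
  have hpa : ((|a| : ℝ) : ℂ) ^ s ≠ 0 := by simp [cpow_eq_zero_iff, hac]
  have hsin := sin_pi_div_two_mul_ne_zero hs
  have hind : intIndicator (|a| * d) = intIndicator (a * d) := by
    by_cases h : a * d ∈ range ((↑) : ℤ → ℝ)
    · rw [intIndicator_of_mem h, intIndicator_of_mem ((mem_range_intCast_abs_mul a d).mpr h)]
    · rw [intIndicator_of_notMem h,
        intIndicator_of_notMem fun h' => h ((mem_range_intCast_abs_mul a d).mp h')]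
  have h1 := boundary_identity_mean hs hD
  rw [logMean_eq hs ha hd] at h1
  have h2 := tsum_sidePair_eq_mean hσ hs' hD
  rw [sum_ofReal_div_succ_cpow hD, hind] at h2
  rw [cpow_neg, ofReal_mul_cpow_ofReal ha' hd] at h1
  rw [ofReal_mul_cpow_ofReal ha' hd] at h2
  -- This number is (σi)^{-s} divided by the sine, and a power with nonzero base does not vanish.
  have hfac : cos (Real.pi / 2 * s) / sin (Real.pi / 2 * s) - σ * I ≠ 0 := by
    rw [div_sub' hsin]
    refine div_ne_zero ?_ hsin
    have h3 : ((σ : ℂ) * I) ^ (-s) ≠ 0 := by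
      simp [cpow_eq_zero_iff, direction_ne_zero (direction_eq hσ)]
    rw [direction_cpow_neg hσ] at h3
    rwa [mul_comm (sin _)]
  rw [tsum_congr fun k => gaussTerm_pair_eq ha hd k, h2, (hasSum_cosineTerm hs' ha hd).tsum_eq,
    hurwitzNat, floor_succ_of_isLeast hD.le hn, ← sub_eq_zero (b := -_)]
  rw [← eq_sub_iff_add_eq] at h1
  rw [h1]
  generalize cos (Real.pi / 2 * s) / sin (Real.pi / 2 * s) = c at hfac
  generalize (∑' k, sidePair 1 s (|a| * d) k + ∑' k, sidePair (-1) s (|a| * d) k) / 2 = M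
  generalize ∑ k ∈ Finset.range ⌊|a| * d⌋₊, 1 / ((k : ℂ) + 1) ^ s = S
  generalize intIndicator (a * d) = χ
  generalize digamma (1 + s) = ψ
  generalize cot (Real.pi * s) = κ
  generalize (d : ℂ) ^ s = B at hpd
  generalize ((|a| : ℝ) : ℂ) ^ s = A at hpa
  generalize (Real.log 2 : ℂ) = l1
  generalize (Real.log (Real.sin (Real.pi * (a * d)) ^ 2) : ℂ) = l2
  generalize (Real.log ((Real.pi * a * d) ^ 2) : ℂ) = l3
  -- The difference of the two sides is ζ(s) times a nonzero factor. The finite zeta sums and the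
  -- indicator terms with σπi cancel in the computation that follows.
  have key : ∀ x y : ℂ, x = -(A * Real.pi * (c - σ * I)) * y → (y = 0 ↔ x = 0) := by
    intro x y hxy
    have hπ : (Real.pi : ℂ) ≠ 0 := ofReal_ne_zero.mpr Real.pi_ne_zero
    have hne : -(A * Real.pi * (c - σ * I)) ≠ 0 :=
      neg_ne_zero.mpr (mul_ne_zero (mul_ne_zero hpa hπ) hfac)
    rw [hxy, mul_eq_zero]
    simp [hne]
  refine key _ _ ?_
  field_simp
  ring

end ZetaZeros
-- Assembly of both statements.
theorem mainTheorem10 :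
    (∀ ρ : ℂ, ρ ≠ 1 → ∀ a d : ℝ, 0 < a → 0 < d →
      Summable (fun k : ℕ => ZetaZeros.sineTerm a d (k + 1) ρ) ∧
      (riemannZeta ρ = 0 ↔
        1 / 2 * (((d : ℂ) * (a * ρ / (1 - ρ)) + 1 / 2) * (d : ℂ) ^ (-ρ) +
            ZetaZeros.remainder a 0 d ρ) =
          ∑' k : ℕ, ZetaZeros.sineTerm a d (k + 1) ρ)) ∧
    (∀ ρ : ℂ, (∀ m : ℤ, ρ ≠ m) → ∀ a d : ℝ, a ≠ 0 → 0 < d →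
      ∀ n : ℕ, IsLeast {m : ℕ | |a| * d < m} n → ∀ σ : ℝ, (σ = 1 ∨ σ = -1) →
      Summable (fun k : ℕ => ZetaZeros.gaussTerm σ a d ρ (k + 1) +
        ZetaZeros.gaussTerm σ a d ρ (-(k + 1))) ∧
      Summable (fun k : ℕ => ZetaZeros.cosineTerm a d (k + 1) ρ) ∧
      (riemannZeta ρ = 0 ↔
        (Real.log 2 : ℂ) / (d : ℂ) ^ ρ +
          (1 - ZetaZeros.intIndicator (a * d)) *
            ((Real.log (Real.sin (Real.pi * (a * d)) ^ 2) : ℂ) / (2 * (d : ℂ) ^ ρ)) +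
          1 / (ρ * (d : ℂ) ^ ρ) +
          1 / (d : ℂ) ^ ρ * ZetaZeros.intIndicator (a * d) *
            (1 / ρ - (Complex.digamma (1 + ρ) + (Real.eulerMascheroniConstant : ℂ)) -
              Real.pi * Complex.cot (Real.pi * ρ) + σ * Complex.I * Real.pi +
              1 / 2 * (Real.log ((Real.pi * a * d) ^ 2) : ℂ)) +
          1 / (d : ℂ) ^ ρ *
            ∑' k : ℕ, (ZetaZeros.gaussTerm σ a d ρ (k + 1) +
              ZetaZeros.gaussTerm σ a d ρ (-(k + 1))) +
          σ * Complex.I * Real.pi * ((|a| : ℝ) : ℂ) ^ ρ * ZetaZeros.hurwitzNat ρ n =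
        -∑' k : ℕ, ZetaZeros.cosineTerm a d (k + 1) ρ)) := by
  refine ⟨fun ρ hρ a d ha hd => ⟨(ZetaZeros.hasSum_sineTerm hρ ha hd).summable,
    ZetaZeros.zeta_eq_zero_iff_sineTerm hρ ha hd⟩, fun ρ hρ a d ha hd n hn σ hσ => ?_⟩
  have hρ' : ∀ m : ℕ, ρ ≠ m := fun m => by simpa using hρ m
  refine ⟨?_, (ZetaZeros.hasSum_cosineTerm hρ' ha hd).summable,
    ZetaZeros.zeta_eq_zero_iff_cosineTerm hρ ha hd hn hσ⟩
  exact (ZetaZeros.summable_sidePair hρ' (mul_pos (abs_pos.mpr ha) hd)).congr fun k =>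
    (ZetaZeros.gaussTerm_pair_eq ha hd k).symm
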